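/- For an integer $N\ge 1$ let $a^\dagger$ and $a$ be the creation and annihilation operators truncated to the first $N$ Fock levels $|0\rangle,\dots,|N-1\rangle$: $a^\dagger|j\rangle=\sqrt{j+1}\,|j+1\rangle$ and $a|j\rangle=\sqrt{j}\,|j-1\rangle$, where $|n\rangle=0$ for $n>N-1$. Consider the Lindbladians $$\mathcal L_{\mathrm{up}}(\rho)=\tfrac1N\big(a^\dagger\rho a-\tfrac12(aa^\dagger\rho+\rho aa^\dagger)\big),\qquad \mathcal L_{\mathrm{down}}(\rho)=\tfrac1N\big(a\rho a^\dagger-\tfrac12(a^\dagger a\rho+\rho a^\dagger a)\big).$$ There is an absolute constant $C>0$ such that for every $N\ge 1$, every time $t>0$, every $\epsilon>0$, and each $\mathcal L\in\{\mathcal L_{\mathrm{up}},\mathcal L_{\mathrm{down}}\}$, there is a quantum circuit of at most $$C\,\max\Big\{\frac{t^2\log N}{\epsilon},\ \log N,\ \log^2(1/\epsilon)\Big\}$$ two-qubit gates (arbitrary unitaries on pairs of qubits; the level $j$ is stored in binary in $\lceil\log_2N\rceil$ qubits, and any number of ancilla qubits, initially $|0\rangle$ and finally traced out, may be used) that implements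 a quantum operation $\mathcal E$ with $\|\mathcal E-e^{\mathcal L t}\|_\diamond<\epsilon$. In particular $O(t^2\log N/\epsilon)$ two-qubit gates suffice whenever $t^2/\epsilon\ge1$ and $t^2\log N/\epsilon\ge\log^2(1/\epsilon)$; this covers all $N\ge2$, $t\ge1$, $0<\epsilon\le1$, and, for every fixed $t>0$ and $N\ge 2$, all sufficiently small $\epsilon$. -/

import Mathlib

open scoped ENNReal Matrix

noncomputable section

/-! ### The truncated oscillator and its Lindbladians -/

/-- The annihilation operator on the first `N` Fock levels: `a|j⟩ = √j |j-1⟩`. -/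
def annihilationOp (N : ℕ) : Matrix (Fin N) (Fin N) ℂ :=
  fun i j => if (i : ℕ) + 1 = j then (Real.sqrt (j : ℕ) : ℂ) else 0

/-- The creation operator on the first `N` Fock levels: `a†|j⟩ = √(j+1) |j+1⟩`, where
`|n⟩ = 0` if `n > N - 1`. -/
def creationOp (N : ℕ) : Matrix (Fin N) (Fin N) ℂ :=
  fun i j => if (i : ℕ) = j + 1 then (Real.sqrt ((j : ℕ) + 1) : ℂ) else 0

theorem annihilationOp_conjTranspose (N : ℕ) : (annihilationOp N)ᴴ = creationOp N := by
  ext i j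
  simp only [annihilationOp, creationOp, Matrix.conjTranspose_apply]
  by_cases h : (i : ℕ) = j + 1
  · simp [h]
  · simp [h, Ne.symm h]

/-- The Lindbladian with zero Hamiltonian and the single Lindblad operator `L`:
`ρ ↦ L ρ L† - (L† L ρ + ρ L† L) / 2`. -/
def dissipator {n : Type*} [Fintype n] (L : Matrix n n ℂ) : Matrix n n ℂ →ₗ[ℂ] Matrix n n ℂ where
  toFun ρ := L * ρ * Lᴴ - (1 / 2 : ℂ) • (Lᴴ * L * ρ + ρ * (Lᴴ * L))
  map_add' ρ σ := by
    simp only [Matrix.mul_add, Matrix.add_mul, smul_add]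
    abel
  map_smul' c ρ := by
    simp only [Matrix.mul_smul, Matrix.smul_mul, RingHom.id_apply, smul_sub, smul_add,
      smul_comm c (1 / 2 : ℂ)]

/-- `ρ ↦ (a† ρ a - (a a† ρ + ρ a a†) / 2) / N`, of Lindblad operator `a† / √N`. -/
def lindbladUp (N : ℕ) : Matrix (Fin N) (Fin N) ℂ →ₗ[ℂ] Matrix (Fin N) (Fin N) ℂ :=
  (1 / (N : ℂ)) • dissipator (creationOp N)

/-- `ρ ↦ (a ρ a† - (a† a ρ + ρ a† a) / 2) / N`, of Lindblad operator `a / √N`. -/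
def lindbladDown (N : ℕ) : Matrix (Fin N) (Fin N) ℂ →ₗ[ℂ] Matrix (Fin N) (Fin N) ℂ :=
  (1 / (N : ℂ)) • dissipator (annihilationOp N)

/-- The exponential of a superoperator, as the exponential of its matrix in the basis of the
matrix units. -/
def superExp {n : Type*} [Fintype n] [DecidableEq n] (T : Matrix n n ℂ →ₗ[ℂ] Matrix n n ℂ) :
    Matrix n n ℂ →ₗ[ℂ] Matrix n n ℂ :=
  Matrix.toLin (Matrix.stdBasis ℂ n n) (Matrix.stdBasis ℂ n n)
    (NormedSpace.exp (LinearMap.toMatrix (Matrix.stdBasis ℂ n n) (Matrix.stdBasis ℂ n n) T))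

/-! ### The diamond norm -/

/-- The trace norm: the sum of the singular values. -/
def traceNorm {n : Type*} [Fintype n] [DecidableEq n] (X : Matrix n n ℂ) : ℝ :=
  ∑ i, Real.sqrt ((Matrix.isHermitian_conjTranspose_mul_self X).eigenvalues i)

/-- `(T ⊗ I)(X)`, where `I` is the identity superoperator on matrices indexed by `r`. -/
def ampliation {m k : Type*} (r : Type*) (T : Matrix m m ℂ →ₗ[ℂ] Matrix k k ℂ)
    (X : Matrix (m × r) (m × r) ℂ) : Matrix (k × r) (k × r) ℂ :=
  fun p p' => T (fun i i' => X (i, p.2) (i', p'.2)) p.1 p'.1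

/-- The diamond norm: the supremum of `‖(T ⊗ I)(X)‖₁` over all `X` with `‖X‖₁ = 1`, where the
dimension of the reference system is that of the input of `T`. -/
def diamondNorm {m k : Type*} [Fintype m] [DecidableEq m] [Fintype k] [DecidableEq k]
    (T : Matrix m m ℂ →ₗ[ℂ] Matrix k k ℂ) : ℝ≥0∞ :=
  ⨆ (X : Matrix (m × m) (m × m) ℂ) (_ : traceNorm X = 1),
    ENNReal.ofReal (traceNorm (ampliation m T X))

/-! ### Quantum circuits -/

/-- An arbitrary unitary acting on an ordered pair of distinct qubits of a register whose qubits
are labelled by `ι`. -/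
structure TwoQubitGate (ι : Type*) where
  fst : ι
  snd : ι
  fst_ne_snd : fst ≠ snd
  unitary : Matrix.unitaryGroup (Bool × Bool) ℂ

/-- The matrix of a gate on the whole register, which is the identity on all other qubits. The
computational basis states of the register are the functions `ι → Bool`. -/
def TwoQubitGate.toMatrix {ι : Type*} [Fintype ι] [DecidableEq ι] (g : TwoQubitGate ι) :
    Matrix (ι → Bool) (ι → Bool) ℂ :=
  fun x y =>
    if ∀ i, i ≠ g.fst → i ≠ g.snd → x i = y i then
      (g.unitary : Matrix (Bool × Bool) (Bool × Bool) ℂ) (x g.fst, x g.snd) (y g.fst, y g.snd)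
    else 0

/-- A circuit is a list of two-qubit gates, the head being applied first; its size is its length. -/
abbrev QCircuit (ι : Type*) := List (TwoQubitGate ι)

/-- The unitary that a circuit applies to its register. -/
def QCircuit.toMatrix {ι : Type*} [Fintype ι] [DecidableEq ι] (c : QCircuit ι) :
    Matrix (ι → Bool) (ι → Bool) ℂ :=
  c.foldl (fun M g => g.toMatrix * M) 1

/-- The binary encoding of the level `j` in `⌈log₂ N⌉` qubits. -/
def levelBits (N : ℕ) (j : Fin N) : Fin (Nat.clog 2 N) → Bool :=
  fun i => (j : ℕ).testBit i

theorem levelBits_injective (N : ℕ) : Function.Injective (levelBits N) := by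
  intro j k h
  have hN : N ≤ 2 ^ Nat.clog 2 N := Nat.le_pow_clog (by norm_num) N
  apply Fin.ext
  apply Nat.eq_of_testBit_eq
  intro i
  by_cases hi : i < Nat.clog 2 N
  · exact congrFun h ⟨i, hi⟩
  · have hp : 2 ^ Nat.clog 2 N ≤ 2 ^ i := Nat.pow_le_pow_right (by norm_num) (not_lt.mp hi)
    rw [Nat.testBit_lt_two_pow (lt_of_lt_of_le j.2 (hN.trans hp)),
      Nat.testBit_lt_two_pow (lt_of_lt_of_le k.2 (hN.trans hp))]

/-- Conjugation `ρ ↦ V ρ V†`. -/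
def conjBy {m k : Type*} [Fintype m] (V : Matrix k m ℂ) :
    Matrix m m ℂ →ₗ[ℂ] Matrix k k ℂ where
  toFun ρ := V * ρ * Vᴴ
  map_add' ρ σ := by simp only [Matrix.mul_add, Matrix.add_mul]
  map_smul' c ρ := by simp only [Matrix.mul_smul, Matrix.smul_mul, RingHom.id_apply]

/-- The isometry from the `N`-level system into `⌈log₂ N⌉` qubits, `|j⟩ ↦ |levelBits j⟩`. -/
def encodeIsometry (N : ℕ) : Matrix (Fin (Nat.clog 2 N) → Bool) (Fin N) ℂ :=
  fun s j => if s = levelBits N j then 1 else 0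

/-- The isometry `|j⟩ ↦ |levelBits j⟩ |0…0⟩` that adjoins `q` ancilla qubits. -/
def encodeWithAncilla (N q : ℕ) : Matrix (Fin (Nat.clog 2 N) ⊕ Fin q → Bool) (Fin N) ℂ :=
  fun x j => if x = Sum.elim (levelBits N j) (fun _ => false) then 1 else 0

/-- The partial trace over the qubits labelled by `κ`. -/
def traceAncilla {ι κ : Type*} [Fintype κ] [DecidableEq κ] :
    Matrix (ι ⊕ κ → Bool) (ι ⊕ κ → Bool) ℂ →ₗ[ℂ] Matrix (ι → Bool) (ι → Bool) ℂ where
  toFun M := Matrix.of fun s s' => ∑ z : κ → Bool, M (Sum.elim s z) (Sum.elim s' z)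
  map_add' M M' := by
    ext s s'
    simp [Finset.sum_add_distrib]
  map_smul' c M := by
    ext s s'
    simp [Finset.mul_sum]

/-- The quantum operation implemented by a circuit: encode the system in qubits, adjoin ancillas
in the state `|0⟩`, apply the gates and trace out the ancillas. -/
def QCircuit.channel (N q : ℕ) (c : QCircuit (Fin (Nat.clog 2 N) ⊕ Fin q)) :
    Matrix (Fin N) (Fin N) ℂ →ₗ[ℂ]
      Matrix (Fin (Nat.clog 2 N) → Bool) (Fin (Nat.clog 2 N) → Bool) ℂ :=
  traceAncilla ∘ₗ conjBy (QCircuit.toMatrix c * encodeWithAncilla N q)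

/-- The Lindbladian `T` on an `N`-level system can be simulated for time `t` within error `ε`,
in diamond norm, using at most `G` two-qubit gates. -/
def SimulableWithin (N : ℕ) (T : Matrix (Fin N) (Fin N) ℂ →ₗ[ℂ] Matrix (Fin N) (Fin N) ℂ)
    (t ε G : ℝ) : Prop :=
  ∃ (q : ℕ) (c : QCircuit (Fin (Nat.clog 2 N) ⊕ Fin q)),
    (c.length : ℝ) ≤ G ∧
      diamondNorm (QCircuit.channel N q c - conjBy (encodeIsometry N) ∘ₗ superExp ((t : ℂ) • T)) <
        ENNReal.ofReal ε

end

/-!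
For `N = 1` both Lindbladians vanish. For `N ≥ 2` both are dissipators of a ladder operator
`L = S * diag e`, where `S` shifts the level by `± 1` and `e j = √((j + d) / N) ≤ 1`
(`lindbladUp_eq`, `lindbladDown_eq`, `IsLadder`).

*Time steps.* The time is divided into `M` steps of length `τ = s²`. In one step a flag qubit is
rotated by an angle `α j` that depends on the level `j`, the level is shifted if the flag is set,
and the same is repeated with angles `β j` and a second flag, controlled by the first one.
Discarding the flags leaves the three Kraus operators `stepKraus`: no jump, one jump, two jumps.
With `α = s e - (s e)³ / 12` and `β = s e / √2` they are, up to terms that contribute to order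
`τ³`, the operators `1 - τD/2 + τ²D²/8`, `√τ (L - τ (DL + LD) / 4)` and `τ L² / √2`, where
`D = L†L`. These reproduce `exp (τ 𝓛)` up to `O(τ³)` (`kraus_second_order_identity`,
`norm_stepKraus_sub_le`), also if the angles carry errors of order `s⁵` and `s³`. Since the step
and the semigroup are contractions, the errors of `M` steps add up to `O(M τ³) = O(t τ²)`
(`norm_superCLM_pow_sub_superExp_le`).

*Norms.* By the duality between the trace norm and the operator norm, superoperators act on
matrices with the trace norm as bounded operators (`superCLM`), and the diamond norm is at most the
operator norm of the ampliation (`diamondNorm_conjBy_comp_le`). The exponential of a superoperator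
thus becomes an exponential in a Banach algebra.

*Circuits.* Approximations of `α j` and `β j` are linear combinations of `y = ⌊√z⌋` and `y z`,
where `z` is `(j + d) / 2ⁿ` with `2b` binary digits and `n = ⌈log₂ N⌉`. Obtaining `z` costs `O(n)`
gates, the digit-by-digit root and the products of digits cost `O(b²)`. Such a Boolean computation
is run on clean ancilla qubits, its results control elementary rotations, and it is undone
(`Program.exists_circuit`, `cleanCost_rotation`). A step takes `O(n + b²)` gates
(`implementable_step`), and fresh ancilla qubits in each step make the operation a power of the
Kraus map (`Implementable.pow`).

*Cost.* With `u = t / ε`, steps of length of order `u ^ (-1 / 2)` make the error less than `ε`, and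
`b` of order `log u` suffices. The number of gates is of order `t √u (log N + log² u)`. The square
of the logarithm is absorbed by the spare factor `√u`, so that this is
`O(t u log N) = O(t² log N / ε)`; a single step costs `O(log N + log² (1 / ε))` (`exists_steps`). If `ε > 2` or `t ≤ ε / 8`,
then the identity is close enough to the semigroup.
-/

set_option linter.unusedSectionVars false

noncomputable section

open scoped Matrix.Norms.L2Operator ComplexOrder
open Matrix

/-! ### The trace norm -/

section TraceNorm

variable {n m : Type*} [Fintype n] [DecidableEq n] [Fintype m] [DecidableEq m]

/-- An entry of a product is bounded by the operator norm and a column norm. -/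
theorem norm_mul_apply_le (A Y : Matrix n n ℂ) (i j : n) :
    ‖(A * Y) i j‖ ≤ ‖A‖ * ‖(WithLp.toLp 2 (fun k => Y k j) : EuclideanSpace ℂ n)‖ := by
  have h := A.l2_opNorm_mulVec (WithLp.toLp 2 (fun k => Y k j))
  refine le_trans ?_ h
  have h2 := PiLp.norm_apply_le (p := 2)
    (WithLp.toLp 2 (A *ᵥ fun k => Y k j) : EuclideanSpace ℂ n) i
  simpa [Matrix.mul_apply, Matrix.mulVec, dotProduct] using h2

/-- The columns of `X V`, where `V` diagonalizes `X†X`, are orthogonal with the singular values of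
`X` as norms. -/
theorem conjTranspose_mul_self_eigenvectorUnitary (X : Matrix n n ℂ) :
    (X * ((isHermitian_conjTranspose_mul_self X).eigenvectorUnitary : Matrix n n ℂ))ᴴ *
      (X * ((isHermitian_conjTranspose_mul_self X).eigenvectorUnitary : Matrix n n ℂ)) =
      diagonal (fun i => (((isHermitian_conjTranspose_mul_self X).eigenvalues i : ℝ) : ℂ)) := by
  set h := isHermitian_conjTranspose_mul_self X
  have h1 := h.spectral_theorem
  set V := (h.eigenvectorUnitary : Matrix n n ℂ) with hV
  have hVV : Vᴴ * V = 1 := by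
    have := Unitary.coe_star_mul_self h.eigenvectorUnitary
    simpa [star_eq_conjTranspose] using this
  rw [Unitary.conjStarAlgAut_apply] at h1
  rw [conjTranspose_mul]
  calc Vᴴ * Xᴴ * (X * V) = Vᴴ * (Xᴴ * X) * V := by simp only [Matrix.mul_assoc]
    _ = Vᴴ * (V * diagonal (RCLike.ofReal ∘ h.eigenvalues) * Vᴴ) * V := by
        conv_lhs => rw [h1]
        simp [star_eq_conjTranspose, hV]
    _ = (Vᴴ * V) * diagonal (RCLike.ofReal ∘ h.eigenvalues) * (Vᴴ * V) := by
        simp only [Matrix.mul_assoc]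
    _ = _ := by rw [hVV, Matrix.one_mul, Matrix.mul_one]; rfl

theorem singular_eigenvalues_nonneg (X : Matrix n n ℂ) (i : n) :
    0 ≤ (isHermitian_conjTranspose_mul_self X).eigenvalues i :=
  (posSemidef_conjTranspose_mul_self X).eigenvalues_nonneg i

theorem traceNorm_nonneg (X : Matrix n n ℂ) : 0 ≤ traceNorm X :=
  Finset.sum_nonneg fun _ _ => Real.sqrt_nonneg _

/-- One half of the duality between the trace norm and the operator norm. -/
theorem norm_trace_mul_le (U X : Matrix n n ℂ) : ‖trace (U * X)‖ ≤ ‖U‖ * traceNorm X := by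
  set h := isHermitian_conjTranspose_mul_self X
  set V := (h.eigenvectorUnitary : Matrix n n ℂ) with hV
  have hVV : V * Vᴴ = 1 := by
    have := Unitary.coe_mul_star_self h.eigenvectorUnitary
    simpa [star_eq_conjTranspose] using this
  have hD := conjTranspose_mul_self_eigenvectorUnitary X
  have hn : ‖Vᴴ‖ ≤ 1 := by
    rw [← star_eq_conjTranspose]
    rcases isEmpty_or_nonempty n with hne | hne
    · have : star V = 0 := Subsingleton.elim _ _
      rw [this]; simp
    · rw [norm_star]
      exact (CStarRing.norm_coe_unitary _).le
  have ht : trace (U * X) = trace ((Vᴴ * U) * (X * V)) := by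
    rw [show (Vᴴ * U) * (X * V) = (Vᴴ * (U * X)) * V by simp only [Matrix.mul_assoc],
      trace_mul_comm (Vᴴ * (U * X)) V, ← Matrix.mul_assoc, hVV, Matrix.one_mul]
  rw [ht, trace, traceNorm, Finset.mul_sum]
  refine (norm_sum_le _ _).trans (Finset.sum_le_sum fun i _ => ?_)
  refine (norm_mul_apply_le _ _ _ _).trans ?_
  refine mul_le_mul ?_ ?_ (norm_nonneg _) (norm_nonneg _)
  · calc ‖Vᴴ * U‖ ≤ ‖Vᴴ‖ * ‖U‖ := norm_mul_le _ _
      _ ≤ 1 * ‖U‖ := by gcongr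
      _ = ‖U‖ := one_mul _
  · rw [EuclideanSpace.norm_eq]
    apply Real.sqrt_le_sqrt
    have := congrFun (congrFun hD i) i
    rw [Matrix.mul_apply, diagonal_apply_eq] at this
    have h2 := congrArg Complex.re this
    rw [Complex.ofReal_re] at h2
    rw [← h2, Complex.re_sum]
    refine Finset.sum_le_sum fun k _ => ?_
    rw [conjTranspose_apply, Complex.star_def, ← Complex.normSq_eq_conj_mul_self,
      Complex.ofReal_re, Complex.normSq_eq_norm_sq]

/-- The other half of the duality: the bound by the trace norm is attained, at the adjoint of the
partial isometry of the polar decomposition. -/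
theorem exists_norm_le_one_trace_mul_eq (X : Matrix n n ℂ) :
    ∃ U : Matrix n n ℂ, ‖U‖ ≤ 1 ∧ trace (U * X) = traceNorm X := by
  set h := isHermitian_conjTranspose_mul_self X
  set V := (h.eigenvectorUnitary : Matrix n n ℂ) with hV
  have hVV : V * Vᴴ = 1 := by
    have := Unitary.coe_mul_star_self h.eigenvectorUnitary
    simpa [star_eq_conjTranspose] using this
  have hVV' : Vᴴ * V = 1 := by
    have := Unitary.coe_star_mul_self h.eigenvectorUnitary
    simpa [star_eq_conjTranspose] using this
  have hD := conjTranspose_mul_self_eigenvectorUnitary X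
  -- `U` inverts the singular values on the support of `X` and vanishes on its kernel.
  set E : Matrix n n ℂ := diagonal (fun i => (((Real.sqrt (h.eigenvalues i))⁻¹ : ℝ) : ℂ)) with hE
  have hEs : Eᴴ = E := by
    rw [hE, diagonal_conjTranspose]; congr 1; ext i; simp
  have hsq : ∀ i, Real.sqrt (h.eigenvalues i) * Real.sqrt (h.eigenvalues i) = h.eigenvalues i :=
    fun i => Real.mul_self_sqrt (singular_eigenvalues_nonneg X i)
  refine ⟨V * (E * (X * V)ᴴ), ?_, ?_⟩
  · have h1 : ‖E * (X * V)ᴴ‖ * ‖E * (X * V)ᴴ‖ ≤ 1 := by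
      have e : ‖E * (X * V)ᴴ‖ = ‖(X * V) * E‖ := by
        rw [← l2_opNorm_conjTranspose, conjTranspose_mul, conjTranspose_conjTranspose, hEs]
      rw [e, ← l2_opNorm_conjTranspose_mul_self, conjTranspose_mul, hEs,
        show E * (X * V)ᴴ * (X * V * E) = E * ((X * V)ᴴ * (X * V)) * E by
          simp only [Matrix.mul_assoc], hD, hE, diagonal_mul_diagonal, diagonal_mul_diagonal,
        l2_opNorm_diagonal, pi_norm_le_iff_of_nonneg zero_le_one]
      intro i
      by_cases h0 : Real.sqrt (h.eigenvalues i) = 0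
      · simp [h0]
      · have h3 : (Real.sqrt (h.eigenvalues i))⁻¹ * h.eigenvalues i *
            (Real.sqrt (h.eigenvalues i))⁻¹ = 1 := by
          nth_rewrite 2 [← hsq i]
          field_simp
        rw [← Complex.ofReal_mul, ← Complex.ofReal_mul, h3]
        simp
    have hn : ‖V‖ ≤ 1 := by
      rcases isEmpty_or_nonempty n with hne | hne
      · have : V = 0 := Subsingleton.elim _ _
        rw [this]; simp
      · exact (CStarRing.norm_coe_unitary _).le
    have h2 : ‖E * (X * V)ᴴ‖ ≤ 1 := by nlinarith [norm_nonneg (E * (X * V)ᴴ)]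
    calc _ ≤ ‖V‖ * ‖E * (X * V)ᴴ‖ := norm_mul_le _ _
      _ ≤ 1 * 1 := by gcongr
      _ = 1 := one_mul 1
  · rw [Matrix.mul_assoc, trace_mul_comm, Matrix.mul_assoc, Matrix.mul_assoc, hD, hE,
      diagonal_mul_diagonal, trace_diagonal, traceNorm, Complex.ofReal_sum]
    refine Finset.sum_congr rfl fun i _ => ?_
    rw [← Complex.ofReal_mul]
    congr 1
    by_cases h0 : Real.sqrt (h.eigenvalues i) = 0
    · simp [h0]
    · nth_rewrite 2 [← hsq i]
      field_simp

theorem traceNorm_le_of_forall {X : Matrix n n ℂ} {c : ℝ}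
    (h : ∀ U : Matrix n n ℂ, ‖U‖ ≤ 1 → ‖trace (U * X)‖ ≤ c) : traceNorm X ≤ c := by
  obtain ⟨U, hU, hX⟩ := exists_norm_le_one_trace_mul_eq X
  have := h U hU
  rw [hX, Complex.norm_real, Real.norm_of_nonneg (traceNorm_nonneg X)] at this
  exact this

theorem traceNorm_add_le (X Y : Matrix n n ℂ) :
    traceNorm (X + Y) ≤ traceNorm X + traceNorm Y := by
  refine traceNorm_le_of_forall fun U hU => ?_
  rw [Matrix.mul_add, trace_add]
  refine (norm_add_le _ _).trans (add_le_add ?_ ?_)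
  · exact (norm_trace_mul_le U X).trans
      (mul_le_of_le_one_left (traceNorm_nonneg X) hU)
  · exact (norm_trace_mul_le U Y).trans
      (mul_le_of_le_one_left (traceNorm_nonneg Y) hU)

theorem traceNorm_smul_le (c : ℂ) (X : Matrix n n ℂ) :
    traceNorm (c • X) ≤ ‖c‖ * traceNorm X := by
  refine traceNorm_le_of_forall fun U hU => ?_
  rw [Matrix.mul_smul, trace_smul, smul_eq_mul, norm_mul]
  gcongr
  exact (norm_trace_mul_le U X).trans (mul_le_of_le_one_left (traceNorm_nonneg X) hU)

theorem traceNorm_smul (c : ℂ) (X : Matrix n n ℂ) : traceNorm (c • X) = ‖c‖ * traceNorm X := by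
  refine le_antisymm (traceNorm_smul_le c X) ?_
  rcases eq_or_ne c 0 with rfl | hc
  · rw [norm_zero, zero_mul]; exact traceNorm_nonneg _
  · have := traceNorm_smul_le c⁻¹ (c • X)
    rwa [inv_smul_smul₀ hc, norm_inv, inv_mul_eq_div, le_div_iff₀ (norm_pos_iff.2 hc),
      mul_comm] at this

theorem traceNorm_zero : traceNorm (0 : Matrix n n ℂ) = 0 :=
  le_antisymm (traceNorm_le_of_forall fun U _ => by simp) (traceNorm_nonneg _)

theorem eq_zero_of_traceNorm_eq_zero {X : Matrix n n ℂ} (h : traceNorm X = 0) : X = 0 := by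
  ext i j
  have := norm_trace_mul_le (Matrix.single j i (1 : ℂ)) X
  rw [h, mul_zero, trace_mul_comm, trace_mul_single] at this
  simpa using this

/-- The trace norm is an ideal norm, also for factors that change the size of the matrix. -/
theorem traceNorm_mul_mul_le (A : Matrix m n ℂ) (X : Matrix n n ℂ) (B : Matrix n m ℂ) :
    traceNorm (A * X * B) ≤ ‖A‖ * ‖B‖ * traceNorm X := by
  refine traceNorm_le_of_forall fun U hU => ?_
  have : trace (U * (A * X * B)) = trace ((B * (U * A)) * X) := by
    rw [show U * (A * X * B) = (U * A * X) * B by simp only [Matrix.mul_assoc], trace_mul_comm]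
    simp only [Matrix.mul_assoc]
  rw [this]
  refine (norm_trace_mul_le _ _).trans (mul_le_mul_of_nonneg_right ?_ (traceNorm_nonneg X))
  calc ‖B * (U * A)‖ ≤ ‖B‖ * ‖U * A‖ := l2_opNorm_mul _ _
    _ ≤ ‖B‖ * (‖U‖ * ‖A‖) := by gcongr; exact l2_opNorm_mul _ _
    _ ≤ ‖B‖ * (1 * ‖A‖) := by gcongr
    _ = ‖A‖ * ‖B‖ := by ring

end TraceNorm
end

noncomputable section

/-! ### Exponentials in a Banach algebra -/

section ExpBounds

variable {𝔸 : Type*} [NormedRing 𝔸] [NormedAlgebra ℂ 𝔸] [CompleteSpace 𝔸]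

/-- The Taylor remainder of the exponential in a Banach algebra is dominated by that of the real
exponential at the norm. -/
theorem norm_exp_sub_sum_range_le (x : 𝔸) {k : ℕ} (hk : 0 < k) :
    ‖NormedSpace.exp x - ∑ i ∈ Finset.range k, ((i.factorial : ℂ)⁻¹) • x ^ i‖ ≤
      Real.exp ‖x‖ - ∑ i ∈ Finset.range k, ((i.factorial : ℝ)⁻¹) * ‖x‖ ^ i := by
  have h1 := NormedSpace.exp_series_hasSum_exp' (𝕂 := ℂ) x
  have h2 : HasSum (fun n : ℕ => ((n.factorial : ℝ)⁻¹) * ‖x‖ ^ n) (Real.exp ‖x‖) := by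
    have := NormedSpace.exp_series_hasSum_exp' (𝕂 := ℝ) (‖x‖)
    rw [← Real.exp_eq_exp_ℝ] at this
    simpa using this
  have h1' := (hasSum_nat_add_iff' k).2 h1
  have h2' := (hasSum_nat_add_iff' k).2 h2
  rw [← h1'.tsum_eq]
  refine tsum_of_norm_bounded h2' fun i => ?_
  rw [norm_smul, norm_inv, Complex.norm_natCast]
  gcongr
  exact norm_pow_le' x (by omega)

theorem norm_exp_sub_one_le (x : 𝔸) : ‖NormedSpace.exp x - 1‖ ≤ Real.exp ‖x‖ - 1 := by
  simpa using norm_exp_sub_sum_range_le x (k := 1) one_pos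

theorem norm_exp_sub_one_sub_self_le (x : 𝔸) (hx : ‖x‖ ≤ 1) :
    ‖NormedSpace.exp x - (1 + x)‖ ≤ ‖x‖ ^ 2 := by
  have h := norm_exp_sub_sum_range_le x (k := 2) two_pos
  have h3 := Real.exp_bound (x := ‖x‖) (by simpa using hx) (n := 2) two_pos
  simp [Finset.sum_range_succ] at h h3
  have := le_abs_self (Real.exp ‖x‖ - (1 + ‖x‖))
  nlinarith [sq_nonneg ‖x‖]

theorem norm_exp_sub_quadratic_le (x : 𝔸) (hx : ‖x‖ ≤ 1) :
    ‖NormedSpace.exp x - (1 + x + (1 / 2 : ℂ) • x ^ 2)‖ ≤ ‖x‖ ^ 3 := by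
  have h := norm_exp_sub_sum_range_le x (k := 3) three_pos
  have h3 := Real.exp_bound (x := ‖x‖) (by simpa using hx) (n := 3) three_pos
  simp [Finset.sum_range_succ, Nat.factorial] at h h3
  have := le_abs_self (Real.exp ‖x‖ - (1 + ‖x‖ + ‖x‖ ^ 2 / 2))
  have h4 : (0 : ℝ) ≤ ‖x‖ ^ 3 := by positivity
  rw [one_div]
  refine h.trans ?_
  nlinarith

/-- A generator whose first-order steps are contractions up to second order generates a
semigroup of contractions. -/
theorem norm_exp_smul_le_one {T : 𝔸} {B K : ℝ} (hB : ‖T‖ ≤ B) (hK : 0 ≤ K)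
    (h : ∀ s : ℝ, 0 ≤ s → s ≤ 1 → ‖1 + (s : ℂ) • T‖ ≤ 1 + K * s ^ 2) {t : ℝ} (ht : 0 ≤ t) :
    ‖NormedSpace.exp ((t : ℂ) • T)‖ ≤ 1 := by
  have hB0 : 0 ≤ B := (norm_nonneg T).trans hB
  set c : ℝ := (K + B ^ 2) * t ^ 2 with hc
  have hc0 : 0 ≤ c := by positivity
  -- Bound for `m` equal steps, each estimated by its first-order Taylor polynomial.
  have key : ∀ m : ℕ, 0 < m → t * (B + 1) ≤ m →
      ‖NormedSpace.exp ((t : ℂ) • T)‖ ≤ Real.exp (c / m) := by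
    intro m hm hmt
    have hm' : (0 : ℝ) < m := by exact_mod_cast hm
    have hs : t / m * (B + 1) ≤ 1 := by
      rw [div_mul_eq_mul_div, div_le_one hm']; exact hmt
    have hs0 : 0 ≤ t / m := by positivity
    have hs1 : t / m ≤ 1 := by nlinarith
    have hx : ‖((t / m : ℝ) : ℂ) • T‖ ≤ t / m * B := by
      rw [norm_smul, Complex.norm_real, Real.norm_of_nonneg hs0]
      gcongr
    have hstep : ‖NormedSpace.exp (((t / m : ℝ) : ℂ) • T)‖ ≤ 1 + c / m ^ 2 := by
      have h1 := norm_exp_sub_one_sub_self_le (((t / m : ℝ) : ℂ) • T) (hx.trans (by nlinarith))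
      have h2 := h (t / m) hs0 hs1
      have h3 : ‖((t / m : ℝ) : ℂ) • T‖ ^ 2 ≤ (t / m * B) ^ 2 := by gcongr
      have h4 := norm_le_norm_add_norm_sub (1 + ((t / m : ℝ) : ℂ) • T)
        (NormedSpace.exp (((t / m : ℝ) : ℂ) • T))
      rw [norm_sub_rev] at h4
      have h5 : c / m ^ 2 = K * (t / m) ^ 2 + (t / m * B) ^ 2 := by
        rw [hc]; field_simp
      linarith
    have hpow : NormedSpace.exp ((t : ℂ) • T) = NormedSpace.exp (((t / m : ℝ) : ℂ) • T) ^ m := by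
      let _ : NormedAlgebra ℚ 𝔸 := NormedAlgebra.restrictScalars ℚ ℂ 𝔸
      rw [← NormedSpace.exp_nsmul, ← Nat.cast_smul_eq_nsmul ℂ, smul_smul]
      congr 2
      push_cast
      rw [mul_div_cancel₀ _ (by exact_mod_cast hm.ne')]
    rw [hpow]
    calc _ ≤ ‖NormedSpace.exp (((t / m : ℝ) : ℂ) • T)‖ ^ m := norm_pow_le' _ hm
      _ ≤ (1 + c / m ^ 2) ^ m := by gcongr
      _ ≤ (Real.exp (c / m ^ 2)) ^ m := by
          gcongr
          rw [add_comm]; exact Real.add_one_le_exp _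
      _ = Real.exp (c / m) := by
          rw [← Real.exp_nat_mul]; congr 1; field_simp
  have hlim : Filter.Tendsto (fun m : ℕ => Real.exp (c / m)) Filter.atTop (nhds 1) := by
    have := (Real.continuous_exp.tendsto 0).comp (tendsto_const_div_atTop_nhds_zero_nat c)
    simpa [Function.comp_def] using this
  refine ge_of_tendsto hlim ?_
  filter_upwards [Filter.eventually_gt_atTop 0,
    Filter.eventually_ge_atTop ⌈t * (B + 1)⌉₊] with m hm hm2
  exact key m hm ((Nat.le_ceil _).trans (by exact_mod_cast hm2))

/-- The errors of the factors of a power add up, by telescoping. -/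
theorem norm_pow_sub_pow_le {𝔸 : Type*} [NormedRing 𝔸] {a b : 𝔸} (ha : ‖a‖ ≤ 1)
    (hb : ∀ k : ℕ, ‖b ^ k‖ ≤ 1) (m : ℕ) :
    ‖a ^ m - b ^ m‖ ≤ m * ‖a - b‖ := by
  induction m with
  | zero => simp
  | succ m ih =>
    have : a ^ (m + 1) - b ^ (m + 1) = a * (a ^ m - b ^ m) + (a - b) * b ^ m := by
      rw [pow_succ', pow_succ']; noncomm_ring
    rw [this]
    calc _ ≤ ‖a‖ * ‖a ^ m - b ^ m‖ + ‖a - b‖ * ‖b ^ m‖ :=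
          (norm_add_le _ _).trans (add_le_add (norm_mul_le _ _) (norm_mul_le _ _))
      _ ≤ 1 * (m * ‖a - b‖) + ‖a - b‖ * 1 := by gcongr; exact hb m
      _ = _ := by push_cast; ring

end ExpBounds

open scoped Matrix.Norms.L2Operator
open Matrix

/-! ### Superoperators and the diamond norm -/

/-- Square matrices, normed by the trace norm. -/
def TraceClass (m : Type*) := Matrix m m ℂ

instance (m : Type*) : AddCommGroup (TraceClass m) := inferInstanceAs (AddCommGroup (Matrix m m ℂ))
instance (m : Type*) : Module ℂ (TraceClass m) := inferInstanceAs (Module ℂ (Matrix m m ℂ))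

section Superop

variable {m n r : Type*} [Fintype m] [DecidableEq m] [Fintype n] [DecidableEq n]
  [Fintype r] [DecidableEq r]

instance : FiniteDimensional ℂ (TraceClass m) :=
  inferInstanceAs (FiniteDimensional ℂ (Matrix m m ℂ))

instance : Norm (TraceClass m) := ⟨fun X => traceNorm (X : Matrix m m ℂ)⟩

theorem TraceClass.normCore : NormedSpace.Core ℂ (TraceClass m) where
  norm_nonneg X := traceNorm_nonneg (n := m) X
  norm_smul c X := traceNorm_smul (n := m) c X
  norm_triangle X Y := traceNorm_add_le (n := m) X Y
  norm_eq_zero_iff X := ⟨fun h => eq_zero_of_traceNorm_eq_zero (n := m) h,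
    fun h => by rw [h]; exact traceNorm_zero (n := m)⟩

instance : NormedAddCommGroup (TraceClass m) := NormedAddCommGroup.ofCore TraceClass.normCore
instance : NormedSpace ℂ (TraceClass m) := NormedSpace.ofCore TraceClass.normCore

/-- The bounded operator on the trace class given by a superoperator. -/
def superCLM : Module.End ℂ (Matrix m m ℂ) →ₐ[ℂ] (TraceClass m →L[ℂ] TraceClass m) :=
  ((Module.End.toContinuousLinearMap (𝕜 := ℂ) (TraceClass m)) :
    Module.End ℂ (TraceClass m) →ₐ[ℂ] (TraceClass m →L[ℂ] TraceClass m))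

theorem traceNorm_apply_le (T : Module.End ℂ (Matrix m m ℂ)) (X : Matrix m m ℂ) :
    traceNorm (T X) ≤ ‖superCLM T‖ * traceNorm X :=
  (superCLM T).le_opNorm X

theorem norm_superCLM_le {T : Module.End ℂ (Matrix m m ℂ)} {c : ℝ} (hc : 0 ≤ c)
    (h : ∀ X, traceNorm (T X) ≤ c * traceNorm X) : ‖superCLM T‖ ≤ c :=
  ContinuousLinearMap.opNorm_le_bound _ hc h

/-- Ampliation as a homomorphism of the algebras of superoperators. -/
def ampliationHom (r : Type*) :
    Module.End ℂ (Matrix m m ℂ) →ₐ[ℂ] Module.End ℂ (Matrix (m × r) (m × r) ℂ) where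
  toFun T :=
    { toFun := fun X => ampliation r T X
      map_add' := fun X Y => by
        ext p q
        exact congrFun (congrFun (T.map_add (fun i i' => X (i, p.2) (i', q.2))
          (fun i i' => Y (i, p.2) (i', q.2))) p.1) q.1
      map_smul' := fun c X => by
        ext p q
        exact congrFun (congrFun (T.map_smul c (fun i i' => X (i, p.2) (i', q.2))) p.1) q.1 }
  map_one' := rfl
  map_mul' _ _ := rfl
  map_zero' := rfl
  map_add' _ _ := rfl
  commutes' _ := rfl

theorem ampliationHom_apply {m r : Type*} (T : Module.End ℂ (Matrix m m ℂ))
    (X : Matrix (m × r) (m × r) ℂ) :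
    ampliationHom r T X = ampliation r T X := rfl

/-- The exponential of a superoperator, computed in the Banach algebra of bounded operators on the
trace class of the system with a reference. -/
theorem superCLM_ampliationHom_superExp (T : Module.End ℂ (Matrix m m ℂ)) :
    superCLM (ampliationHom r (superExp T)) = NormedSpace.exp (superCLM (ampliationHom r T)) := by
  set φ : Matrix (m × m) (m × m) ℂ →ₐ[ℂ] (TraceClass (m × r) →L[ℂ] TraceClass (m × r)) :=
    superCLM.comp ((ampliationHom r).comp
      (Matrix.toLinAlgEquiv (Matrix.stdBasis ℂ m m)).toAlgHom) with hφ
  have hc : Continuous φ := LinearMap.continuous_of_finiteDimensional φ.toLinearMap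
  let _ : NormedAlgebra ℚ (Matrix (m × m) (m × m) ℂ) := NormedAlgebra.restrictScalars ℚ ℂ _
  let _ : NormedAlgebra ℚ (TraceClass (m × r) →L[ℂ] TraceClass (m × r)) :=
    NormedAlgebra.restrictScalars ℚ ℂ _
  have h := NormedSpace.map_exp φ hc
    (LinearMap.toMatrix (Matrix.stdBasis ℂ m m) (Matrix.stdBasis ℂ m m) T)
  have e1 : φ (NormedSpace.exp
      (LinearMap.toMatrix (Matrix.stdBasis ℂ m m) (Matrix.stdBasis ℂ m m) T)) =
      superCLM (ampliationHom r (superExp T)) := rfl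
  have e2 : φ (LinearMap.toMatrix (Matrix.stdBasis ℂ m m) (Matrix.stdBasis ℂ m m) T) =
      superCLM (ampliationHom r T) := by
    change superCLM (ampliationHom r (Matrix.toLin _ _ (LinearMap.toMatrix _ _ T))) = _
    rw [Matrix.toLin_toMatrix]
  rw [e1, e2] at h
  exact h

end Superop
end

noncomputable section

open scoped Matrix.Norms.L2Operator
open Matrix

/-! ### Kraus maps -/

section Kraus

variable {m n r κ : Type*} [Fintype m] [DecidableEq m] [Fintype n] [DecidableEq n]
  [Fintype r] [DecidableEq r] [Fintype κ] [DecidableEq κ]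

/-- The map `X ↦ A X B`. -/
def sandwich (A B : Matrix m m ℂ) : Module.End ℂ (Matrix m m ℂ) :=
  LinearMap.mulLeft ℂ A * LinearMap.mulRight ℂ B

theorem sandwich_apply (A B X : Matrix m m ℂ) : sandwich A B X = A * (X * B) := rfl

theorem norm_superCLM_sandwich_le (A B : Matrix m m ℂ) :
    ‖superCLM (sandwich A B)‖ ≤ ‖A‖ * ‖B‖ := by
  refine norm_superCLM_le (by positivity) fun X => ?_
  rw [sandwich_apply, ← Matrix.mul_assoc]
  exact traceNorm_mul_mul_le A X B

/-- The completely positive map `X ↦ ∑ z, A z X (A z)†`. -/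
def krausMap (A : κ → Matrix m m ℂ) : Module.End ℂ (Matrix m m ℂ) := ∑ z, conjBy (A z)

theorem krausMap_apply (A : κ → Matrix m m ℂ) (X : Matrix m m ℂ) :
    krausMap A X = ∑ z, A z * X * (A z)ᴴ := by
  simp [krausMap, conjBy]

theorem conjBy_eq_sandwich (A : Matrix m m ℂ) : conjBy A = sandwich A Aᴴ := by
  ext1 X
  rw [sandwich_apply, ← Matrix.mul_assoc]; rfl

/-- Tensoring with the identity of a reference system. -/
def tensorOne (r : Type*) [Fintype r] [DecidableEq r] :
    Matrix m m ℂ →⋆ₐ[ℂ] Matrix (m × r) (m × r) ℂ where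
  toFun A := kroneckerMap (· * ·) A (1 : Matrix r r ℂ)
  map_one' := one_kronecker_one
  map_mul' A B := by
    have := mul_kronecker_mul A B (1 : Matrix r r ℂ) (1 : Matrix r r ℂ)
    rw [Matrix.one_mul] at this
    exact this
  map_zero' := zero_kronecker _
  map_add' A B := add_kronecker A B _
  commutes' c := by
    ext ⟨i, j⟩ ⟨i', j'⟩
    by_cases h1 : i = i' <;> by_cases h2 : j = j' <;>
      simp [Matrix.algebraMap_matrix_apply, h1, h2]
  map_star' A := by
    have := conjTranspose_kronecker A (1 : Matrix r r ℂ)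
    rw [conjTranspose_one] at this
    exact this.symm

theorem norm_tensorOne_le (A : Matrix m m ℂ) : ‖tensorOne r A‖ ≤ ‖A‖ :=
  NonUnitalStarAlgHom.norm_apply_le (tensorOne (m := m) r) A

theorem tensorOne_conjTranspose (A : Matrix m m ℂ) : tensorOne r Aᴴ = (tensorOne r A)ᴴ :=
  map_star (tensorOne (m := m) r) A

theorem ampliationHom_sandwich (A B : Matrix m m ℂ) :
    ampliationHom r (sandwich A B) = sandwich (tensorOne r A) (tensorOne r B) := by
  ext1 X
  ext ⟨i, j⟩ ⟨i', j'⟩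
  have h : ∀ Y : Matrix m m ℂ, sandwich A B Y i i' = ∑ x, ∑ y, A i y * Y y x * B x i' := by
    intro Y
    rw [sandwich_apply, ← Matrix.mul_assoc]
    simp only [Matrix.mul_apply, Finset.sum_mul]
  rw [sandwich_apply, ← Matrix.mul_assoc]
  refine (h _).trans ?_
  simp [tensorOne, Matrix.mul_apply, Fintype.sum_prod_type, kroneckerMap_apply, Matrix.one_apply,
    Finset.sum_mul]

theorem ampliationHom_conjBy (A : Matrix m m ℂ) :
    ampliationHom r (conjBy A : Module.End ℂ (Matrix m m ℂ)) = conjBy (tensorOne r A) := by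
  rw [conjBy_eq_sandwich, conjBy_eq_sandwich, ampliationHom_sandwich, tensorOne_conjTranspose]

theorem ampliationHom_krausMap (A : κ → Matrix m m ℂ) :
    ampliationHom r (krausMap A) = krausMap fun z => tensorOne r (A z) := by
  rw [krausMap, map_sum]
  exact Finset.sum_congr rfl fun z _ => ampliationHom_conjBy (A z)

theorem dissipator_eq_sandwich (L : Matrix m m ℂ) :
    dissipator L = sandwich L Lᴴ - (1 / 2 : ℂ) • (sandwich (Lᴴ * L) 1 + sandwich 1 (Lᴴ * L)) := by
  ext1 X
  simp [dissipator, sandwich_apply, Matrix.mul_assoc]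

theorem ampliationHom_dissipator (L : Matrix m m ℂ) :
    ampliationHom r (dissipator L : Module.End ℂ (Matrix m m ℂ)) = dissipator (tensorOne r L) := by
  rw [dissipator_eq_sandwich, dissipator_eq_sandwich, map_sub, map_smul, map_add]
  simp only [ampliationHom_sandwich, map_mul, tensorOne_conjTranspose, map_one]

/-- A completely positive map is bounded in trace norm by the norm of the dual map at the
identity. -/
theorem norm_superCLM_krausMap_le (A : κ → Matrix m m ℂ) :
    ‖superCLM (krausMap A)‖ ≤ ‖∑ z, (A z)ᴴ * A z‖ := by
  -- The Kraus operators are stacked to a single matrix `V`.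
  set V : Matrix (m × κ) m ℂ := Matrix.of fun p j => A p.2 p.1 j with hV
  have hVV : ∀ U : Matrix m m ℂ, Vᴴ * (tensorOne κ U * V) = ∑ z, (A z)ᴴ * (U * A z) := by
    intro U
    ext i j
    simp only [Matrix.mul_apply, conjTranspose_apply, Fintype.sum_prod_type, Matrix.sum_apply]
    rw [Finset.sum_comm]
    refine Finset.sum_congr rfl fun z _ => Finset.sum_congr rfl fun k _ => ?_
    simp [hV, tensorOne, kroneckerMap_apply, Matrix.one_apply]
  have hVn : ‖V‖ * ‖V‖ = ‖∑ z, (A z)ᴴ * A z‖ := by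
    rw [← l2_opNorm_conjTranspose_mul_self]
    have := hVV 1
    simp only [map_one, Matrix.one_mul] at this
    rw [this]
  refine norm_superCLM_le (norm_nonneg _) fun X => traceNorm_le_of_forall fun U hU => ?_
  have ht : trace (U * krausMap A X) = trace ((Vᴴ * (tensorOne κ U * V)) * X) := by
    rw [hVV, krausMap_apply, Matrix.mul_sum, trace_sum, Matrix.sum_mul, trace_sum]
    refine Finset.sum_congr rfl fun z _ => ?_
    rw [show U * (A z * X * (A z)ᴴ) = (U * A z * X) * (A z)ᴴ by simp only [Matrix.mul_assoc],
      trace_mul_comm]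
    simp only [Matrix.mul_assoc]
  rw [ht, ← hVn]
  refine (norm_trace_mul_le _ _).trans (mul_le_mul_of_nonneg_right ?_ (traceNorm_nonneg X))
  calc ‖Vᴴ * (tensorOne κ U * V)‖ ≤ ‖Vᴴ‖ * (‖tensorOne κ U‖ * ‖V‖) :=
        (l2_opNorm_mul _ _).trans (by gcongr; exact l2_opNorm_mul _ _)
    _ ≤ ‖V‖ * (1 * ‖V‖) := by
        rw [l2_opNorm_conjTranspose]
        gcongr
        exact (norm_tensorOne_le U).trans hU
    _ = ‖V‖ * ‖V‖ := by ring

theorem norm_one_le : ‖(1 : Matrix m m ℂ)‖ ≤ 1 := by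
  rcases isEmpty_or_nonempty m with h | h
  · rw [Subsingleton.elim (1 : Matrix m m ℂ) 0, norm_zero]; exact zero_le_one
  · exact norm_one.le

theorem norm_superCLM_dissipator_le (L : Matrix m m ℂ) :
    ‖superCLM (dissipator L)‖ ≤ 2 * ‖L‖ ^ 2 := by
  have hD : ‖Lᴴ * L‖ = ‖L‖ ^ 2 := by rw [l2_opNorm_conjTranspose_mul_self, sq]
  have h1 : ‖superCLM (sandwich L Lᴴ)‖ ≤ ‖L‖ ^ 2 := by
    refine (norm_superCLM_sandwich_le _ _).trans ?_
    rw [l2_opNorm_conjTranspose, sq]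
  have h2 : ‖superCLM (sandwich (Lᴴ * L) 1)‖ ≤ ‖L‖ ^ 2 := by
    refine (norm_superCLM_sandwich_le _ _).trans ?_
    rw [hD]
    exact mul_le_of_le_one_right (by positivity) norm_one_le
  have h3 : ‖superCLM (sandwich 1 (Lᴴ * L))‖ ≤ ‖L‖ ^ 2 := by
    refine (norm_superCLM_sandwich_le _ _).trans ?_
    rw [hD]
    exact mul_le_of_le_one_left (by positivity) norm_one_le
  rw [dissipator_eq_sandwich, map_sub, map_smul, map_add]
  refine (norm_sub_le _ _).trans ?_
  rw [norm_smul]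
  have h4 := norm_add_le (superCLM (sandwich (Lᴴ * L) 1)) (superCLM (sandwich 1 (Lᴴ * L)))
  have h5 : ‖(1 / 2 : ℂ)‖ = 1 / 2 := by norm_num
  rw [h5]
  linarith

/-- A first-order step of a dissipator is, up to second order, the Kraus map of the operators
`1 - s L†L / 2` and `√s L`. -/
theorem norm_one_add_smul_dissipator_le {L : Matrix m m ℂ} (hL : ‖L‖ ≤ 1) (s : ℝ) (hs : 0 ≤ s) :
    ‖1 + (s : ℂ) • superCLM (dissipator L)‖ ≤ 1 + 1 / 2 * s ^ 2 := by
  set D := Lᴴ * L with hD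
  have hDn : ‖D‖ ≤ 1 := by
    rw [hD, l2_opNorm_conjTranspose_mul_self]; nlinarith [norm_nonneg L]
  have hDs : Dᴴ = D := by rw [hD, conjTranspose_mul, conjTranspose_conjTranspose]
  set A : Bool → Matrix m m ℂ := fun b => bif b then ((Real.sqrt s : ℝ) : ℂ) • L else
    1 - ((s / 2 : ℝ) : ℂ) • D with hA
  have hss : ((Real.sqrt s : ℝ) : ℂ) * ((Real.sqrt s : ℝ) : ℂ) = s := by
    rw [← Complex.ofReal_mul, Real.mul_self_sqrt hs]
  have e1 : 1 + (s : ℂ) • dissipator L = krausMap A - ((s ^ 2 / 4 : ℝ) : ℂ) • sandwich D D := by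
    ext1 X
    simp only [LinearMap.sub_apply, LinearMap.add_apply, krausMap_apply, Fintype.sum_bool, hA,
      cond_true, cond_false, LinearMap.smul_apply, sandwich_apply, Module.End.one_apply]
    simp only [dissipator, LinearMap.coe_mk, AddHom.coe_mk, conjTranspose_smul, conjTranspose_sub,
      conjTranspose_one, hDs, ← hD, Complex.star_def, Complex.conj_ofReal, Matrix.smul_mul,
      Matrix.mul_smul, smul_smul, hss, Matrix.sub_mul, Matrix.mul_sub, Matrix.one_mul,
      Matrix.mul_one, smul_add, smul_sub, Matrix.mul_assoc]
    push_cast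
    module
  have e2 : ∑ z, (A z)ᴴ * A z = 1 + ((s ^ 2 / 4 : ℝ) : ℂ) • (D * D) := by
    simp only [Fintype.sum_bool, hA, cond_true, cond_false, conjTranspose_smul, conjTranspose_sub,
      conjTranspose_one, hDs, Complex.star_def, Complex.conj_ofReal, Matrix.smul_mul,
      Matrix.mul_smul, smul_smul, hss, Matrix.sub_mul, Matrix.mul_sub, Matrix.one_mul,
      Matrix.mul_one, smul_sub, ← hD]
    push_cast
    module
  have e3 : 1 + (s : ℂ) • superCLM (dissipator L) = superCLM (1 + (s : ℂ) • dissipator L) := by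
    rw [map_add, map_one, map_smul]
  have hc : ‖((s ^ 2 / 4 : ℝ) : ℂ)‖ = s ^ 2 / 4 := by
    rw [Complex.norm_real, Real.norm_of_nonneg (by positivity)]
  have hDD : ‖D‖ * ‖D‖ ≤ 1 := by nlinarith [norm_nonneg D]
  rw [e3, e1, map_sub, map_smul]
  have h1 := (norm_superCLM_krausMap_le A)
  rw [e2] at h1
  have h2 : ‖1 + ((s ^ 2 / 4 : ℝ) : ℂ) • (D * D)‖ ≤ 1 + s ^ 2 / 4 := by
    refine (norm_add_le _ _).trans (add_le_add norm_one_le ?_)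
    rw [norm_smul, hc]
    refine mul_le_of_le_one_right (by positivity) ((norm_mul_le _ _).trans hDD)
  have h3 : ‖((s ^ 2 / 4 : ℝ) : ℂ) • superCLM (sandwich D D)‖ ≤ s ^ 2 / 4 := by
    rw [norm_smul, hc]
    exact mul_le_of_le_one_right (by positivity) ((norm_superCLM_sandwich_le _ _).trans hDD)
  have h4 := norm_sub_le (superCLM (krausMap A)) (((s ^ 2 / 4 : ℝ) : ℂ) • superCLM (sandwich D D))
  linarith

/-- Conjugation depends continuously on the Kraus operator. A Kraus operator of norm of order `c`
needs an error `δ` such that `c δ` has the desired order. -/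
theorem norm_superCLM_conjBy_sub_le {A a : Matrix m m ℂ} {δ c : ℝ} (h : ‖A - a‖ ≤ δ)
    (ha : ‖a‖ ≤ c) : ‖superCLM (conjBy A) - superCLM (conjBy a)‖ ≤ δ * (2 * c + δ) := by
  have hδ : 0 ≤ δ := (norm_nonneg _).trans h
  have hA : ‖A‖ ≤ c + δ := by
    have := norm_le_norm_add_norm_sub a A
    rw [norm_sub_rev] at this
    linarith
  have e : conjBy A - conjBy a = sandwich (A - a) Aᴴ + sandwich a (A - a)ᴴ := by
    ext1 X
    simp only [LinearMap.sub_apply, LinearMap.add_apply, sandwich_apply, conjBy, LinearMap.coe_mk,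
      AddHom.coe_mk, conjTranspose_sub, Matrix.sub_mul, Matrix.mul_sub, Matrix.mul_assoc]
    abel
  rw [← map_sub, e, map_add]
  refine (norm_add_le _ _).trans ?_
  have h1 := norm_superCLM_sandwich_le (A - a) Aᴴ
  have h2 := norm_superCLM_sandwich_le a (A - a)ᴴ
  rw [l2_opNorm_conjTranspose] at h1 h2
  have h3 : ‖A - a‖ * ‖A‖ ≤ δ * (c + δ) := by gcongr
  have h4 : ‖a‖ * ‖A - a‖ ≤ c * δ := by
    have : 0 ≤ c := (norm_nonneg _).trans ha
    gcongr
  linarith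

end Kraus
end

noncomputable section

open scoped Matrix.Norms.L2Operator
open Matrix

/-! ### A second-order Kraus approximation of a dissipative semigroup -/

section SecondOrder

variable {m : Type*} [Fintype m] [DecidableEq m]

/-- The Kraus operators `1 - τD/2 + τ²D²/8`, `√τ (L - τ (DL + LD)/4)` and `τ L²/√2`, where
`D = L†L`, reproduce the second-order Taylor polynomial of the semigroup of `dissipator L` up to
the terms of order `τ³` on the right. -/
theorem kraus_second_order_identity (L : Matrix m m ℂ) (s c : ℝ) (hc : c * c = 1 / 2) :
    (conjBy (1 - ((s ^ 2 / 2 : ℝ) : ℂ) • (Lᴴ * L) +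
        ((s ^ 4 / 8 : ℝ) : ℂ) • (Lᴴ * L * (Lᴴ * L))) +
      conjBy ((s : ℂ) • (L - ((s ^ 2 / 4 : ℝ) : ℂ) • (Lᴴ * L * L + L * (Lᴴ * L)))) +
      conjBy (((c * s ^ 2 : ℝ) : ℂ) • (L * L)) : Module.End ℂ (Matrix m m ℂ)) =
    1 + ((s ^ 2 : ℝ) : ℂ) • dissipator L +
      (1 / 2 : ℂ) • (((s ^ 2 : ℝ) : ℂ) • dissipator L) ^ 2 +
    (((s ^ 6 / 16 : ℝ) : ℂ) • (conjBy (Lᴴ * L * L + L * (Lᴴ * L)) -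
        sandwich (Lᴴ * L) (Lᴴ * L * (Lᴴ * L)) - sandwich (Lᴴ * L * (Lᴴ * L)) (Lᴴ * L)) +
      ((s ^ 8 / 64 : ℝ) : ℂ) • sandwich (Lᴴ * L * (Lᴴ * L)) (Lᴴ * L * (Lᴴ * L))) := by
  have hD : (Lᴴ * L)ᴴ = Lᴴ * L := by rw [conjTranspose_mul, conjTranspose_conjTranspose]
  have hc' : (c : ℂ) * c = 1 / 2 := by
    rw [← Complex.ofReal_mul, hc]; norm_num
  generalize hDD : Lᴴ * L = D at *
  ext1 X
  simp only [LinearMap.add_apply, LinearMap.sub_apply, LinearMap.smul_apply, pow_two (_ • _),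
    Module.End.mul_apply, Module.End.one_apply, sandwich_apply]
  simp only [dissipator, conjBy, LinearMap.coe_mk, AddHom.coe_mk, hDD, conjTranspose_add,
    conjTranspose_sub, conjTranspose_smul, conjTranspose_mul, conjTranspose_one, hD,
    Complex.star_def, Complex.conj_ofReal, Matrix.smul_mul, Matrix.mul_smul, smul_smul,
    Matrix.sub_mul, Matrix.mul_sub, Matrix.add_mul, Matrix.mul_add, Matrix.one_mul,
    Matrix.mul_one, smul_add, smul_sub, Matrix.mul_assoc, map_smul, map_sub, map_add, map_mul]
  have e : ((c * s ^ 2 : ℝ) : ℂ) * ((c * s ^ 2 : ℝ) : ℂ) = (s : ℂ) ^ 4 / 2 := by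
    push_cast
    linear_combination (s : ℂ) ^ 4 * hc'
  simp only [e]
  push_cast
  module

theorem norm_add_add_sub_le_of_eq {E : Type*} [NormedAddCommGroup E] {x y z x' y' z' P R : E}
    (h : x' + y' + z' = P + R) :
    ‖x + y + z - P‖ ≤ ‖x - x'‖ + ‖y - y'‖ + ‖z - z'‖ + ‖R‖ := by
  have e : x + y + z - P = (x - x') + (y - y') + (z - z') + R := by
    rw [← sub_eq_iff_eq_add'] at h
    rw [← h]; abel
  rw [e]
  exact (norm_add_le _ _).trans (add_le_add_left (norm_add₃_le) _)

/-- The terms of order `τ³` and `τ⁴`, with `τ = s²`, of `kraus_second_order_identity`. -/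
theorem norm_kraus_residual_le {D M : Matrix m m ℂ} {s : ℝ} (hs : 0 ≤ s) (hs1 : s ≤ 1)
    (hDn : ‖D‖ ≤ 1) (hM : ‖M‖ ≤ 2) :
    ‖superCLM (((s ^ 6 / 16 : ℝ) : ℂ) • (conjBy M - sandwich D (D * D) - sandwich (D * D) D) +
      ((s ^ 8 / 64 : ℝ) : ℂ) • sandwich (D * D) (D * D))‖ ≤ s ^ 6 := by
  have hr : ∀ x : ℝ, 0 ≤ x → ‖(x : ℂ)‖ = x := fun x hx => by
    rw [Complex.norm_real, Real.norm_of_nonneg hx]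
  have hDD : ‖D * D‖ ≤ 1 :=
    (norm_mul_le _ _).trans (by nlinarith [norm_nonneg D])
  have h1 : ‖superCLM (conjBy (M) : Module.End ℂ (Matrix m m ℂ))‖ ≤ 4 := by
    rw [conjBy_eq_sandwich]
    refine (norm_superCLM_sandwich_le _ _).trans ?_
    rw [l2_opNorm_conjTranspose]
    nlinarith [norm_nonneg (M)]
  have h2 : ‖superCLM (sandwich D (D * D))‖ ≤ 1 :=
    (norm_superCLM_sandwich_le _ _).trans (by nlinarith [norm_nonneg D, norm_nonneg (D * D)])
  have h3 : ‖superCLM (sandwich (D * D) D)‖ ≤ 1 :=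
    (norm_superCLM_sandwich_le _ _).trans (by nlinarith [norm_nonneg D, norm_nonneg (D * D)])
  have h4 : ‖superCLM (sandwich (D * D) (D * D))‖ ≤ 1 :=
    (norm_superCLM_sandwich_le _ _).trans (by nlinarith [norm_nonneg (D * D)])
  rw [map_add, map_smul, map_smul, map_sub, map_sub]
  refine (norm_add_le _ _).trans ?_
  rw [norm_smul, norm_smul, hr _ (by positivity), hr _ (by positivity)]
  have h5 := norm_sub_le (superCLM (conjBy (M) : Module.End ℂ (Matrix m m ℂ)) -
    superCLM (sandwich D (D * D))) (superCLM (sandwich (D * D) D))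
  have h6 := norm_sub_le (superCLM (conjBy (M) : Module.End ℂ (Matrix m m ℂ)))
    (superCLM (sandwich D (D * D)))
  have h7 : s ^ 8 ≤ s ^ 6 := pow_le_pow_of_le_one hs hs1 (by norm_num)
  have h8 : (0 : ℝ) ≤ s ^ 6 := by positivity
  have h9 : (0 : ℝ) ≤ s ^ 8 := by positivity
  have h10 := mul_le_mul_of_nonneg_left (h5.trans (add_le_add (h6.trans (add_le_add h1 h2)) h3))
    (by positivity : (0 : ℝ) ≤ s ^ 6 / 16)
  have h11 := mul_le_mul_of_nonneg_left h4 (by positivity : (0 : ℝ) ≤ s ^ 8 / 64)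
  linarith

/-- The Kraus operators of `kraus_second_order_identity` may be perturbed: a larger error is
admissible for an operator with a smaller norm. -/
theorem norm_kraus_second_order_le {L A₀ A₁ A₂ : Matrix m m ℂ} (hL : ‖L‖ ≤ 1) {s c K : ℝ}
    (hs : 0 ≤ s) (hs1 : s ≤ 1) (hK : 0 ≤ K) (hc : c * c = 1 / 2) (hc0 : 0 ≤ c)
    (h₀ : ‖A₀ - (1 - ((s ^ 2 / 2 : ℝ) : ℂ) • (Lᴴ * L) +
        ((s ^ 4 / 8 : ℝ) : ℂ) • (Lᴴ * L * (Lᴴ * L)))‖ ≤ K * s ^ 6)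
    (h₁ : ‖A₁ - (s : ℂ) • (L - ((s ^ 2 / 4 : ℝ) : ℂ) • (Lᴴ * L * L + L * (Lᴴ * L)))‖ ≤ K * s ^ 5)
    (h₂ : ‖A₂ - ((c * s ^ 2 : ℝ) : ℂ) • (L * L)‖ ≤ K * s ^ 4) :
    ‖superCLM (conjBy A₀ + conjBy A₁ + conjBy A₂ : Module.End ℂ (Matrix m m ℂ)) -
      (1 + ((s ^ 2 : ℝ) : ℂ) • superCLM (dissipator L) +
        (1 / 2 : ℂ) • (((s ^ 2 : ℝ) : ℂ) • superCLM (dissipator L)) ^ 2)‖ ≤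
      (10 * K + 3 * K ^ 2 + 1) * s ^ 6 := by
  have hid := congrArg superCLM (kraus_second_order_identity L s c hc)
  set D := Lᴴ * L with hD
  have hDn : ‖D‖ ≤ 1 := by
    rw [hD, l2_opNorm_conjTranspose_mul_self]; nlinarith [norm_nonneg L]
  have hDD : ‖D * D‖ ≤ 1 :=
    (norm_mul_le _ _).trans (by nlinarith [norm_nonneg D])
  have hLL : ‖L * L‖ ≤ 1 :=
    (norm_mul_le _ _).trans (by nlinarith [norm_nonneg L])
  have hDL : ‖D * L + L * D‖ ≤ 2 := by
    refine (norm_add_le _ _).trans ?_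
    have h1 := norm_mul_le D L
    have h2 := norm_mul_le L D
    nlinarith [norm_nonneg D, norm_nonneg L]
  have hs2 : s ^ 2 ≤ 1 := pow_le_one₀ hs hs1
  have hs4 : s ^ 4 ≤ 1 := pow_le_one₀ hs hs1
  have hs6 : s ^ 6 ≤ 1 := pow_le_one₀ hs hs1
  have hr : ∀ x : ℝ, 0 ≤ x → ‖(x : ℂ)‖ = x := fun x hx => by
    rw [Complex.norm_real, Real.norm_of_nonneg hx]
  set a₀ := 1 - ((s ^ 2 / 2 : ℝ) : ℂ) • D + ((s ^ 4 / 8 : ℝ) : ℂ) • (D * D) with ha₀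
  set a₁ := (s : ℂ) • (L - ((s ^ 2 / 4 : ℝ) : ℂ) • (D * L + L * D)) with ha₁
  set a₂ := ((c * s ^ 2 : ℝ) : ℂ) • (L * L) with ha₂
  have n₀ : ‖a₀‖ ≤ 2 := by
    have h1 : ‖((s ^ 2 / 2 : ℝ) : ℂ) • D‖ ≤ 1 / 2 := by
      rw [norm_smul, hr _ (by positivity)]; nlinarith [norm_nonneg D]
    have h2 : ‖((s ^ 4 / 8 : ℝ) : ℂ) • (D * D)‖ ≤ 1 / 8 := by
      rw [norm_smul, hr _ (by positivity)]; nlinarith [norm_nonneg (D * D)]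
    have h3 := norm_add_le (1 - ((s ^ 2 / 2 : ℝ) : ℂ) • D) (((s ^ 4 / 8 : ℝ) : ℂ) • (D * D))
    have h4 := norm_sub_le 1 (((s ^ 2 / 2 : ℝ) : ℂ) • D)
    have h5 := norm_one_le (m := m)
    linarith
  have n₁ : ‖a₁‖ ≤ 2 * s := by
    have h1 : ‖((s ^ 2 / 4 : ℝ) : ℂ) • (D * L + L * D)‖ ≤ 1 / 2 := by
      rw [norm_smul, hr _ (by positivity)]; nlinarith [norm_nonneg (D * L + L * D)]
    have h2 := norm_sub_le L (((s ^ 2 / 4 : ℝ) : ℂ) • (D * L + L * D))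
    rw [ha₁, norm_smul, hr _ hs]
    nlinarith
  have hc1 : c ≤ 1 := by nlinarith
  have n₂ : ‖a₂‖ ≤ s ^ 2 := by
    rw [ha₂, norm_smul, hr _ (by positivity)]
    have : c * s ^ 2 ≤ s ^ 2 := mul_le_of_le_one_left (by positivity) hc1
    nlinarith [norm_nonneg (L * L), sq_nonneg s]
  have d₀ := norm_superCLM_conjBy_sub_le h₀ n₀
  have d₁ := norm_superCLM_conjBy_sub_le h₁ n₁
  have d₂ := norm_superCLM_conjBy_sub_le h₂ n₂
  have hR := norm_kraus_residual_le (D := D) hs hs1 hDn hDL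
  simp only [map_add, map_smul, map_pow, map_one] at hid hR
  rw [map_add, map_add]
  refine (norm_add_add_sub_le_of_eq hid).trans ?_
  have t0 : K * s ^ 6 * (2 * 2 + K * s ^ 6) ≤ (4 * K + K ^ 2) * s ^ 6 := by
    have : K * s ^ 6 * (K * s ^ 6) ≤ K * s ^ 6 * (K * 1) := by gcongr
    linarith
  have t1 : K * s ^ 5 * (2 * (2 * s) + K * s ^ 5) ≤ (4 * K + K ^ 2) * s ^ 6 := by
    have h1 : s ^ 5 * s ^ 5 ≤ s ^ 6 := by
      rw [← pow_add]; exact pow_le_pow_of_le_one hs hs1 (by norm_num)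
    have h2 : K ^ 2 * (s ^ 5 * s ^ 5) ≤ K ^ 2 * s ^ 6 := by gcongr
    linarith
  have t2 : K * s ^ 4 * (2 * s ^ 2 + K * s ^ 4) ≤ (2 * K + K ^ 2) * s ^ 6 := by
    have h1 : s ^ 4 * s ^ 4 ≤ s ^ 6 := by
      rw [← pow_add]; exact pow_le_pow_of_le_one hs hs1 (by norm_num)
    have h2 : K ^ 2 * (s ^ 4 * s ^ 4) ≤ K ^ 2 * s ^ 6 := by gcongr
    linarith
  linarith

end SecondOrder
end

noncomputable section

open scoped Matrix.Norms.L2Operator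
open Matrix

/-! ### Kraus operators of a step in terms of rotation angles -/

section Trigonometry

theorem abs_cos_sub_taylor_le {x : ℝ} (hx : |x| ≤ 1) :
    |Real.cos x - (1 - x ^ 2 / 2 + x ^ 4 / 24)| ≤ |x| ^ 6 := by
  have h := Complex.exp_bound (x := x * Complex.I) (by simpa using hx) (n := 6) (by norm_num)
  have h2 := (Complex.abs_re_le_norm _).trans h
  have e : (Complex.exp (x * Complex.I) -
      ∑ m ∈ Finset.range 6, (x * Complex.I) ^ m / (m.factorial : ℂ)).re =
      Real.cos x - (1 - x ^ 2 / 2 + x ^ 4 / 24) := by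
    rw [Complex.sub_re, Complex.exp_ofReal_mul_I_re]
    congr 1
    have : ∑ m ∈ Finset.range 6, (x * Complex.I) ^ m / (m.factorial : ℂ) =
        ((1 - x ^ 2 / 2 + x ^ 4 / 24 : ℝ) : ℂ) + ((x - x ^ 3 / 6 + x ^ 5 / 120 : ℝ) : ℂ) *
          Complex.I := by
      simp only [Finset.sum_range_succ, Finset.sum_range_zero, Nat.factorial]
      push_cast
      ring_nf
      simp only [Complex.I_sq, show Complex.I ^ 3 = -Complex.I by rw [pow_succ, Complex.I_sq]; ring,
        Complex.I_pow_four,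
        show Complex.I ^ 5 = Complex.I by rw [pow_succ, Complex.I_pow_four]; ring]
      ring
    rw [this, Complex.add_re, Complex.re_ofReal_mul, Complex.I_re, Complex.ofReal_re]
    ring
  rw [e] at h2
  have e2 : ‖(x : ℂ) * Complex.I‖ = |x| := by simp
  rw [e2] at h2
  refine h2.trans (mul_le_of_le_one_right (by positivity) ?_)
  norm_num [Nat.factorial]

theorem abs_sin_sub_taylor_le {x : ℝ} (hx : |x| ≤ 1) :
    |Real.sin x - (x - x ^ 3 / 6)| ≤ |x| ^ 5 := by
  have h := Complex.exp_bound (x := x * Complex.I) (by simpa using hx) (n := 5) (by norm_num)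
  have h2 := (Complex.abs_im_le_norm _).trans h
  have e : (Complex.exp (x * Complex.I) -
      ∑ m ∈ Finset.range 5, (x * Complex.I) ^ m / (m.factorial : ℂ)).im =
      Real.sin x - (x - x ^ 3 / 6) := by
    rw [Complex.sub_im, Complex.exp_ofReal_mul_I_im]
    congr 1
    have : ∑ m ∈ Finset.range 5, (x * Complex.I) ^ m / (m.factorial : ℂ) =
        ((1 - x ^ 2 / 2 + x ^ 4 / 24 : ℝ) : ℂ) + ((x - x ^ 3 / 6 : ℝ) : ℂ) * Complex.I := by
      simp only [Finset.sum_range_succ, Finset.sum_range_zero, Nat.factorial]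
      push_cast
      ring_nf
      simp only [Complex.I_sq, show Complex.I ^ 3 = -Complex.I by rw [pow_succ, Complex.I_sq]; ring,
        Complex.I_pow_four]
      ring
    rw [this, Complex.add_im, Complex.im_ofReal_mul, Complex.I_im, Complex.ofReal_im]
    ring
  rw [e] at h2
  have e2 : ‖(x : ℂ) * Complex.I‖ = |x| := by simp
  rw [e2] at h2
  refine h2.trans (mul_le_of_le_one_right (by positivity) ?_)
  norm_num [Nat.factorial]

theorem abs_sin_sub_sin_le (a b : ℝ) : |Real.sin a - Real.sin b| ≤ |a - b| := by
  rw [Real.sin_sub_sin, abs_mul, abs_mul, abs_two]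
  have h1 : |Real.sin ((a - b) / 2)| ≤ |a - b| / 2 := by
    refine Real.abs_sin_le_abs.trans ?_
    rw [abs_div, abs_two]
  have h2 := Real.abs_cos_le_one ((a + b) / 2)
  nlinarith [abs_nonneg (Real.sin ((a - b) / 2))]

theorem abs_cos_sub_cos_le (a b : ℝ) : |Real.cos a - Real.cos b| ≤ (|a| + |b|) / 2 * |a - b| := by
  rw [Real.cos_sub_cos, abs_mul, abs_mul, abs_neg, abs_two]
  have h1 : |Real.sin ((a - b) / 2)| ≤ |a - b| / 2 := by
    refine Real.abs_sin_le_abs.trans ?_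
    rw [abs_div, abs_two]
  have h2 : |Real.sin ((a + b) / 2)| ≤ (|a| + |b|) / 2 := by
    refine Real.abs_sin_le_abs.trans ?_
    rw [abs_div, abs_two]
    gcongr
    exact abs_add_le a b
  have h3 := mul_le_mul h2 h1 (abs_nonneg _) (by positivity)
  linarith

/-- Rotation by `x - x³/12` with `x = √(τd)` has the cosine `1 - τd/2 + (τd)²/8 + O(τ³)`, as the
amplitude `exp (-τd/2)` of the no-jump evolution. -/
theorem abs_cos_angle_sub_le {s e α K : ℝ} (hs : 0 ≤ s) (hs1 : s ≤ 1) (he : 0 ≤ e) (he1 : e ≤ 1)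
    (hK : 0 ≤ K) (hα : |α - (s * e - (s * e) ^ 3 / 12)| ≤ K * s ^ 5) :
    |Real.cos α - (1 - s ^ 2 / 2 * e ^ 2 + s ^ 4 / 8 * e ^ 4)| ≤ (K ^ 2 + 2 * K + 3) * s ^ 6 := by
  set x := s * e with hx
  have hx0 : 0 ≤ x := by positivity
  have hxs : x ≤ s := by nlinarith
  have hx1 : x ≤ 1 := hxs.trans hs1
  set θ := x - x ^ 3 / 12 with hθ
  have hu : x ^ 2 ≤ 1 := pow_le_one₀ hx0 hx1
  have hx3 : 0 ≤ x ^ 3 := by positivity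
  have hx3' : x ^ 3 ≤ x := by nlinarith
  have hθ0 : 0 ≤ θ := by linarith
  have hθx : θ ≤ x := by linarith
  have h1 := abs_cos_sub_taylor_le (x := θ) (by rw [abs_of_nonneg hθ0]; linarith)
  have h2 := abs_cos_sub_cos_le α θ
  have hα' : |α| ≤ s + K * s ^ 5 := by
    have := abs_sub_abs_le_abs_sub α θ
    rw [abs_of_nonneg hθ0] at this
    linarith
  have hs5 : s ^ 5 ≤ s := by
    calc s ^ 5 ≤ s ^ 1 := pow_le_pow_of_le_one hs hs1 (by norm_num)
      _ = s := pow_one s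
  have h3 : (|α| + |θ|) / 2 * |α - θ| ≤ (s + K * s + s) / 2 * (K * s ^ 5) := by
    have : K * s ^ 5 ≤ K * s := by gcongr
    rw [abs_of_nonneg hθ0]
    gcongr <;> linarith
  have h4 : |θ| ^ 6 ≤ s ^ 6 := by
    rw [abs_of_nonneg hθ0]; gcongr; linarith
  have h5 : |(1 - θ ^ 2 / 2 + θ ^ 4 / 24) - (1 - s ^ 2 / 2 * e ^ 2 + s ^ 4 / 8 * e ^ 4)| ≤
      s ^ 6 := by
    have e1 : (1 - θ ^ 2 / 2 + θ ^ 4 / 24) - (1 - s ^ 2 / 2 * e ^ 2 + s ^ 4 / 8 * e ^ 4) =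
        -(x ^ 6 * (1 / 288 + 1 / 24 * (1 / 3 - x ^ 2 / 24 + x ^ 4 / 432 - x ^ 6 / 20736))) := by
      rw [hθ, hx]; ring
    have hx4 : x ^ 4 ≤ 1 := pow_le_one₀ hx0 hx1
    have hx6 : x ^ 6 ≤ 1 := pow_le_one₀ hx0 hx1
    have hx4' : 0 ≤ x ^ 4 := by positivity
    have hx6' : 0 ≤ x ^ 6 := by positivity
    rw [e1, abs_neg, abs_of_nonneg (mul_nonneg hx6' (by nlinarith))]
    calc _ ≤ x ^ 6 * 1 := by gcongr; nlinarith
      _ ≤ s ^ 6 := by rw [mul_one]; gcongr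
  have h6 := abs_add_three (Real.cos α - Real.cos θ) (Real.cos θ - (1 - θ ^ 2 / 2 + θ ^ 4 / 24))
    ((1 - θ ^ 2 / 2 + θ ^ 4 / 24) - (1 - s ^ 2 / 2 * e ^ 2 + s ^ 4 / 8 * e ^ 4))
  have e3 : Real.cos α - Real.cos θ + (Real.cos θ - (1 - θ ^ 2 / 2 + θ ^ 4 / 24)) +
      ((1 - θ ^ 2 / 2 + θ ^ 4 / 24) - (1 - s ^ 2 / 2 * e ^ 2 + s ^ 4 / 8 * e ^ 4)) =
      Real.cos α - (1 - s ^ 2 / 2 * e ^ 2 + s ^ 4 / 8 * e ^ 4) := by ring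
  rw [e3] at h6
  have h7 : (s + K * s + s) / 2 * (K * s ^ 5) = (K ^ 2 / 2 + K) * s ^ 6 := by ring
  have h8 : 0 ≤ s ^ 6 := by positivity
  nlinarith [mul_nonneg (mul_nonneg hK hK) h8, mul_nonneg hK h8]

/-- The sine of the same angle is `√(τd) (1 - τd/4) + O(s⁵)`, the right factor in the Kraus
operator of a single jump. -/
theorem abs_sin_angle_sub_le {s e α K : ℝ} (hs : 0 ≤ s) (hs1 : s ≤ 1) (he : 0 ≤ e) (he1 : e ≤ 1)
    (hK : 0 ≤ K) (hα : |α - (s * e - (s * e) ^ 3 / 12)| ≤ K * s ^ 5) :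
    |Real.sin α - (s * e - s ^ 3 / 4 * e ^ 3)| ≤ (K ^ 2 + 2 * K + 3) * s ^ 5 := by
  set x := s * e with hx
  have hx0 : 0 ≤ x := by positivity
  have hxs : x ≤ s := by nlinarith
  have hx1 : x ≤ 1 := hxs.trans hs1
  set θ := x - x ^ 3 / 12 with hθ
  have hu : x ^ 2 ≤ 1 := pow_le_one₀ hx0 hx1
  have hx3 : 0 ≤ x ^ 3 := by positivity
  have hx3' : x ^ 3 ≤ x := by nlinarith
  have hθ0 : 0 ≤ θ := by linarith
  have hθx : θ ≤ x := by linarith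
  have h1 := abs_sin_sub_taylor_le (x := θ) (by rw [abs_of_nonneg hθ0]; linarith)
  have h2 := (abs_sin_sub_sin_le α θ).trans hα
  have h4 : |θ| ^ 5 ≤ s ^ 5 := by
    rw [abs_of_nonneg hθ0]; gcongr; linarith
  have h5 : |(θ - θ ^ 3 / 6) - (x - s ^ 3 / 4 * e ^ 3)| ≤ s ^ 5 := by
    have e1 : (θ - θ ^ 3 / 6) - (x - s ^ 3 / 4 * e ^ 3) =
        x ^ 5 * (1 / 24 - x ^ 2 / 288 + x ^ 4 / 10368) := by
      rw [hθ, hx]; ring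
    have hx4 : x ^ 4 ≤ 1 := pow_le_one₀ hx0 hx1
    have hx4' : 0 ≤ x ^ 4 := by positivity
    rw [e1, abs_of_nonneg (mul_nonneg (by positivity) (by nlinarith))]
    calc _ ≤ x ^ 5 * 1 := by gcongr; nlinarith
      _ ≤ s ^ 5 := by rw [mul_one]; gcongr
  have h6 := abs_add_three (Real.sin α - Real.sin θ) (Real.sin θ - (θ - θ ^ 3 / 6))
    ((θ - θ ^ 3 / 6) - (x - s ^ 3 / 4 * e ^ 3))
  have e3 : Real.sin α - Real.sin θ + (Real.sin θ - (θ - θ ^ 3 / 6)) +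
      ((θ - θ ^ 3 / 6) - (x - s ^ 3 / 4 * e ^ 3)) =
      Real.sin α - (x - s ^ 3 / 4 * e ^ 3) := by ring
  rw [e3] at h6
  have h8 : 0 ≤ s ^ 5 := by positivity
  nlinarith [mul_nonneg (mul_nonneg hK hK) h8, mul_nonneg hK h8]

/-- The second rotation has the angle `√(τd/2)`; its cosine `1 - τd/4 + O(s⁴)` is the left
factor in the Kraus operator of a single jump. -/
theorem abs_cos_half_angle_sub_le {s e c β K : ℝ} (hs : 0 ≤ s) (hs1 : s ≤ 1) (he : 0 ≤ e)
    (he1 : e ≤ 1) (hc : c * c = 1 / 2) (hc0 : 0 ≤ c) (hK : 0 ≤ K)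
    (hβ : |β - c * (s * e)| ≤ K * s ^ 3) :
    |Real.cos β - (1 - s ^ 2 / 4 * e ^ 2)| ≤ (K ^ 2 + 2 * K + 3) * s ^ 4 := by
  have hc1 : c ≤ 1 := by nlinarith
  set x := c * (s * e) with hx
  have hx0 : 0 ≤ x := by positivity
  have hse : s * e ≤ s := by nlinarith
  have hxs : x ≤ s := by nlinarith
  have hx1 : x ≤ 1 := hxs.trans hs1
  have h1 := abs_cos_sub_taylor_le (x := x) (by rwa [abs_of_nonneg hx0])
  have h2 := abs_cos_sub_cos_le β x
  have hs3 : s ^ 3 ≤ s := by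
    calc s ^ 3 ≤ s ^ 1 := pow_le_pow_of_le_one hs hs1 (by norm_num)
      _ = s := pow_one s
  have hβ' : |β| ≤ s + K * s := by
    have h := abs_sub_abs_le_abs_sub β x
    rw [abs_of_nonneg hx0] at h
    have : K * s ^ 3 ≤ K * s := by gcongr
    linarith
  have h3 : (|β| + |x|) / 2 * |β - x| ≤ (s + K * s + s) / 2 * (K * s ^ 3) := by
    rw [abs_of_nonneg hx0]
    gcongr
  have h4 : |x| ^ 6 ≤ s ^ 4 := by
    rw [abs_of_nonneg hx0]
    calc x ^ 6 ≤ s ^ 6 := by gcongr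
      _ ≤ s ^ 4 := pow_le_pow_of_le_one hs hs1 (by norm_num)
  have h5 : |x ^ 4 / 24| ≤ s ^ 4 := by
    have : x ^ 4 ≤ s ^ 4 := by gcongr
    rw [abs_of_nonneg (by positivity)]
    have : 0 ≤ x ^ 4 := by positivity
    linarith
  have h6 := abs_add_three (Real.cos β - Real.cos x) (Real.cos x - (1 - x ^ 2 / 2 + x ^ 4 / 24))
    (x ^ 4 / 24)
  have e3 : Real.cos β - Real.cos x + (Real.cos x - (1 - x ^ 2 / 2 + x ^ 4 / 24)) + x ^ 4 / 24 =
      Real.cos β - (1 - s ^ 2 / 4 * e ^ 2) := by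
    have : x ^ 2 = s ^ 2 / 2 * e ^ 2 := by
      rw [hx]; linear_combination (s * e) ^ 2 * hc
    linear_combination 1 / 2 * this
  rw [e3] at h6
  have h7 : (s + K * s + s) / 2 * (K * s ^ 3) = (K ^ 2 / 2 + K) * s ^ 4 := by ring
  have h8 : 0 ≤ s ^ 4 := by positivity
  nlinarith [mul_nonneg (mul_nonneg hK hK) h8, mul_nonneg hK h8]

theorem abs_sin_half_angle_sub_le {s e c β K : ℝ} (hs : 0 ≤ s) (hs1 : s ≤ 1) (he : 0 ≤ e)
    (he1 : e ≤ 1) (hc : c * c = 1 / 2) (hc0 : 0 ≤ c) (hK : 0 ≤ K)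
    (hβ : |β - c * (s * e)| ≤ K * s ^ 3) :
    |Real.sin β - c * (s * e)| ≤ (K ^ 2 + 2 * K + 3) * s ^ 3 := by
  have hc1 : c ≤ 1 := by nlinarith
  set x := c * (s * e) with hx
  have hx0 : 0 ≤ x := by positivity
  have hse : s * e ≤ s := by nlinarith
  have hxs : x ≤ s := by nlinarith
  have hx1 : x ≤ 1 := hxs.trans hs1
  have h1 := abs_sin_sub_taylor_le (x := x) (by rwa [abs_of_nonneg hx0])
  have h2 := (abs_sin_sub_sin_le β x).trans hβ
  have h4 : |x| ^ 5 ≤ s ^ 3 := by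
    rw [abs_of_nonneg hx0]
    calc x ^ 5 ≤ s ^ 5 := by gcongr
      _ ≤ s ^ 3 := pow_le_pow_of_le_one hs hs1 (by norm_num)
  have h5 : |-(x ^ 3 / 6)| ≤ s ^ 3 := by
    have : x ^ 3 ≤ s ^ 3 := by gcongr
    rw [abs_neg, abs_of_nonneg (by positivity)]
    have : 0 ≤ x ^ 3 := by positivity
    linarith
  have h6 := abs_add_three (Real.sin β - Real.sin x) (Real.sin x - (x - x ^ 3 / 6)) (-(x ^ 3 / 6))
  have e3 : Real.sin β - Real.sin x + (Real.sin x - (x - x ^ 3 / 6)) + -(x ^ 3 / 6) =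
      Real.sin β - x := by ring
  rw [e3] at h6
  have h8 : 0 ≤ s ^ 3 := by positivity
  nlinarith [mul_nonneg (mul_nonneg hK hK) h8, mul_nonneg hK h8]

end Trigonometry

section StepKraus

variable {m r : Type*} [Fintype m] [DecidableEq m] [Fintype r] [DecidableEq r]

/-- The diagonal matrix with the given real entries. -/
def realDiag (v : m → ℝ) : Matrix m m ℂ := diagonal fun i => (v i : ℂ)

theorem norm_realDiag_le {v : m → ℝ} {c : ℝ} (hc : 0 ≤ c) (h : ∀ i, |v i| ≤ c) :
    ‖realDiag v‖ ≤ c := by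
  rw [realDiag, l2_opNorm_diagonal, pi_norm_le_iff_of_nonneg hc]
  intro i
  rw [Complex.norm_real]
  exact h i

theorem realDiag_mul (v w : m → ℝ) : realDiag v * realDiag w = realDiag fun i => v i * w i := by
  simp [realDiag, diagonal_mul_diagonal]

theorem realDiag_sub (v w : m → ℝ) : realDiag v - realDiag w = realDiag fun i => v i - w i := by
  simp [realDiag]

theorem realDiag_conjTranspose (v : m → ℝ) : (realDiag v)ᴴ = realDiag v := by
  rw [realDiag, diagonal_conjTranspose]
  congr 1; ext i; simp

theorem smul_realDiag (c : ℝ) (v : m → ℝ) : (c : ℂ) • realDiag v = realDiag fun i => c * v i := by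
  ext i j
  by_cases h : i = j <;> simp [realDiag, h]

theorem realDiag_one : realDiag (fun _ => 1 : m → ℝ) = 1 := by
  simp [realDiag]

theorem realDiag_add (v w : m → ℝ) : realDiag v + realDiag w = realDiag fun i => v i + w i := by
  simp [realDiag, diagonal_add]

/-- The Kraus operators of one step: no jump, one jump and two jumps. The jumps are made by `S`,
and the angles `α` and `β` fix the amplitudes of the first and of the second jump. -/
def stepKraus (S : Matrix m m ℂ) (α β : m → ℝ) : Option Bool → Matrix m m ℂ
  | none => realDiag fun i => Real.cos (α i)
  | some false => realDiag (fun i => Real.cos (β i)) * S * realDiag fun i => Real.sin (α i)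
  | some true => S * realDiag (fun i => Real.sin (β i)) * S * realDiag fun i => Real.sin (α i)

/-- A step is trace preserving if the angles vanish wherever the jump `S` is not isometric. -/
theorem sum_stepKraus {S : Matrix m m ℂ} {α β p : m → ℝ} (hS : Sᴴ * S = realDiag p)
    (hα : ∀ i, p i = 1 ∨ α i = 0) (hβ : ∀ i, p i = 1 ∨ β i = 0) :
    ∑ z, (stepKraus S α β z)ᴴ * stepKraus S α β z = 1 := by
  have hsin : ∀ γ : m → ℝ, (∀ i, p i = 1 ∨ γ i = 0) →
      realDiag (fun i => Real.sin (γ i)) * (Sᴴ * S) * realDiag (fun i => Real.sin (γ i)) =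
        realDiag fun i => Real.sin (γ i) ^ 2 := by
    intro γ hγ
    rw [hS, realDiag_mul, realDiag_mul]
    congr 1
    ext i
    rcases hγ i with h | h <;> simp [h, sq]
  rw [Fintype.sum_option, Fintype.sum_bool]
  simp only [stepKraus, conjTranspose_mul, realDiag_conjTranspose]
  set Sα := realDiag fun i => Real.sin (α i)
  set Sβ := realDiag fun i => Real.sin (β i) with hSβ
  set Cβ := realDiag fun i => Real.cos (β i) with hCβ
  have e1 : Sα * (Sᴴ * (Sβ * Sᴴ)) * (S * Sβ * S * Sα) =
      Sα * (Sᴴ * (Sβ * (Sᴴ * S) * Sβ) * S) * Sα := by simp only [Matrix.mul_assoc]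
  have e2 : Sα * (Sᴴ * Cβ) * (Cβ * S * Sα) = Sα * (Sᴴ * (Cβ * Cβ) * S) * Sα := by
    simp only [Matrix.mul_assoc]
  rw [e1, e2, hsin β hβ, ← Matrix.add_mul, ← Matrix.mul_add, ← Matrix.add_mul, ← Matrix.mul_add,
    show Cβ * Cβ = _ from realDiag_mul _ _, realDiag_add]
  have e3 : (realDiag fun i => Real.sin (β i) ^ 2 + Real.cos (β i) * Real.cos (β i)) = 1 := by
    rw [← realDiag_one]
    congr 1
    ext i
    rw [← sq, Real.sin_sq_add_cos_sq]
  rw [e3, Matrix.mul_one, hsin α hα, realDiag_mul, realDiag_add, ← realDiag_one]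
  congr 1
  ext i
  rw [← sq, Real.cos_sq_add_sin_sq]

/-- The Kraus operator of two jumps only has to be correct in the leading order. -/
theorem norm_two_jumps_sub_le {S B Z E : Matrix m m ℂ} {s c K K₁ : ℝ} (hSn : ‖S‖ ≤ 1)
    (t1 : ‖B - ((c * s : ℝ) : ℂ) • E‖ ≤ K₁ * s ^ 3) (t2 : ‖Z - (s : ℂ) • E‖ ≤ (K₁ + 1) * s ^ 3)
    (t3 : ‖((c * s : ℝ) : ℂ) • E‖ ≤ s) (t4 : ‖Z‖ ≤ (K + 1) * s) (hs : 0 ≤ s)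
    (h3 : 3 ≤ K₁) :
    ‖S * B * S * Z - ((c * s ^ 2 : ℝ) : ℂ) • (S * E * (S * E))‖ ≤ K₁ * (K + 3) * s ^ 4 := by
  have e1 : S * B * S * Z - ((c * s ^ 2 : ℝ) : ℂ) • (S * E * (S * E)) =
      S * (B - ((c * s : ℝ) : ℂ) • E) * S * Z +
        S * (((c * s : ℝ) : ℂ) • E) * S * (Z - (s : ℂ) • E) := by
    simp only [Matrix.sub_mul, Matrix.mul_sub, Matrix.smul_mul, Matrix.mul_smul, smul_smul,
      Matrix.mul_assoc]
    push_cast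
    module
  have n1 : ‖S * (B - ((c * s : ℝ) : ℂ) • E) * S * Z‖ ≤ 1 * (K₁ * s ^ 3) * 1 * ((K + 1) * s) := by
    refine (norm_mul_le _ _).trans (mul_le_mul ?_ t4 (norm_nonneg _) (by positivity))
    refine (norm_mul_le _ _).trans (mul_le_mul ?_ hSn (norm_nonneg _) (by positivity))
    exact (norm_mul_le _ _).trans (mul_le_mul hSn t1 (norm_nonneg _) (by positivity))
  have n2 : ‖S * (((c * s : ℝ) : ℂ) • E) * S * (Z - (s : ℂ) • E)‖ ≤
      1 * s * 1 * ((K₁ + 1) * s ^ 3) := by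
    refine (norm_mul_le _ _).trans (mul_le_mul ?_ t2 (norm_nonneg _) (by positivity))
    refine (norm_mul_le _ _).trans (mul_le_mul ?_ hSn (norm_nonneg _) (by positivity))
    exact (norm_mul_le _ _).trans (mul_le_mul hSn t3 (norm_nonneg _) (by positivity))
  rw [e1]
  refine (norm_add_le _ _).trans ((add_le_add n1 n2).trans ?_)
  have : 0 ≤ s ^ 4 := by positivity
  nlinarith

set_option maxHeartbeats 400000 in
/-- One step, with angles of the stated accuracy, follows the semigroup up to order `s⁶ = τ³`. -/
theorem norm_stepKraus_sub_le {S : Matrix m m ℂ} {α β p e : m → ℝ} (hS : Sᴴ * S = realDiag p)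
    (hp : ∀ i, p i = 1 ∨ p i = 0) (hpe : ∀ i, p i = 1 ∨ e i = 0) (he : ∀ i, 0 ≤ e i)
    (he1 : ∀ i, e i ≤ 1) {s c K : ℝ} (hs : 0 ≤ s) (hs1 : s ≤ 1) (hK : 0 ≤ K)
    (hc : c * c = 1 / 2) (hc0 : 0 ≤ c)
    (hα : ∀ i, |α i - (s * e i - (s * e i) ^ 3 / 12)| ≤ K * s ^ 5)
    (hβ : ∀ i, |β i - c * (s * e i)| ≤ K * s ^ 3) :
    ∃ K', K' = (K ^ 2 + 2 * K + 3) * (K + 3) ∧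
    ‖superCLM (ampliationHom r (krausMap (stepKraus S α β))) -
      (1 + ((s ^ 2 : ℝ) : ℂ) • superCLM (ampliationHom r (dissipator (S * realDiag e))) +
        (1 / 2 : ℂ) • (((s ^ 2 : ℝ) : ℂ) •
          superCLM (ampliationHom r (dissipator (S * realDiag e)))) ^ 2)‖ ≤
      (10 * K' + 3 * K' ^ 2 + 1) * s ^ 6 := by
  refine ⟨_, rfl, ?_⟩
  set K₁ := K ^ 2 + 2 * K + 3 with hK₁
  have hK₁0 : 0 ≤ K₁ := by positivity
  set L := S * realDiag e with hLdef
  set E := realDiag e with hE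
  have hSn : ‖S‖ ≤ 1 := by
    have h1 : ‖S‖ * ‖S‖ ≤ 1 := by
      rw [← l2_opNorm_conjTranspose_mul_self, hS]
      refine norm_realDiag_le zero_le_one fun i => ?_
      rcases hp i with h | h <;> simp [h]
    nlinarith [norm_nonneg S]
  have hEn : ‖E‖ ≤ 1 := norm_realDiag_le zero_le_one fun i => by
    rw [abs_of_nonneg (he i)]; exact he1 i
  have hLn : ‖L‖ ≤ 1 := (norm_mul_le _ _).trans (by nlinarith [norm_nonneg S, norm_nonneg E])
  have hD : Lᴴ * L = realDiag fun i => e i ^ 2 := by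
    rw [hLdef, conjTranspose_mul, hE, realDiag_conjTranspose,
      show realDiag e * Sᴴ * (S * realDiag e) = realDiag e * (Sᴴ * S) * realDiag e by
        simp only [Matrix.mul_assoc], hS, realDiag_mul, realDiag_mul]
    congr 1
    ext i
    rcases hpe i with h | h <;> simp [h, sq]
  set D := realDiag fun i => e i ^ 2 with hDdef
  have hDn : ‖D‖ ≤ 1 := norm_realDiag_le zero_le_one fun i => by
    rw [abs_of_nonneg (by positivity)]; exact pow_le_one₀ (he i) (he1 i)
  -- Estimates of the diagonal factors.
  have b₀ : ∀ i, |Real.cos (α i) - (1 - s ^ 2 / 2 * e i ^ 2 + s ^ 4 / 8 * e i ^ 4)| ≤ K₁ * s ^ 6 :=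
    fun i => abs_cos_angle_sub_le hs hs1 (he i) (he1 i) hK (hα i)
  have b₁ : ∀ i, |Real.sin (α i) - (s * e i - s ^ 3 / 4 * e i ^ 3)| ≤ K₁ * s ^ 5 :=
    fun i => abs_sin_angle_sub_le hs hs1 (he i) (he1 i) hK (hα i)
  have b₂ : ∀ i, |Real.cos (β i) - (1 - s ^ 2 / 4 * e i ^ 2)| ≤ K₁ * s ^ 4 :=
    fun i => abs_cos_half_angle_sub_le hs hs1 (he i) (he1 i) hc hc0 hK (hβ i)
  have b₃ : ∀ i, |Real.sin (β i) - c * (s * e i)| ≤ K₁ * s ^ 3 :=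
    fun i => abs_sin_half_angle_sub_le hs hs1 (he i) (he1 i) hc hc0 hK (hβ i)
  have hs53 : s ^ 5 ≤ s ^ 3 := pow_le_pow_of_le_one hs hs1 (by norm_num)
  have hs31 : s ^ 3 ≤ s := by
    calc s ^ 3 ≤ s ^ 1 := pow_le_pow_of_le_one hs hs1 (by norm_num)
      _ = s := pow_one s
  have b₄ : ∀ i, |Real.sin (α i) - s * e i| ≤ (K₁ + 1) * s ^ 3 := by
    intro i
    have h1 : |s ^ 3 / 4 * e i ^ 3| ≤ s ^ 3 := by
      have : e i ^ 3 ≤ 1 := pow_le_one₀ (he i) (he1 i)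
      have h0 := he i
      rw [abs_of_nonneg (by positivity)]
      have : 0 ≤ s ^ 3 := by positivity
      have : 0 ≤ e i ^ 3 := by positivity
      nlinarith
    have h2 := abs_sub_le (Real.sin (α i)) (s * e i - s ^ 3 / 4 * e i ^ 3) (s * e i)
    have e1 : s * e i - s ^ 3 / 4 * e i ^ 3 - s * e i = -(s ^ 3 / 4 * e i ^ 3) := by ring
    rw [e1, abs_neg] at h2
    have h3 := b₁ i
    have h4 : K₁ * s ^ 5 ≤ K₁ * s ^ 3 := by gcongr
    linarith
  have b₅ : ∀ i, |Real.sin (α i)| ≤ (K + 1) * s := by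
    intro i
    refine Real.abs_sin_le_abs.trans ?_
    have h1 := abs_sub_abs_le_abs_sub (α i) (s * e i - (s * e i) ^ 3 / 12)
    have hx0 : 0 ≤ s * e i := mul_nonneg hs (he i)
    have hxs : s * e i ≤ s := mul_le_of_le_one_right hs (he1 i)
    have hx2 : (s * e i) ^ 2 ≤ 1 := pow_le_one₀ hx0 (hxs.trans hs1)
    have hx3 : 0 ≤ (s * e i) ^ 3 := by positivity
    have hx3' : (s * e i) ^ 3 ≤ s * e i := by nlinarith
    rw [abs_of_nonneg (show 0 ≤ s * e i - (s * e i) ^ 3 / 12 by linarith)] at h1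
    have h2 := hα i
    have h3 : K * s ^ 5 ≤ K * s := by gcongr; linarith
    linarith
  have m0 : tensorOne r (1 - ((s ^ 2 / 2 : ℝ) : ℂ) • (Lᴴ * L) +
        ((s ^ 4 / 8 : ℝ) : ℂ) • (Lᴴ * L * (Lᴴ * L))) =
      1 - ((s ^ 2 / 2 : ℝ) : ℂ) • ((tensorOne r L)ᴴ * tensorOne r L) +
        ((s ^ 4 / 8 : ℝ) : ℂ) • ((tensorOne r L)ᴴ * tensorOne r L *
          ((tensorOne r L)ᴴ * tensorOne r L)) := by
    simp only [map_add, map_sub, map_one, map_smul, map_mul, tensorOne_conjTranspose]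
  have m1 : tensorOne r ((s : ℂ) • (L - ((s ^ 2 / 4 : ℝ) : ℂ) • (Lᴴ * L * L + L * (Lᴴ * L)))) =
      (s : ℂ) • (tensorOne r L - ((s ^ 2 / 4 : ℝ) : ℂ) •
        ((tensorOne r L)ᴴ * tensorOne r L * tensorOne r L +
          tensorOne r L * ((tensorOne r L)ᴴ * tensorOne r L))) := by
    simp only [map_add, map_sub, map_smul, map_mul, tensorOne_conjTranspose]
  have m2 : tensorOne r (((c * s ^ 2 : ℝ) : ℂ) • (L * L)) =
      ((c * s ^ 2 : ℝ) : ℂ) • (tensorOne r L * tensorOne r L) := by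
    simp only [map_smul, map_mul]
  have key := norm_kraus_second_order_le (L := tensorOne r L)
    (A₀ := tensorOne r (stepKraus S α β none)) (A₁ := tensorOne r (stepKraus S α β (some false)))
    (A₂ := tensorOne r (stepKraus S α β (some true))) ((norm_tensorOne_le L).trans hLn) hs hs1
    (K := K₁ * (K + 3)) (by positivity) hc hc0 ?_ ?_ ?_
  · rw [ampliationHom_krausMap, ampliationHom_dissipator, krausMap, Fintype.sum_option,
      Fintype.sum_bool, add_comm (conjBy (tensorOne r (stepKraus S α β (some true)))), ← add_assoc]
    exact key
  · rw [← m0, ← map_sub, hD]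
    refine (norm_tensorOne_le _).trans ?_
    rw [stepKraus, ← realDiag_one, realDiag_mul, smul_realDiag, smul_realDiag, realDiag_sub,
      realDiag_add, realDiag_sub]
    have hs6 : 0 ≤ s ^ 6 := by positivity
    refine norm_realDiag_le (by positivity) fun i => ?_
    refine le_trans (le_of_eq (congrArg abs ?_)) ((b₀ i).trans ?_)
    · ring
    · have : K₁ * s ^ 6 * 1 ≤ K₁ * s ^ 6 * (K + 3) := by gcongr; linarith
      linarith
  · rw [← m1, ← map_sub, hD]
    refine (norm_tensorOne_le _).trans ?_
    rw [stepKraus]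
    set C := realDiag fun i => Real.cos (β i) with hC
    set Z := realDiag fun i => Real.sin (α i) with hZ
    set C₀ := realDiag fun i => 1 - s ^ 2 / 4 * e i ^ 2 with hC₀
    set Z₀ := realDiag fun i => s * e i - s ^ 3 / 4 * e i ^ 3 with hZ₀
    have hC₀' : C₀ = 1 - ((s ^ 2 / 4 : ℝ) : ℂ) • D := by
      rw [hC₀, hDdef, smul_realDiag, ← realDiag_one, realDiag_sub]
    have hZ₀' : Z₀ = (s : ℂ) • E - ((s ^ 3 / 4 : ℝ) : ℂ) • (E * D) := by
      rw [hZ₀, hDdef, hE, realDiag_mul, smul_realDiag, smul_realDiag, realDiag_sub]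
      congr 1; ext i; ring
    have e1 : C * S * Z - (s : ℂ) • (L - ((s ^ 2 / 4 : ℝ) : ℂ) • (D * L + L * D)) =
        (C - C₀) * S * Z + C₀ * S * (Z - Z₀) + ((s ^ 5 / 16 : ℝ) : ℂ) • (D * L * D) := by
      have e2 : C₀ * S * Z₀ = (s : ℂ) • (L - ((s ^ 2 / 4 : ℝ) : ℂ) • (D * L + L * D)) +
          ((s ^ 5 / 16 : ℝ) : ℂ) • (D * L * D) := by
        rw [hC₀', hZ₀', hLdef]
        simp only [Matrix.sub_mul, Matrix.mul_sub, Matrix.one_mul, Matrix.smul_mul,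
          Matrix.mul_smul, smul_smul, smul_sub, smul_add, Matrix.mul_assoc]
        push_cast
        module
      rw [← sub_eq_iff_eq_add] at e2
      rw [← e2, Matrix.sub_mul, Matrix.sub_mul, Matrix.mul_sub]
      abel
    rw [e1]
    have n1 : ‖(C - C₀) * S * Z‖ ≤ K₁ * s ^ 4 * 1 * ((K + 1) * s) := by
      refine (norm_mul_le _ _).trans ?_
      have := norm_mul_le (C - C₀) S
      gcongr
      · refine this.trans ?_
        gcongr
        rw [hC, hC₀, realDiag_sub]
        exact norm_realDiag_le (by positivity) b₂
      · exact norm_realDiag_le (by positivity) b₅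
    have n2 : ‖C₀ * S * (Z - Z₀)‖ ≤ 1 * 1 * (K₁ * s ^ 5) := by
      refine (norm_mul_le _ _).trans ?_
      have := norm_mul_le C₀ S
      gcongr
      · refine this.trans ?_
        gcongr
        refine norm_realDiag_le zero_le_one fun i => ?_
        have h1 : e i ^ 2 ≤ 1 := pow_le_one₀ (he i) (he1 i)
        have h2 : s ^ 2 ≤ 1 := pow_le_one₀ hs hs1
        rw [abs_le]
        constructor <;> nlinarith [sq_nonneg (e i), sq_nonneg s]
      · rw [hZ, hZ₀, realDiag_sub]
        exact norm_realDiag_le (by positivity) b₁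
    have n3 : ‖((s ^ 5 / 16 : ℝ) : ℂ) • (D * L * D)‖ ≤ s ^ 5 * 1 := by
      rw [norm_smul, Complex.norm_real, Real.norm_of_nonneg (by positivity)]
      have h1 := norm_mul_le (D * L) D
      have h2 := norm_mul_le D L
      have h3 : ‖D * L‖ ≤ 1 := h2.trans (by nlinarith [norm_nonneg D, norm_nonneg L])
      have h4 : ‖D * L * D‖ ≤ 1 := h1.trans (by nlinarith [norm_nonneg D, norm_nonneg (D * L)])
      have : 0 ≤ s ^ 5 := by positivity
      gcongr
      linarith
    refine norm_add₃_le.trans ((add_le_add_three n1 n2 n3).trans ?_)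
    have : 0 ≤ s ^ 5 := by positivity
    have h3 : 3 ≤ K₁ := by nlinarith [sq_nonneg K]
    nlinarith
  · rw [← m2, ← map_sub]
    refine (norm_tensorOne_le _).trans ?_
    rw [stepKraus]
    set B := realDiag fun i => Real.sin (β i) with hB
    set Z := realDiag fun i => Real.sin (α i) with hZ
    have hc1 : c ≤ 1 := by nlinarith
    have t1 : ‖B - ((c * s : ℝ) : ℂ) • E‖ ≤ K₁ * s ^ 3 := by
      rw [hB, hE, smul_realDiag, realDiag_sub]
      refine norm_realDiag_le (by positivity) fun i => ?_
      rw [mul_assoc]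
      exact b₃ i
    have t2 : ‖Z - (s : ℂ) • E‖ ≤ (K₁ + 1) * s ^ 3 := by
      rw [hZ, hE, smul_realDiag, realDiag_sub]
      exact norm_realDiag_le (by positivity) b₄
    have t3 : ‖((c * s : ℝ) : ℂ) • E‖ ≤ s := by
      rw [norm_smul, Complex.norm_real, Real.norm_of_nonneg (by positivity)]
      have : c * s ≤ s := mul_le_of_le_one_left hs hc1
      nlinarith [norm_nonneg E]
    have t4 : ‖Z‖ ≤ (K + 1) * s := norm_realDiag_le (by positivity) b₅
    exact norm_two_jumps_sub_le hSn t1 t2 t3 t4 hs (by nlinarith [sq_nonneg K])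

end StepKraus
end

noncomputable section

open scoped Matrix.Norms.L2Operator
open Matrix

/-! ### From steps to the semigroup, in diamond norm -/

section Semigroup

variable {m k r κ : Type*} [Fintype m] [DecidableEq m] [Fintype k] [DecidableEq k]
  [Fintype r] [DecidableEq r] [Fintype κ] [DecidableEq κ]

theorem ampliation_conjBy_comp (V : Matrix k m ℂ) (T : Module.End ℂ (Matrix m m ℂ))
    (X : Matrix (m × r) (m × r) ℂ) :
    ampliation r (conjBy V ∘ₗ T) X = kroneckerMap (· * ·) V (1 : Matrix r r ℂ) * ampliation r T X *
      (kroneckerMap (· * ·) V (1 : Matrix r r ℂ))ᴴ := by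
  ext ⟨i, j⟩ ⟨i', j'⟩
  have h : ∀ Y : Matrix m m ℂ, (V * Y * Vᴴ) i i' = ∑ x, ∑ y, V i y * Y y x * star (V i' x) := by
    intro Y
    simp only [Matrix.mul_apply, Finset.sum_mul, conjTranspose_apply]
  refine (h _).trans ?_
  simp [ampliation, Matrix.mul_apply, Fintype.sum_prod_type, kroneckerMap_apply,
    Matrix.one_apply, Finset.sum_mul, apply_ite (starRingEnd ℂ)]

theorem norm_le_one_of_conjTranspose_mul_self {V : Matrix k m ℂ} (hV : Vᴴ * V = 1) : ‖V‖ ≤ 1 := by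
  have h := l2_opNorm_conjTranspose_mul_self V
  rw [hV] at h
  have := norm_one_le (m := m)
  nlinarith [norm_nonneg V]

/-- The diamond norm is the norm of the ampliated superoperator on the trace class; a final
isometric encoding does not increase it. -/
theorem diamondNorm_conjBy_comp_le {V : Matrix k m ℂ} (hV : Vᴴ * V = 1)
    (T : Module.End ℂ (Matrix m m ℂ)) :
    diamondNorm (conjBy V ∘ₗ T) ≤ ENNReal.ofReal ‖superCLM (ampliationHom m T)‖ := by
  refine iSup₂_le fun X hX => ENNReal.ofReal_le_ofReal ?_
  have hK : (kroneckerMap (· * ·) V (1 : Matrix m m ℂ))ᴴ *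
      kroneckerMap (· * ·) V (1 : Matrix m m ℂ) = 1 := by
    have h1 := conjTranspose_kronecker V (1 : Matrix m m ℂ)
    have h2 := mul_kronecker_mul Vᴴ V (1 : Matrix m m ℂ)ᴴ (1 : Matrix m m ℂ)
    rw [hV, conjTranspose_one, Matrix.one_mul, one_kronecker_one] at h2
    rw [conjTranspose_one] at h1
    exact (congrArg (· * kroneckerMap (· * ·) V (1 : Matrix m m ℂ)) h1).trans h2.symm
  have hn := norm_le_one_of_conjTranspose_mul_self hK
  rw [ampliation_conjBy_comp]
  refine (traceNorm_mul_mul_le _ _ _).trans ?_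
  have h3 := traceNorm_apply_le (ampliationHom m T) X
  rw [hX, mul_one, ampliationHom_apply] at h3
  rw [l2_opNorm_conjTranspose]
  have h4 := traceNorm_nonneg (ampliation m T X)
  have h5 : ‖kroneckerMap (· * ·) V (1 : Matrix m m ℂ)‖ *
      ‖kroneckerMap (· * ·) V (1 : Matrix m m ℂ)‖ ≤ 1 :=
    mul_le_one₀ hn (norm_nonneg _) hn
  nlinarith

theorem norm_superCLM_ampliationHom_krausMap_le {A : κ → Matrix m m ℂ}
    (hA : ∑ z, (A z)ᴴ * A z = 1) : ‖superCLM (ampliationHom r (krausMap A))‖ ≤ 1 := by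
  rw [ampliationHom_krausMap]
  refine (norm_superCLM_krausMap_le _).trans ?_
  have : ∑ z, (tensorOne r (A z))ᴴ * tensorOne r (A z) = 1 := by
    simp only [← tensorOne_conjTranspose, ← map_mul]
    rw [← map_sum, hA, map_one]
  rw [this]
  exact norm_one_le

theorem norm_superCLM_ampliationHom_dissipator_le (L : Matrix m m ℂ) :
    ‖superCLM (ampliationHom r (dissipator L))‖ ≤ 2 * ‖L‖ ^ 2 := by
  rw [ampliationHom_dissipator]
  refine (norm_superCLM_dissipator_le _).trans ?_
  have := norm_tensorOne_le (r := r) L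
  gcongr

/-- The semigroup of a dissipator is contractive in diamond norm. -/
theorem norm_superCLM_superExp_dissipator_le_one {L : Matrix m m ℂ} (hL : ‖L‖ ≤ 1) {t : ℝ}
    (ht : 0 ≤ t) :
    ‖superCLM (ampliationHom r (superExp ((t : ℂ) • dissipator L)))‖ ≤ 1 := by
  rw [superCLM_ampliationHom_superExp, map_smul, map_smul]
  have hL' : ‖tensorOne r L‖ ≤ 1 := (norm_tensorOne_le L).trans hL
  refine norm_exp_smul_le_one (B := 2 * ‖L‖ ^ 2) (K := 1 / 2)
    (norm_superCLM_ampliationHom_dissipator_le L) (by norm_num) (fun s hs _ => ?_) ht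
  rw [ampliationHom_dissipator]
  exact norm_one_add_smul_dissipator_le hL' s hs

/-- `M` steps of a contraction that follows the quadratic Taylor polynomial of the generator. -/
theorem norm_superCLM_pow_sub_superExp_le {L : Matrix m m ℂ} (hL : ‖L‖ ≤ 1)
    {Ψ : Module.End ℂ (Matrix m m ℂ)} (hΨ : ‖superCLM (ampliationHom r Ψ)‖ ≤ 1) {τ δ : ℝ}
    (hτ : 0 ≤ τ) (hτ1 : τ ≤ 1 / 2)
    (h : ‖superCLM (ampliationHom r Ψ) -
      (1 + (τ : ℂ) • superCLM (ampliationHom r (dissipator L)) +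
        (1 / 2 : ℂ) • ((τ : ℂ) • superCLM (ampliationHom r (dissipator L))) ^ 2)‖ ≤ δ) (M : ℕ) :
    ‖superCLM (ampliationHom r (Ψ ^ M - superExp (((M * τ : ℝ) : ℂ) • dissipator L)))‖ ≤
      M * (δ + 8 * τ ^ 3) := by
  set T := superCLM (ampliationHom r (dissipator L)) with hT
  have hTn : ‖T‖ ≤ 2 := by
    refine (norm_superCLM_ampliationHom_dissipator_le L).trans ?_
    nlinarith [norm_nonneg L]
  have hx : ‖(τ : ℂ) • T‖ ≤ 2 * τ := by
    rw [norm_smul, Complex.norm_real, Real.norm_of_nonneg hτ]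
    nlinarith
  have h1 := norm_exp_sub_quadratic_le ((τ : ℂ) • T) (hx.trans (by linarith))
  have h2 : ‖(τ : ℂ) • T‖ ^ 3 ≤ (2 * τ) ^ 3 := by gcongr
  have hpow : ∀ j : ℕ, NormedSpace.exp ((τ : ℂ) • T) ^ j =
      superCLM (ampliationHom r (superExp (((j * τ : ℝ) : ℂ) • dissipator L))) := by
    intro j
    let _ : NormedAlgebra ℚ (TraceClass (m × r) →L[ℂ] TraceClass (m × r)) :=
      NormedAlgebra.restrictScalars ℚ ℂ _
    rw [superCLM_ampliationHom_superExp, map_smul, map_smul, ← NormedSpace.exp_nsmul,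
      ← Nat.cast_smul_eq_nsmul ℂ, smul_smul]
    congr 2
    push_cast
    rfl
  have h3 := norm_pow_sub_pow_le hΨ (b := NormedSpace.exp ((τ : ℂ) • T)) (fun j => by
    rw [hpow]
    exact norm_superCLM_superExp_dissipator_le_one hL (by positivity)) M
  rw [hpow, ← map_pow, ← map_pow, ← map_sub, ← map_sub] at h3
  refine h3.trans ?_
  have h4 := norm_sub_le_norm_sub_add_norm_sub (superCLM (ampliationHom r Ψ))
    (1 + (τ : ℂ) • T + (1 / 2 : ℂ) • ((τ : ℂ) • T) ^ 2) (NormedSpace.exp ((τ : ℂ) • T))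
  rw [norm_sub_rev (1 + (τ : ℂ) • T + _)] at h4
  gcongr
  have : (2 * τ) ^ 3 = 8 * τ ^ 3 := by ring
  linarith

/-- Over a time `t` the semigroup departs from the identity by at most `exp (2 t ‖L‖²) - 1`. -/
theorem norm_superCLM_one_sub_superExp_le (L : Matrix m m ℂ) {t : ℝ} (ht : 0 ≤ t) :
    ‖superCLM (ampliationHom r (1 - superExp ((t : ℂ) • dissipator L)))‖ ≤
      Real.exp (t * (2 * ‖L‖ ^ 2)) - 1 := by
  rw [map_sub, map_sub, superCLM_ampliationHom_superExp, map_smul, map_smul, map_one, map_one,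
    norm_sub_rev]
  refine (norm_exp_sub_one_le _).trans ?_
  have : ‖(t : ℂ) • superCLM (ampliationHom r (dissipator L))‖ ≤ t * (2 * ‖L‖ ^ 2) := by
    rw [norm_smul, Complex.norm_real, Real.norm_of_nonneg ht]
    gcongr
    exact norm_superCLM_ampliationHom_dissipator_le L
  gcongr

theorem norm_superCLM_one_sub_superExp_le_two {L : Matrix m m ℂ} (hL : ‖L‖ ≤ 1) {t : ℝ}
    (ht : 0 ≤ t) :
    ‖superCLM (ampliationHom r (1 - superExp ((t : ℂ) • dissipator L)))‖ ≤ 2 := by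
  rw [map_sub, map_sub, map_one, map_one]
  refine (norm_sub_le _ _).trans ?_
  have h1 := norm_superCLM_superExp_dissipator_le_one (r := r) hL ht
  have h2 : ‖(1 : TraceClass (m × r) →L[ℂ] TraceClass (m × r))‖ ≤ 1 :=
    ContinuousLinearMap.norm_id_le
  linarith

end Semigroup
end

noncomputable section

open Matrix

/-! ### Circuits acting on basis states -/

section Gates

variable {W W' : Type*} [Fintype W] [DecidableEq W] [Fintype W'] [DecidableEq W']

/-- The computational basis vector `|x⟩`. -/
def ket (x : W → Bool) : (W → Bool) → ℂ := Pi.single x 1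

theorem mulVec_ket (M : Matrix (W → Bool) (W → Bool) ℂ) (x y : W → Bool) :
    (M *ᵥ ket x) y = M y x := by
  simp [ket]

theorem eq_sum_ket (v : (W → Bool) → ℂ) : v = ∑ z, v z • ket z := by
  ext y
  simp [ket, Finset.sum_apply, Pi.single_apply]

theorem matrix_ext_ket {M N : Matrix (W → Bool) (W → Bool) ℂ} (h : ∀ x, M *ᵥ ket x = N *ᵥ ket x) :
    M = N := by
  ext y x
  have := congrFun (h x) y
  rwa [mulVec_ket, mulVec_ket] at this

theorem TwoQubitGate.toMatrix_mulVec_ket (g : TwoQubitGate W) (x : W → Bool) :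
    g.toMatrix *ᵥ ket x = ∑ p : Bool × Bool,
      (g.unitary : Matrix (Bool × Bool) (Bool × Bool) ℂ) p (x g.fst, x g.snd) •
        ket (Function.update (Function.update x g.fst p.1) g.snd p.2) := by
  have hne := g.fst_ne_snd
  ext y
  rw [mulVec_ket, TwoQubitGate.toMatrix, Finset.sum_apply]
  have hk : ∀ p : Bool × Bool,
      y = Function.update (Function.update x g.fst p.1) g.snd p.2 ↔
        (∀ i, i ≠ g.fst → i ≠ g.snd → y i = x i) ∧ p = (y g.fst, y g.snd) := by
    intro p
    constructor
    · rintro rfl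
      refine ⟨fun i h1 h2 => ?_, ?_⟩
      · rw [Function.update_of_ne h2, Function.update_of_ne h1]
      · rw [Function.update_self, Function.update_of_ne hne, Function.update_self]
    · rintro ⟨h, rfl⟩
      ext i
      by_cases h2 : i = g.snd
      · subst h2; rw [Function.update_self]
      · rw [Function.update_of_ne h2]
        by_cases h1 : i = g.fst
        · subst h1; rw [Function.update_self]
        · rw [Function.update_of_ne h1, h i h1 h2]
  simp only [Pi.smul_apply, smul_eq_mul, ket, Pi.single_apply, hk, mul_ite, mul_one, mul_zero]
  by_cases h : ∀ i, i ≠ g.fst → i ≠ g.snd → y i = x i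
  · simp only [eq_true h, true_and, if_true, Finset.sum_ite_eq', Finset.mem_univ]
  · simp only [eq_false h, false_and, if_false, Finset.sum_const_zero]

theorem QCircuit.toMatrix_nil : QCircuit.toMatrix ([] : QCircuit W) = 1 := rfl

theorem QCircuit.foldl_toMatrix (c : QCircuit W) (M : Matrix (W → Bool) (W → Bool) ℂ) :
    c.foldl (fun M g => g.toMatrix * M) M = QCircuit.toMatrix c * M := by
  induction c generalizing M with
  | nil => rw [QCircuit.toMatrix_nil, Matrix.one_mul]; rfl
  | cons g c ih =>
    rw [QCircuit.toMatrix, List.foldl_cons, List.foldl_cons, ih, ih (g.toMatrix * 1),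
      Matrix.mul_one, Matrix.mul_assoc]

theorem QCircuit.toMatrix_append (c d : QCircuit W) :
    QCircuit.toMatrix (c ++ d : QCircuit W) = QCircuit.toMatrix d * QCircuit.toMatrix c := by
  rw [QCircuit.toMatrix, List.foldl_append, QCircuit.foldl_toMatrix d]
  rfl

theorem QCircuit.toMatrix_cons (g : TwoQubitGate W) (c : QCircuit W) :
    QCircuit.toMatrix (g :: c : QCircuit W) = QCircuit.toMatrix c * g.toMatrix := by
  rw [QCircuit.toMatrix, List.foldl_cons, QCircuit.foldl_toMatrix, Matrix.mul_one]

theorem QCircuit.toMatrix_singleton (g : TwoQubitGate W) :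
    QCircuit.toMatrix ([g] : QCircuit W) = g.toMatrix := by
  rw [QCircuit.toMatrix_cons, QCircuit.toMatrix_nil, Matrix.one_mul]

theorem QCircuit.toMatrix_append_mulVec (c d : QCircuit W) (v : (W → Bool) → ℂ) :
    QCircuit.toMatrix (c ++ d : QCircuit W) *ᵥ v =
      QCircuit.toMatrix d *ᵥ (QCircuit.toMatrix c *ᵥ v) := by
  rw [QCircuit.toMatrix_append, Matrix.mulVec_mulVec]

/-! ### Circuits on a part of the register -/

/-- The state of a larger register whose qubits in the range of `e` are in the state `v` and whose
other qubits are as in `y`. -/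
def liftState (e : W ↪ W') (y : W' → Bool) (v : (W → Bool) → ℂ) : (W' → Bool) → ℂ :=
  ∑ z, v z • ket (Function.extend e z y)

theorem liftState_ket (e : W ↪ W') (y : W' → Bool) (x : W → Bool) :
    liftState e y (ket x) = ket (Function.extend e x y) := by
  simp [liftState, ket, Pi.single_apply]

theorem liftState_sum_smul {α : Type*} (e : W ↪ W') (y : W' → Bool) (s : Finset α)
    (a : α → ℂ) (v : α → (W → Bool) → ℂ) :
    liftState e y (∑ i ∈ s, a i • v i) = ∑ i ∈ s, a i • liftState e y (v i) := by
  simp only [liftState, Finset.sum_apply, Pi.smul_apply, smul_eq_mul, Finset.sum_smul,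
    Finset.smul_sum, smul_smul]
  rw [Finset.sum_comm]

/-- The gate on the images of the qubits under an injection. -/
def TwoQubitGate.relabel (e : W ↪ W') (g : TwoQubitGate W) : TwoQubitGate W' where
  fst := e g.fst
  snd := e g.snd
  fst_ne_snd h := g.fst_ne_snd (e.injective h)
  unitary := g.unitary

/-- The circuit on the images of the qubits under an injection. -/
def QCircuit.relabel (e : W ↪ W') (c : QCircuit W) : QCircuit W' := c.map (TwoQubitGate.relabel e)

theorem QCircuit.length_relabel (e : W ↪ W') (c : QCircuit W) :
    (QCircuit.relabel e c).length = c.length := List.length_map _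

theorem update_extend (e : W ↪ W') (x : W → Bool) (y : W' → Bool) (i : W) (b : Bool) :
    Function.update (Function.extend e x y) (e i) b =
      Function.extend e (Function.update x i b) y := by
  ext j
  by_cases hj : ∃ k, e k = j
  · obtain ⟨k, rfl⟩ := hj
    rw [e.injective.extend_apply]
    by_cases hk : k = i
    · subst hk; rw [Function.update_self, Function.update_self]
    · rw [Function.update_of_ne (fun h => hk (e.injective h)), Function.update_of_ne hk,
        e.injective.extend_apply]
  · rw [Function.extend_apply' _ _ _ hj, Function.update_of_ne, Function.extend_apply' _ _ _ hj]
    rintro rfl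
    exact hj ⟨i, rfl⟩

theorem TwoQubitGate.relabel_mulVec_liftState (e : W ↪ W') (y : W' → Bool) (g : TwoQubitGate W)
    (v : (W → Bool) → ℂ) :
    (g.relabel e).toMatrix *ᵥ liftState e y v = liftState e y (g.toMatrix *ᵥ v) := by
  conv_rhs => rw [eq_sum_ket v]
  rw [liftState, Matrix.mulVec_sum, Matrix.mulVec_sum]
  simp only [Matrix.mulVec_smul]
  rw [liftState_sum_smul]
  refine Finset.sum_congr rfl fun z _ => ?_
  congr 1
  rw [TwoQubitGate.toMatrix_mulVec_ket, TwoQubitGate.toMatrix_mulVec_ket, liftState_sum_smul]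
  refine Finset.sum_congr rfl fun p _ => ?_
  rw [liftState_ket]
  simp only [TwoQubitGate.relabel, update_extend, e.injective.extend_apply]

theorem QCircuit.relabel_mulVec_liftState (e : W ↪ W') (y : W' → Bool) (c : QCircuit W)
    (v : (W → Bool) → ℂ) :
    QCircuit.toMatrix (QCircuit.relabel e c) *ᵥ liftState e y v =
      liftState e y (QCircuit.toMatrix c *ᵥ v) := by
  induction c generalizing v with
  | nil => simp [QCircuit.relabel, QCircuit.toMatrix_nil]
  | cons g c ih =>
    rw [QCircuit.relabel, List.map_cons, QCircuit.toMatrix_cons, QCircuit.toMatrix_cons,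
      ← Matrix.mulVec_mulVec, TwoQubitGate.relabel_mulVec_liftState, ← Matrix.mulVec_mulVec]
    exact ih _

/-! ### Controlled operations on one qubit -/

/-- The operation that applies to the qubit `t` the matrix `F x` chosen by the basis state `x` of
the register. -/
def ctl (t : W) (F : (W → Bool) → Matrix Bool Bool ℂ) : Matrix (W → Bool) (W → Bool) ℂ :=
  fun y x => if ∀ i, i ≠ t → y i = x i then F x (y t) (x t) else 0

theorem ctl_mulVec_ket (t : W) (F : (W → Bool) → Matrix Bool Bool ℂ) (x : W → Bool) :
    ctl t F *ᵥ ket x = ∑ b, F x b (x t) • ket (Function.update x t b) := by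
  ext y
  rw [mulVec_ket, ctl, Finset.sum_apply]
  have hk : ∀ b : Bool, y = Function.update x t b ↔ (∀ i, i ≠ t → y i = x i) ∧ b = y t := by
    intro b
    constructor
    · rintro rfl
      exact ⟨fun i h => Function.update_of_ne h _ _, by rw [Function.update_self]⟩
    · rintro ⟨h, rfl⟩
      ext i
      by_cases hi : i = t
      · subst hi; rw [Function.update_self]
      · rw [Function.update_of_ne hi, h i hi]
  simp only [Pi.smul_apply, smul_eq_mul, ket, Pi.single_apply, hk, mul_ite, mul_one, mul_zero]
  by_cases h : ∀ i, i ≠ t → y i = x i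
  · simp only [eq_true h, true_and, if_true, Finset.sum_ite_eq', Finset.mem_univ]
  · simp only [eq_false h, false_and, if_false, Finset.sum_const_zero]

theorem ctl_mul_ctl (t : W) (F G : (W → Bool) → Matrix Bool Bool ℂ)
    (hF : ∀ x b, F (Function.update x t b) = F x) :
    ctl t F * ctl t G = ctl t fun x => F x * G x := by
  refine matrix_ext_ket fun x => ?_
  rw [← Matrix.mulVec_mulVec, ctl_mulVec_ket, Matrix.mulVec_sum, ctl_mulVec_ket]
  simp only [Matrix.mulVec_smul, ctl_mulVec_ket, hF, Function.update_self, Function.update_idem]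
  simp only [Fintype.sum_bool, Matrix.mul_apply]
  module

/-- The block-diagonal two-qubit unitary that applies `U b` to the second qubit if the first one is
in the state `b`. -/
def controlledUnitary (U : Bool → unitaryGroup Bool ℂ) : unitaryGroup (Bool × Bool) ℂ :=
  ⟨of fun p q => if p.1 = q.1 then (U p.1 : Matrix Bool Bool ℂ) p.2 q.2 else 0, by
    refine mem_unitaryGroup_iff.2 ?_
    have h : ∀ b c d, ∑ e, (U b : Matrix Bool Bool ℂ) c e * star ((U b : Matrix Bool Bool ℂ) d e) =
        if c = d then 1 else 0 := by
      intro b c d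
      have := congrFun (congrFun (mem_unitaryGroup_iff.1 (U b).2) c) d
      rw [Matrix.one_apply, Matrix.mul_apply] at this
      rw [← this]
      rfl
    ext ⟨a, c⟩ ⟨b, d⟩
    rw [Matrix.mul_apply, Fintype.sum_prod_type]
    simp only [Matrix.star_apply, of_apply]
    by_cases hab : a = b
    · subst hab
      have h3 := h a c d
      simp only [Fintype.sum_bool] at h3 ⊢
      cases a <;> simpa [Matrix.one_apply] using h3
    · simp only [Fintype.sum_bool, Matrix.one_apply, Prod.mk.injEq, hab, false_and, if_false]
      cases a <;> cases b <;> simp_all⟩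

/-- The gate that applies `U b` to the qubit `t` if the qubit `a` is in the state `b`. -/
def controlledGate (a t : W) (h : a ≠ t) (U : Bool → unitaryGroup Bool ℂ) : TwoQubitGate W :=
  ⟨a, t, h, controlledUnitary U⟩

theorem controlledGate_toMatrix (a t : W) (h : a ≠ t) (U : Bool → unitaryGroup Bool ℂ) :
    (controlledGate a t h U).toMatrix = ctl t fun x => (U (x a) : Matrix Bool Bool ℂ) := by
  refine matrix_ext_ket fun x => ?_
  rw [TwoQubitGate.toMatrix_mulVec_ket, ctl_mulVec_ket, Fintype.sum_prod_type]
  have hu : ∀ b b', (controlledUnitary U : Matrix (Bool × Bool) (Bool × Bool) ℂ) (b, b')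
      (x a, x t) = if b = x a then (U (x a) : Matrix Bool Bool ℂ) b' (x t) else 0 := by
    intro b b'
    change (if b = x a then (U b : Matrix Bool Bool ℂ) b' (x t) else 0) = _
    split_ifs with h
    · rw [h]
    · rfl
  simp only [controlledGate, hu]
  rw [Finset.sum_eq_single (x a)]
  · simp [Function.update_eq_self]
  · intro b _ hb
    simp [hb]
  · simp

/-- A square root of the bit flip. -/
def sqrtNot : unitaryGroup Bool ℂ :=
  ⟨of fun b c => if b = c then (1 + Complex.I) / 2 else (1 - Complex.I) / 2, by
    refine mem_unitaryGroup_iff.2 ?_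
    ext b c
    rw [Matrix.mul_apply]
    simp only [Matrix.star_apply, Fintype.sum_bool]
    cases b <;> cases c <;> simp <;> ring_nf <;> simp <;> ring⟩

theorem sqrtNot_sq_apply (b c : Bool) :
    ((sqrtNot ^ 2 : unitaryGroup Bool ℂ) : Matrix Bool Bool ℂ) b c = if b = !c then 1 else 0 := by
  have : ((sqrtNot ^ 2 : unitaryGroup Bool ℂ) : Matrix Bool Bool ℂ) =
      (sqrtNot : Matrix Bool Bool ℂ) * (sqrtNot : Matrix Bool Bool ℂ) := by
    rw [pow_two]; rfl
  rw [this, Matrix.mul_apply]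
  simp only [Fintype.sum_bool, sqrtNot]
  cases b <;> cases c <;> simp <;> ring_nf <;> simp <;> ring

theorem sqrtNot_pow_four : sqrtNot ^ 4 = 1 := by
  apply Subtype.ext
  have : ((sqrtNot ^ 4 : unitaryGroup Bool ℂ) : Matrix Bool Bool ℂ) =
      ((sqrtNot ^ 2 : unitaryGroup Bool ℂ) : Matrix Bool Bool ℂ) *
        ((sqrtNot ^ 2 : unitaryGroup Bool ℂ) : Matrix Bool Bool ℂ) := by
    rw [show 4 = 2 + 2 from rfl, pow_add]; rfl
  rw [this]
  ext b c
  rw [Matrix.mul_apply]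
  simp only [Fintype.sum_bool, sqrtNot_sq_apply]
  cases b <;> cases c <;> simp

theorem sqrtNot_pow_congr {j k : ℕ} (h : j % 4 = k % 4) : sqrtNot ^ j = sqrtNot ^ k :=
  pow_eq_pow_of_modEq h sqrtNot_pow_four

theorem ctl_sqrtNot_mulVec_ket (t : W) (f : (W → Bool) → Bool) (x : W → Bool) :
    (ctl t fun x => ((sqrtNot ^ (2 * (f x).toNat) : unitaryGroup Bool ℂ) :
      Matrix Bool Bool ℂ)) *ᵥ ket x = ket (Function.update x t (x t ^^ f x)) := by
  rw [ctl_mulVec_ket]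
  cases f x
  · simp only [Bool.toNat_false, mul_zero, pow_zero, Bool.xor_false, Function.update_eq_self]
    cases h : x t <;> simp [Matrix.one_apply, ← h, Function.update_eq_self]
  · simp only [Bool.toNat_true, mul_one, sqrtNot_sq_apply, Bool.xor_true]
    cases x t <;> simp

/-- The Toffoli-like construction of a controlled gate from square roots: if `f` has the Reed-Muller
form `c₀ + c₁ p + c₂ q + c₃ p q` modulo two, then `2 p q = p + q - (p ^^ q)` expresses
twice the value of `f`, modulo four, by terms that depend on one bit each. -/
theorem exists_circuit_xor_of_ne {a b t : W} (hat : a ≠ t) (hbt : b ≠ t) (hab : a ≠ b)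
    (f : Bool → Bool → Bool) :
    ∃ c : QCircuit W, c.length ≤ 5 ∧ ∀ x,
      QCircuit.toMatrix c *ᵥ ket x = ket (Function.update x t (x t ^^ f (x a) (x b))) := by
  -- The Reed-Muller coefficients of `f`; the exponent `3 * c₃` stands for `-c₃` modulo four.
  set c₀ := (f false false).toNat
  set c₁ := (f true false ^^ f false false).toNat
  set c₂ := (f false true ^^ f false false).toNat
  set c₃ := (f true true ^^ f true false ^^ f false true ^^ f false false).toNat
  set P : Matrix (W → Bool) (W → Bool) ℂ := ctl b fun x =>
    ((sqrtNot ^ (2 * (x a).toNat) : unitaryGroup Bool ℂ) : Matrix Bool Bool ℂ) with hP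
  have hPket : ∀ x, P *ᵥ ket x = ket (Function.update x b (x b ^^ x a)) := fun x =>
    ctl_sqrtNot_mulVec_ket b (fun x => x a) x
  let cnot : TwoQubitGate W := controlledGate a b hab fun p => sqrtNot ^ (2 * p.toNat)
  refine ⟨[controlledGate b t hbt fun q => sqrtNot ^ (2 * c₂ * q.toNat + c₃ * q.toNat),
    cnot, controlledGate b t hbt fun q => sqrtNot ^ (3 * c₃ * q.toNat), cnot,
    controlledGate a t hat fun p => sqrtNot ^ (2 * c₀ + 2 * c₁ * p.toNat + c₃ * p.toNat)],
    by simp, fun x => ?_⟩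
  simp only [QCircuit.toMatrix_cons, QCircuit.toMatrix_nil, controlledGate_toMatrix, cnot, ← hP,
    Matrix.one_mul]
  -- Conjugation by the controlled bit flip replaces the control `b` by `a ^^ b`.
  have hconj : ∀ F : Bool → Matrix Bool Bool ℂ,
      P * ctl t (fun x => F (x b)) * P = ctl t fun x => F (x b ^^ x a) := by
    intro F
    refine matrix_ext_ket fun x => ?_
    rw [← Matrix.mulVec_mulVec, ← Matrix.mulVec_mulVec, hPket, ctl_mulVec_ket, Matrix.mulVec_sum,
      ctl_mulVec_ket]
    refine Finset.sum_congr rfl fun d _ => ?_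
    rw [Matrix.mulVec_smul, hPket, Function.update_self, Function.update_of_ne hbt.symm]
    congr 2
    ext i
    by_cases hib : i = b
    · subst hib
      rw [Function.update_self, Function.update_of_ne hbt, Function.update_self,
        Function.update_of_ne hat, Function.update_of_ne hab, Function.update_of_ne hbt]
      cases x i <;> cases x a <;> rfl
    · rw [Function.update_of_ne hib]
      by_cases hit : i = t
      · subst hit; rw [Function.update_self, Function.update_self]
      · rw [Function.update_of_ne hit, Function.update_of_ne hib, Function.update_of_ne hit]
  have hassoc : ∀ A B C D E : Matrix (W → Bool) (W → Bool) ℂ,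
      A * B * C * D * E = A * (B * C * D) * E := by
    intros; simp only [Matrix.mul_assoc]
  rw [hassoc, hconj fun q => ((sqrtNot ^ (3 * c₃ * q.toNat) : unitaryGroup Bool ℂ) :
      Matrix Bool Bool ℂ), ctl_mul_ctl, ctl_mul_ctl,
    ← ctl_sqrtNot_mulVec_ket t (fun x => f (x a) (x b)) x]
  · congr 2
    ext1 y
    rw [← Submonoid.coe_mul, ← Submonoid.coe_mul, ← pow_add, ← pow_add]
    congr 1
    apply sqrtNot_pow_congr
    simp only [c₀, c₁, c₂, c₃]
    cases y a <;> cases y b <;> cases f false false <;> cases f true false <;>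
      cases f false true <;> cases f true true <;> rfl
  · intro x d
    simp only [Function.update_of_ne hat, Function.update_of_ne hbt]
  · intro x d
    simp only [Function.update_of_ne hat]

theorem exists_circuit_xor {a b t : W} (hat : a ≠ t) (hbt : b ≠ t) (f : Bool → Bool → Bool) :
    ∃ c : QCircuit W, c.length ≤ 5 ∧ ∀ x,
      QCircuit.toMatrix c *ᵥ ket x = ket (Function.update x t (x t ^^ f (x a) (x b))) := by
  by_cases hab : a = b
  · subst hab
    refine ⟨[controlledGate a t hat fun p => sqrtNot ^ (2 * (f p p).toNat)], by simp, fun x => ?_⟩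
    rw [QCircuit.toMatrix_singleton, controlledGate_toMatrix]
    exact ctl_sqrtNot_mulVec_ket t (fun x => f (x a) (x a)) x
  · exact exists_circuit_xor_of_ne hat hbt hab f

end Gates
end

noncomputable section

open Matrix

/-! ### Operations implemented with clean ancilla qubits -/

section Clean

variable {W : Type} [Fintype W] [DecidableEq W]

/-- The state in which all qubits are `0`. -/
def zeros {ι : Type*} : ι → Bool := fun _ => false

theorem extend_inl {α β : Type*} (x : α → Bool) (y : α ⊕ β → Bool) :
    Function.extend (Function.Embedding.inl : α ↪ α ⊕ β) x y = Sum.elim x fun b => y (.inr b) := by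
  ext i
  rcases i with i | i
  · exact (Function.Embedding.inl : α ↪ α ⊕ β).injective.extend_apply x y i
  · exact Function.extend_apply' _ _ _ (by rintro ⟨a, h⟩; cases h)

theorem extend_extend_zeros {α β γ : Type*} (e : β ↪ γ) (e' : α ↪ β) (x : α → Bool) :
    Function.extend e (Function.extend e' x zeros) zeros =
      Function.extend (e'.trans e) x zeros := by
  ext i
  by_cases h : ∃ j, e j = i
  · obtain ⟨j, rfl⟩ := h
    rw [e.injective.extend_apply]
    by_cases h' : ∃ k, e' k = j
    · obtain ⟨k, rfl⟩ := h'
      rw [e'.injective.extend_apply]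
      exact ((e'.trans e).injective.extend_apply x zeros k).symm
    · rw [Function.extend_apply' _ _ _ h', Function.extend_apply' _ _ _]
      · rfl
      · rintro ⟨k, hk⟩
        exact h' ⟨k, e.injective hk⟩
  · rw [Function.extend_apply' _ _ _ h, Function.extend_apply' _ _ _]
    rintro ⟨k, hk⟩
    exact h ⟨e' k, hk⟩

theorem liftState_liftState_zeros {W₁ W₂ W₃ : Type*} [Fintype W₁] [DecidableEq W₁] [Fintype W₂]
    [DecidableEq W₂] [Fintype W₃] [DecidableEq W₃] (e : W₂ ↪ W₃) (e' : W₁ ↪ W₂)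
    (v : (W₁ → Bool) → ℂ) :
    liftState e zeros (liftState e' zeros v) = liftState (e'.trans e) zeros v := by
  conv_lhs => rw [liftState.eq_1 e', liftState_sum_smul]
  simp only [liftState_ket, extend_extend_zeros]
  rfl

/-- `B` can be applied with at most `k` two-qubit gates, using ancilla qubits that start in the
state `0` and are returned to it. -/
def CleanCost (B : Matrix (W → Bool) (W → Bool) ℂ) (k : ℕ) : Prop :=
  ∃ (K : Type) (_ : Fintype K) (_ : DecidableEq K) (c : QCircuit (W ⊕ K)), c.length ≤ k ∧
    ∀ v, QCircuit.toMatrix c *ᵥ liftState Function.Embedding.inl zeros v =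
      liftState Function.Embedding.inl zeros (B *ᵥ v)

theorem mulVec_liftState_of_ket {W' : Type*} [Fintype W'] [DecidableEq W'] {e : W ↪ W'}
    {y : W' → Bool} {M : Matrix (W' → Bool) (W' → Bool) ℂ} {B : Matrix (W → Bool) (W → Bool) ℂ}
    (h : ∀ x, M *ᵥ ket (Function.extend e x y) = liftState e y (B *ᵥ ket x))
    (v : (W → Bool) → ℂ) : M *ᵥ liftState e y v = liftState e y (B *ᵥ v) := by
  conv_rhs => rw [eq_sum_ket v]
  rw [liftState, Matrix.mulVec_sum, Matrix.mulVec_sum]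
  simp only [Matrix.mulVec_smul]
  rw [liftState_sum_smul]
  exact Finset.sum_congr rfl fun z _ => by rw [h]

theorem CleanCost.mono {B : Matrix (W → Bool) (W → Bool) ℂ} {k l : ℕ} (h : CleanCost B k)
    (hkl : k ≤ l) : CleanCost B l := by
  obtain ⟨K, _, _, c, hc, h⟩ := h
  exact ⟨K, _, _, c, hc.trans hkl, h⟩

/-- The two operations are given separate ancilla qubits. -/
theorem CleanCost.mul {B B' : Matrix (W → Bool) (W → Bool) ℂ} {k k' : ℕ} (h' : CleanCost B' k')
    (h : CleanCost B k) : CleanCost (B' * B) (k + k') := by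
  obtain ⟨K, _, _, c, hc, h⟩ := h
  obtain ⟨K', _, _, c', hc', h'⟩ := h'
  let e : W ⊕ K ↪ W ⊕ (K ⊕ K') := (Function.Embedding.refl W).sumMap Function.Embedding.inl
  let e' : W ⊕ K' ↪ W ⊕ (K ⊕ K') := (Function.Embedding.refl W).sumMap Function.Embedding.inr
  refine ⟨K ⊕ K', inferInstance, inferInstance,
    QCircuit.relabel e c ++ QCircuit.relabel e' c', ?_, fun v => ?_⟩
  · rw [List.length_append, QCircuit.length_relabel, QCircuit.length_relabel]; omega
  · have h1 : ∀ v : (W → Bool) → ℂ, liftState (Function.Embedding.inl : W ↪ W ⊕ (K ⊕ K')) zeros v =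
        liftState e zeros (liftState Function.Embedding.inl zeros v) :=
      fun v => (liftState_liftState_zeros e Function.Embedding.inl v).symm
    have h2 : ∀ v : (W → Bool) → ℂ, liftState (Function.Embedding.inl : W ↪ W ⊕ (K ⊕ K')) zeros v =
        liftState e' zeros (liftState Function.Embedding.inl zeros v) :=
      fun v => (liftState_liftState_zeros e' Function.Embedding.inl v).symm
    rw [QCircuit.toMatrix_append_mulVec, h1, QCircuit.relabel_mulVec_liftState, h, ← h1, h2,
      QCircuit.relabel_mulVec_liftState, h', ← h2, Matrix.mulVec_mulVec]

/-- Part of the register may be used as clean ancilla. -/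
theorem CleanCost.of_sum {Y : Type} [Fintype Y] [DecidableEq Y]
    {B' : Matrix (W ⊕ Y → Bool) (W ⊕ Y → Bool) ℂ} {B : Matrix (W → Bool) (W → Bool) ℂ} {k : ℕ}
    (h : CleanCost B' k)
    (hB : ∀ x, B' *ᵥ ket (Sum.elim x zeros) =
      liftState Function.Embedding.inl zeros (B *ᵥ ket x)) : CleanCost B k := by
  obtain ⟨K, _, _, c, hc, h⟩ := h
  let e : (W ⊕ Y) ⊕ K ↪ W ⊕ (Y ⊕ K) := (Equiv.sumAssoc W Y K).toEmbedding
  refine ⟨Y ⊕ K, inferInstance, inferInstance, QCircuit.relabel e c, ?_, fun v => ?_⟩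
  · rw [QCircuit.length_relabel]; exact hc
  · have h1 : ∀ v : (W → Bool) → ℂ, liftState (Function.Embedding.inl : W ↪ W ⊕ (Y ⊕ K)) zeros v =
        liftState e zeros (liftState Function.Embedding.inl zeros
          (liftState Function.Embedding.inl zeros v)) := by
      intro v
      rw [liftState_liftState_zeros, liftState_liftState_zeros]
      rfl
    have h2 := mulVec_liftState_of_ket (e := (Function.Embedding.inl : W ↪ W ⊕ Y)) (y := zeros)
      (M := B') (B := B) (fun x => by
        rw [← hB x]; congr 2; exact extend_inl x zeros) v
    rw [h1, QCircuit.relabel_mulVec_liftState, h, h2, ← h1]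

/-- The matrix of a map of the basis states. -/
def mapMatrix (π : (W → Bool) → W → Bool) : Matrix (W → Bool) (W → Bool) ℂ :=
  fun y x => if y = π x then 1 else 0

theorem mapMatrix_mulVec_ket (π : (W → Bool) → W → Bool) (x : W → Bool) :
    mapMatrix π *ᵥ ket x = ket (π x) := by
  ext y
  rw [mulVec_ket, mapMatrix, ket, Pi.single_apply]

/-! ### Straight-line programs -/

/-- `Program F F' k`: from the Boolean functions in `F` a straight-line program with `k` binary
gates computes the functions that `F'` has in addition. -/
inductive Program {X : Type*} (F : Set (X → Bool)) : Set (X → Bool) → ℕ → Prop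
  | refl : Program F F 0
  | gate {F' : Set (X → Bool)} {k : ℕ} (f : Bool → Bool → Bool) {u v : X → Bool} :
      Program F F' k → u ∈ F' → v ∈ F' → Program F (insert (fun x => f (u x) (v x)) F') (k + 1)

theorem Program.subset {X : Type*} {F F' : Set (X → Bool)} {k : ℕ} (h : Program F F' k) :
    F ⊆ F' := by
  induction h with
  | refl => exact subset_rfl
  | gate f _ _ _ ih => exact ih.trans (Set.subset_insert _ _)

theorem Program.trans {X : Type*} {F F' F'' : Set (X → Bool)} {k l : ℕ} (h : Program F F' k)
    (h' : Program F' F'' l) : Program F F'' (k + l) := by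
  induction h' with
  | refl => exact h
  | gate f _ hu hv ih => exact ih.gate f hu hv

/-- The functions that read a qubit of `S`. -/
def inputs (S : Set W) : Set ((W → Bool) → Bool) := {h | ∃ i ∈ S, h = fun x => x i}

theorem extend_option {K : Type} (x : W → Bool) (g : K → Bool) (b : Bool) :
    Function.extend ((Function.Embedding.refl W).sumMap (Function.Embedding.some : K ↪ Option K))
      (Sum.elim x g) (fun _ => b) = Sum.elim x fun o => o.elim b g := by
  set e := (Function.Embedding.refl W).sumMap (Function.Embedding.some : K ↪ Option K)
  ext i
  rcases i with i | _ | i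
  · exact e.injective.extend_apply (Sum.elim x g) _ (.inl i)
  · exact Function.extend_apply' _ _ _ (by rintro ⟨_ | _, h⟩ <;> cases h)
  · exact e.injective.extend_apply (Sum.elim x g) _ (.inr i)

theorem update_elim_none {K : Type} [DecidableEq K] (x : W → Bool) (g : K → Bool) (b b' : Bool) :
    Function.update (Sum.elim x fun o : Option K => o.elim b g) (.inr none) b' =
      Sum.elim x fun o : Option K => o.elim b' g := by
  ext i
  rcases i with i | _ | i <;> simp

/-- A straight-line program is executed with one ancilla and five two-qubit gates for each of its
gates, and is undone at the same cost. -/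
theorem Program.exists_circuit {S : Set W} {F : Set ((W → Bool) → Bool)} {k : ℕ}
    (h : Program (inputs S) F k) :
    ∃ (K : Type) (_ : Fintype K) (_ : DecidableEq K) (c c' : QCircuit (W ⊕ K))
      (G : (W → Bool) → K → Bool), c.length ≤ 5 * k ∧ c'.length ≤ 5 * k ∧
      (∀ x, QCircuit.toMatrix c *ᵥ ket (Sum.elim x zeros) = ket (Sum.elim x (G x))) ∧
      (∀ x, QCircuit.toMatrix c' *ᵥ ket (Sum.elim x (G x)) = ket (Sum.elim x zeros)) ∧
      (∀ x x', (∀ i ∈ S, x i = x' i) → G x = G x') ∧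
      ∀ h ∈ F, ∃ w : W ⊕ K, (∀ i, w = .inl i → i ∈ S) ∧ ∀ x, h x = Sum.elim x (G x) w := by
  induction h with
  | refl =>
    refine ⟨Empty, inferInstance, inferInstance, [], [], fun _ => zeros, by simp, by simp, ?_, ?_,
      fun _ _ _ => rfl, ?_⟩
    · intro x; rw [QCircuit.toMatrix_nil, Matrix.one_mulVec]
    · intro x; rw [QCircuit.toMatrix_nil, Matrix.one_mulVec]
    · rintro h ⟨i, hi, rfl⟩
      exact ⟨.inl i, fun j hj => by cases hj; exact hi, fun x => rfl⟩
  | @gate F' k f u v _ hu hv ih =>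
    obtain ⟨K, _, _, c, c', G, hc, hc', h1, h2, h3, h4⟩ := ih
    obtain ⟨a, ha, hua⟩ := h4 u hu
    obtain ⟨b, hb, hvb⟩ := h4 v hv
    let e : W ⊕ K ↪ W ⊕ Option K := (Function.Embedding.refl W).sumMap Function.Embedding.some
    have hne : ∀ a, e a ≠ .inr none := by rintro (a | a) h <;> cases h
    obtain ⟨d, hd, hdk⟩ := exists_circuit_xor (hne a) (hne b) f
    have hrel : ∀ (c : QCircuit (W ⊕ K)) (x : W → Bool) (g g' : K → Bool) (p : Bool),
        QCircuit.toMatrix c *ᵥ ket (Sum.elim x g) = ket (Sum.elim x g') →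
        QCircuit.toMatrix (QCircuit.relabel e c) *ᵥ ket (Sum.elim x fun o => o.elim p g) =
          ket (Sum.elim x fun o => o.elim p g') := by
      intro c x g g' p h
      have := QCircuit.relabel_mulVec_liftState e (fun _ => p) c (ket (Sum.elim x g))
      rw [h, liftState_ket, liftState_ket] at this
      rwa [extend_option, extend_option] at this
    have hdk' : ∀ x p, QCircuit.toMatrix d *ᵥ ket (Sum.elim x fun o => o.elim p (G x)) =
        ket (Sum.elim x fun o => o.elim (p ^^ f (u x) (v x)) (G x)) := by
      intro x p
      have hval : ∀ a, Sum.elim x (fun o : Option K => o.elim p (G x)) (e a) =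
          Sum.elim x (G x) a := by rintro (a | a) <;> rfl
      rw [hdk, hval, hval, ← hua, ← hvb, update_elim_none]
      rfl
    have hz : (fun o : Option K => o.elim false zeros) = (zeros : Option K → Bool) := by
      ext o; cases o <;> rfl
    refine ⟨Option K, inferInstance, inferInstance, QCircuit.relabel e c ++ d,
      d ++ QCircuit.relabel e c', fun x o => o.elim (f (u x) (v x)) (G x), ?_, ?_, ?_, ?_, ?_, ?_⟩
    · rw [List.length_append, QCircuit.length_relabel]; omega
    · rw [List.length_append, QCircuit.length_relabel]; omega
    · intro x
      rw [QCircuit.toMatrix_append_mulVec, ← hz, hrel c x _ _ false (h1 x), hdk', Bool.false_xor]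
    · intro x
      rw [QCircuit.toMatrix_append_mulVec, hdk', Bool.xor_self, hrel c' x _ _ false (h2 x), hz]
    · intro x x' hx
      have hel : ∀ w : W ⊕ K, (∀ i, w = .inl i → i ∈ S) →
          Sum.elim x (G x) w = Sum.elim x' (G x') w := by
        rintro (i | i) hi
        · exact hx i (hi i rfl)
        · exact congrFun (h3 x x' hx) i
      have hux : u x = u x' := by rw [hua, hua, hel a ha]
      have hvx : v x = v x' := by rw [hvb, hvb, hel b hb]
      simp only [hux, hvx, h3 x x' hx]
    · intro h hh
      rcases hh with rfl | hh
      · exact ⟨.inr none, ⟨fun i hi => (by cases hi), fun x => rfl⟩⟩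
      · obtain ⟨w, hw, hhw⟩ := h4 h hh
        refine ⟨e w, fun i hi => ?_, fun x => ?_⟩
        · rcases w with j | j
          · cases hi; exact hw _ rfl
          · cases hi
        · rw [hhw]
          rcases w with j | j <;> rfl

/-! ### Rotations by computed angles -/

/-- The rotation of a qubit by the angle `θ`. -/
def qubitRotation (θ : ℝ) : unitaryGroup Bool ℂ :=
  ⟨of fun b c => ((if b = c then Real.cos θ else if b then Real.sin θ else -Real.sin θ : ℝ) : ℂ), by
    refine mem_unitaryGroup_iff.2 ?_
    have h : (Complex.cos θ) ^ 2 + Complex.sin θ ^ 2 = 1 := Complex.cos_sq_add_sin_sq _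
    ext b c
    rw [Matrix.mul_apply]
    simp only [Matrix.star_apply, Fintype.sum_bool, of_apply, Complex.star_def, Complex.conj_ofReal]
    cases b <;> cases c <;> simp <;> first | linear_combination h | ring⟩

theorem qubitRotation_apply (θ : ℝ) (b c : Bool) : (qubitRotation θ : Matrix Bool Bool ℂ) b c =
    ((if b = c then Real.cos θ else if b then Real.sin θ else -Real.sin θ : ℝ) : ℂ) := rfl

theorem qubitRotation_add (θ φ : ℝ) : (qubitRotation (θ + φ) : Matrix Bool Bool ℂ) =
    (qubitRotation θ : Matrix Bool Bool ℂ) * (qubitRotation φ : Matrix Bool Bool ℂ) := by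
  ext b c
  rw [Matrix.mul_apply]
  simp only [Fintype.sum_bool, qubitRotation_apply, Real.cos_add, Real.sin_add]
  cases b <;> cases c <;> simp <;> ring

theorem qubitRotation_zero : (qubitRotation 0 : Matrix Bool Bool ℂ) = 1 := by
  ext b c
  rw [qubitRotation_apply]
  cases b <;> cases c <;> simp

/-- The sum of the weights of the functions in the list that are true at `x`. -/
def weightedSum {X : Type*} (ps : List ((X → Bool) × ℝ)) (x : X) : ℝ :=
  (ps.map fun p => if p.1 x then p.2 else 0).sum

theorem weightedSum_cons {X : Type*} (p : (X → Bool) × ℝ) (ps : List ((X → Bool) × ℝ)) (x : X) :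
    weightedSum (p :: ps) x = (if p.1 x then p.2 else 0) + weightedSum ps x := by
  simp [weightedSum]

/-- Controlled rotations by the weights of the qubits compose to a rotation by their weighted
sum. -/
theorem exists_circuit_rotation {t : W} (ws : List (W × ℝ)) (hws : ∀ p ∈ ws, p.1 ≠ t) :
    ∃ c : QCircuit W, c.length = ws.length ∧ QCircuit.toMatrix c =
      ctl t fun x => (qubitRotation (weightedSum (ws.map fun p => (fun x => x p.1, p.2)) x) :
        Matrix Bool Bool ℂ) := by
  induction ws with
  | nil =>
    refine ⟨[], rfl, matrix_ext_ket fun x => ?_⟩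
    rw [QCircuit.toMatrix_nil, Matrix.one_mulVec, ctl_mulVec_ket]
    simp only [weightedSum, List.map_nil, List.sum_nil, qubitRotation_zero, Fintype.sum_bool]
    cases h : x t <;> simp [← h, Function.update_eq_self]
  | cons p ws ih =>
    obtain ⟨c, hc, hcm⟩ := ih fun q hq => hws q (List.mem_cons_of_mem _ hq)
    have hp := hws p List.mem_cons_self
    refine ⟨c ++ [controlledGate p.1 t hp fun b => qubitRotation (if b then p.2 else 0)],
      by simp [hc], ?_⟩
    rw [QCircuit.toMatrix_append, QCircuit.toMatrix_singleton, controlledGate_toMatrix, hcm,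
      ctl_mul_ctl]
    · simp only [List.map_cons, weightedSum_cons, qubitRotation_add]
    · intro x b
      rw [Function.update_of_ne hp]

/-- Rotation of the qubit `t` by an angle that is a weighted sum of functions computed by a
program which does not read `t`. -/
theorem cleanCost_rotation {S : Set W} {F : Set ((W → Bool) → Bool)} {k : ℕ}
    (h : Program (inputs S) F k) {t : W} (ht : t ∉ S) (ps : List (((W → Bool) → Bool) × ℝ))
    (hps : ∀ p ∈ ps, p.1 ∈ F) :
    CleanCost (ctl t fun x => (qubitRotation (weightedSum ps x) : Matrix Bool Bool ℂ))
      (10 * k + ps.length) := by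
  obtain ⟨K, _, _, c, c', G, hc, hc', h1, h2, h3, h4⟩ := h.exists_circuit
  have hws : ∃ ws : List ((W ⊕ K) × ℝ), ws.length = ps.length ∧ (∀ p ∈ ws, p.1 ≠ .inl t) ∧
      ∀ x, weightedSum (ws.map fun p => (fun x => x p.1, p.2)) (Sum.elim x (G x)) =
        weightedSum ps x := by
    clear h
    induction ps with
    | nil => exact ⟨[], rfl, by simp, fun x => by simp [weightedSum]⟩
    | cons p ps ih =>
      obtain ⟨ws, hl, hne, hs⟩ := ih fun q hq => hps q (List.mem_cons_of_mem _ hq)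
      obtain ⟨w, hw, hpw⟩ := h4 p.1 (hps p List.mem_cons_self)
      refine ⟨(w, p.2) :: ws, by simp [hl], ?_, fun x => ?_⟩
      · intro q hq
        rcases List.mem_cons.1 hq with rfl | hq
        · intro hwt
          exact ht (hw t hwt)
        · exact hne q hq
      · rw [List.map_cons, weightedSum_cons, weightedSum_cons, hs, hpw]
  obtain ⟨ws, hl, hne, hs⟩ := hws
  obtain ⟨d, hd, hdm⟩ := exists_circuit_rotation ws hne
  refine ⟨K, _, _, c ++ d ++ c', ?_, mulVec_liftState_of_ket fun x => ?_⟩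
  · rw [List.length_append, List.length_append]; omega
  · rw [extend_inl]
    change _ *ᵥ ket (Sum.elim x zeros) = _
    rw [QCircuit.toMatrix_append_mulVec, QCircuit.toMatrix_append_mulVec, h1, hdm, ctl_mulVec_ket,
      Matrix.mulVec_sum, ctl_mulVec_ket, liftState_sum_smul]
    refine Finset.sum_congr rfl fun b _ => ?_
    rw [Matrix.mulVec_smul, hs, liftState_ket, extend_inl]
    have hG : G (Function.update x t b) = G x := h3 _ _ fun i hi =>
      Function.update_of_ne (fun h => ht (by rwa [← h])) _ _
    rw [Sum.update_elim_inl, ← hG, h2]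
    rfl

/-- Addition modulo two, to the qubits in `T`, of functions computed by a program which does not
read these qubits. -/
theorem cleanCost_xor {S : Set W} {F : Set ((W → Bool) → Bool)} {k : ℕ}
    (h : Program (inputs S) F k) (T : List W) (hT : T.Nodup) (hTS : ∀ t ∈ T, t ∉ S)
    (H : W → (W → Bool) → Bool) (hH : ∀ t ∈ T, H t ∈ F) :
    CleanCost (mapMatrix fun x w => if w ∈ T then x w ^^ H w x else x w)
      (10 * k + T.length) := by
  obtain ⟨K, _, _, c, c', G, hc, hc', h1, h2, h3, h4⟩ := h.exists_circuit
  have hd : ∃ d : QCircuit (W ⊕ K), d.length = T.length ∧ ∀ x y : W → Bool,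
      (∀ i ∈ S, y i = x i) → QCircuit.toMatrix d *ᵥ ket (Sum.elim y (G x)) =
        ket (Sum.elim (fun w => if w ∈ T then y w ^^ H w x else y w) (G x)) := by
    clear h
    induction T with
    | nil => exact ⟨[], rfl, fun x y _ => by simp [QCircuit.toMatrix_nil]⟩
    | cons t T ih =>
      obtain ⟨d, hd, hdk⟩ := ih (List.nodup_cons.1 hT).2
        (fun s hs => hTS s (List.mem_cons_of_mem _ hs))
        (fun s hs => hH s (List.mem_cons_of_mem _ hs))
      obtain ⟨w, hw, hpw⟩ := h4 (H t) (hH t List.mem_cons_self)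
      have htS := hTS t List.mem_cons_self
      have hwt : w ≠ .inl t := fun hwt => htS (hw t hwt)
      refine ⟨controlledGate w (.inl t) hwt (fun p => sqrtNot ^ (2 * p.toNat)) :: d,
        by simp [hd], fun x y hxy => ?_⟩
      have hyw : Sum.elim y (G x) w = H t x := by
        rw [hpw]
        rcases w with i | i
        · exact hxy i (hw i rfl)
        · rfl
      rw [QCircuit.toMatrix_cons, ← Matrix.mulVec_mulVec, controlledGate_toMatrix,
        ctl_sqrtNot_mulVec_ket (.inl t) (fun x => x w), hyw, Sum.elim_inl, Sum.update_elim_inl,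
        hdk]
      · congr 2
        ext s
        by_cases hst : s = t
        · subst hst
          rw [if_neg (List.nodup_cons.1 hT).1, Function.update_self, if_pos List.mem_cons_self]
        · rw [Function.update_of_ne hst]
          simp [hst]
      · intro i hi
        rw [Function.update_of_ne (fun h => htS (by rwa [← h])), hxy i hi]
  obtain ⟨d, hdl, hdk⟩ := hd
  refine ⟨K, _, _, c ++ d ++ c', ?_, mulVec_liftState_of_ket fun x => ?_⟩
  · rw [List.length_append, List.length_append]; omega
  · rw [extend_inl]
    change _ *ᵥ ket (Sum.elim x zeros) = _
    rw [QCircuit.toMatrix_append_mulVec, QCircuit.toMatrix_append_mulVec, h1,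
      hdk x x fun _ _ => rfl, mapMatrix_mulVec_ket, liftState_ket, extend_inl]
    have hG : G (fun w => if w ∈ T then x w ^^ H w x else x w) = G x := h3 _ _ fun i hi => by
      rw [if_neg fun h => hTS i h hi]
    rw [← hG, h2]
    rfl

end Clean
end

noncomputable section

/-! ### Binary arithmetic by straight-line programs -/

section Arithmetic

variable {X : Type*} {F : Set (X → Bool)}

/-- The `w` lowest binary digits of `A` are among the functions in `F`. -/
def HasBits (F : Set (X → Bool)) (w : ℕ) (A : X → ℕ) : Prop :=
  ∀ i < w, (fun x => (A x).testBit i) ∈ F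

theorem HasBits.mono {F' : Set (X → Bool)} {w : ℕ} {A : X → ℕ} (h : HasBits F w A)
    (hF : F ⊆ F') : HasBits F' w A := fun i hi => hF (h i hi)

theorem hasBits_const (ht : (fun _ => true) ∈ F) (hf : (fun _ => false) ∈ F) (w d : ℕ) :
    HasBits F w fun _ => d := by
  intro i _
  cases h : d.testBit i
  · simpa [h] using hf
  · simpa [h] using ht

theorem Program.exists_gate {F' : Set (X → Bool)} {k : ℕ} (h : Program F F' k)
    (f : Bool → Bool → Bool) {u v : X → Bool} (hu : u ∈ F') (hv : v ∈ F') :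
    ∃ F'', Program F F'' (k + 1) ∧ F' ⊆ F'' ∧ (fun x => f (u x) (v x)) ∈ F'' :=
  ⟨_, h.gate f hu hv, Set.subset_insert _ _, Set.mem_insert _ _⟩

/-- A program that applies the same binary gate to `w` pairs of functions. -/
theorem Program.exists_map (f : Bool → Bool → Bool) (u v : ℕ → X → Bool) (w : ℕ)
    (hu : ∀ i < w, u i ∈ F) (hv : ∀ i < w, v i ∈ F) :
    ∃ F', Program F F' w ∧ ∀ i < w, (fun x => f (u i x) (v i x)) ∈ F' := by
  induction w with
  | zero => exact ⟨F, .refl, by simp⟩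
  | succ w ih =>
    obtain ⟨F', h, hF'⟩ := ih (fun i hi => hu i (by omega)) fun i hi => hv i (by omega)
    obtain ⟨F'', h', hsub, hm⟩ := h.exists_gate f (h.subset (hu w (by omega)))
      (h.subset (hv w (by omega)))
    refine ⟨F'', h', fun i hi => ?_⟩
    rcases Nat.lt_succ_iff_lt_or_eq.1 hi with hi | rfl
    · exact hsub (hF' i hi)
    · exact hm

theorem Program.exists_const (hF : F.Nonempty) :
    ∃ F', Program F F' 2 ∧ (fun _ => true) ∈ F' ∧ (fun _ => false) ∈ F' := by
  obtain ⟨u, hu⟩ := hF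
  obtain ⟨F₁, h₁, hs₁, hm₁⟩ := (Program.refl (F := F)).exists_gate (fun _ _ => true) hu hu
  obtain ⟨F₂, h₂, hs₂, hm₂⟩ := h₁.exists_gate (fun _ _ => false) hm₁ hm₁
  exact ⟨F₂, h₂, hs₂ hm₁, hm₂⟩

/-- The carry into the digit `i` in the addition of `a`, `b` and the bit `c`. -/
def carryBit (a b : ℕ) (c : Bool) (i : ℕ) : Bool := decide (2 ^ i ≤ a % 2 ^ i + b % 2 ^ i + c.toNat)

theorem mod_two_pow_succ_eq (a i : ℕ) :
    a % 2 ^ (i + 1) = a % 2 ^ i + 2 ^ i * (a.testBit i).toNat := by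
  rw [Nat.mod_pow_succ, Nat.toNat_testBit]

theorem carryBit_succ (a b : ℕ) (c : Bool) (i : ℕ) : carryBit a b c (i + 1) =
    ((a.testBit i && b.testBit i) || (carryBit a b c i && (a.testBit i ^^ b.testBit i))) := by
  have h1 : a % 2 ^ i < 2 ^ i := Nat.mod_lt _ (by positivity)
  have h2 : b % 2 ^ i < 2 ^ i := Nat.mod_lt _ (by positivity)
  have h3 : c.toNat ≤ 1 := Bool.toNat_le c
  unfold carryBit
  rw [mod_two_pow_succ_eq, mod_two_pow_succ_eq, pow_succ]
  generalize a % 2 ^ i = x at *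
  generalize b % 2 ^ i = y at *
  generalize 2 ^ i = p at *
  generalize c.toNat = c at *
  cases a.testBit i <;> cases b.testBit i <;> simp <;> omega

theorem testBit_add_add_toNat (a b : ℕ) (c : Bool) (i : ℕ) : (a + b + c.toNat).testBit i =
    ((a.testBit i ^^ b.testBit i) ^^ carryBit a b c i) := by
  have h1 : a % 2 ^ i < 2 ^ i := Nat.mod_lt _ (by positivity)
  have h2 : b % 2 ^ i < 2 ^ i := Nat.mod_lt _ (by positivity)
  have h3 : c.toNat ≤ 1 := Bool.toNat_le c
  have ha := Nat.mod_add_div a (2 ^ i)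
  have hb := Nat.mod_add_div b (2 ^ i)
  have hp : 0 < 2 ^ i := by positivity
  rw [Nat.testBit_eq_decide_div_mod_eq, Nat.testBit_eq_decide_div_mod_eq,
    Nat.testBit_eq_decide_div_mod_eq]
  unfold carryBit
  have hs : (a + b + c.toNat) / 2 ^ i =
      (a % 2 ^ i + b % 2 ^ i + c.toNat) / 2 ^ i + (a / 2 ^ i + b / 2 ^ i) := by
    rw [← Nat.add_mul_div_left _ _ hp]
    congr 1
    rw [Nat.mul_add]
    omega
  rw [hs]
  by_cases h : 2 ^ i ≤ a % 2 ^ i + b % 2 ^ i + c.toNat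
  · have : (a % 2 ^ i + b % 2 ^ i + c.toNat) / 2 ^ i = 1 := by
      apply Nat.div_eq_of_lt_le <;> omega
    rw [this]
    rcases Nat.mod_two_eq_zero_or_one (a / 2 ^ i) with h5 | h5 <;>
      rcases Nat.mod_two_eq_zero_or_one (b / 2 ^ i) with h6 | h6 <;>
      simp [h, h5, h6] <;> omega
  · have : (a % 2 ^ i + b % 2 ^ i + c.toNat) / 2 ^ i = 0 := Nat.div_eq_of_lt (by omega)
    rw [this]
    rcases Nat.mod_two_eq_zero_or_one (a / 2 ^ i) with h5 | h5 <;>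
      rcases Nat.mod_two_eq_zero_or_one (b / 2 ^ i) with h6 | h6 <;>
      simp [h, h5, h6] <;> omega

/-- The ripple-carry adder. -/
theorem Program.exists_add {w : ℕ} {A B : X → ℕ} {c : X → Bool} (hA : HasBits F w A)
    (hB : HasBits F w B) (hc : c ∈ F) :
    ∃ F', Program F F' (5 * w) ∧ HasBits F' w (fun x => A x + B x + (c x).toNat) ∧
      (fun x => carryBit (A x) (B x) (c x) w) ∈ F' := by
  induction w with
  | zero =>
    refine ⟨F, .refl, fun i hi => absurd hi (by omega), ?_⟩
    convert hc using 2 with x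
    unfold carryBit
    cases c x <;> simp [Nat.mod_one]
  | succ w ih =>
    obtain ⟨F₀, h₀, hs, hcar⟩ := ih (fun i hi => hA i (by omega)) fun i hi => hB i (by omega)
    have ha := h₀.subset (hA w (by omega))
    have hb := h₀.subset (hB w (by omega))
    obtain ⟨F₁, h₁, s₁, m₁⟩ := h₀.exists_gate (fun a b => a ^^ b) ha hb
    obtain ⟨F₂, h₂, s₂, m₂⟩ := h₁.exists_gate (fun a b => a ^^ b) m₁ (s₁ hcar)
    obtain ⟨F₃, h₃, s₃, m₃⟩ := h₂.exists_gate (fun a b => a && b) (s₂ (s₁ hcar)) (s₂ m₁)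
    obtain ⟨F₄, h₄, s₄, m₄⟩ := h₃.exists_gate (fun a b => a && b) (s₃ (s₂ (s₁ ha)))
      (s₃ (s₂ (s₁ hb)))
    obtain ⟨F₅, h₅, s₅, m₅⟩ := h₄.exists_gate (fun a b => a || b) m₄ (s₄ m₃)
    refine ⟨F₅, h₅, fun i hi => ?_, ?_⟩
    · rcases Nat.lt_succ_iff_lt_or_eq.1 hi with hi | rfl
      · exact s₅ (s₄ (s₃ (s₂ (s₁ (hs i hi)))))
      · simp only [testBit_add_add_toNat]
        exact s₅ (s₄ (s₃ m₂))
    · simp only [carryBit_succ]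
      exact m₅

/-- Subtraction by addition of the complement of `V` and a carry. The carry out of the highest digit
tells whether `V ≤ U`, and the digits are those of `U - V` modulo `2 ^ w`. -/
theorem Program.exists_sub {w : ℕ} {U V : X → ℕ} (ht : (fun _ => true) ∈ F)
    (hU : HasBits F w U) (hV : HasBits F w V) (hUw : ∀ x, U x < 2 ^ w) (hVw : ∀ x, V x < 2 ^ w) :
    ∃ F', Program F F' (6 * w) ∧ (fun x => decide (V x ≤ U x)) ∈ F' ∧
      HasBits F' w fun x => U x + 2 ^ w - V x := by
  obtain ⟨F₁, h₁, m₁⟩ := Program.exists_map (fun a _ => !a) (fun i x => (V x).testBit i)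
    (fun i x => (V x).testBit i) w hV hV
  have hN : HasBits F₁ w fun x => 2 ^ w - (V x + 1) := by
    intro i hi
    convert m₁ i hi using 2 with x
    rw [Nat.testBit_two_pow_sub_succ (hVw x)]
    simp [hi]
  obtain ⟨F₂, h₂, hs, hcar⟩ := Program.exists_add (hU.mono h₁.subset) hN (h₁.subset ht)
  refine ⟨F₂, ?_, ?_, ?_⟩
  · have := h₁.trans h₂
    rwa [show w + 5 * w = 6 * w by ring] at this
  · convert hcar using 2 with x
    have h1 := hUw x
    have h2 := hVw x
    unfold carryBit
    rw [Nat.mod_eq_of_lt h1, Nat.mod_eq_of_lt (by omega)]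
    simp only [Bool.toNat_true, decide_eq_decide]
    omega
  · intro i hi
    convert hs i hi using 3 with x
    have h2 := hVw x
    simp only [Bool.toNat_true]
    omega

/-- The next binary digit of a square root, decided by comparing the scaled remainder with
`4 √Q + 1`. -/
theorem sqrt_four_mul_add {Q r : ℕ} (hr : r < 4) :
    Nat.sqrt (4 * Q + r) = 2 * Nat.sqrt Q +
      (decide (4 * Nat.sqrt Q + 1 ≤ 4 * (Q - Nat.sqrt Q * Nat.sqrt Q) + r)).toNat := by
  have h1 := Nat.sqrt_le Q
  have h2 := Nat.lt_succ_sqrt Q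
  rw [eq_comm, Nat.eq_sqrt]
  generalize Nat.sqrt Q = s at *
  have h3 : (s + 1) * (s + 1) = s * s + 2 * s + 1 := by ring
  rw [Nat.succ_eq_add_one, h3] at h2
  obtain ⟨R, rfl⟩ := Nat.exists_eq_add_of_le h1
  rw [Nat.add_sub_cancel_left]
  by_cases h : 4 * s + 1 ≤ 4 * R + r
  · simp only [h, decide_true, Bool.toNat_true]
    constructor <;> ring_nf <;> ring_nf at h h2 <;> omega
  · simp only [h, decide_false, Bool.toNat_false]
    constructor <;> ring_nf <;> ring_nf at h h2 <;> omega

theorem hasBits_ite_const {g : X → Bool} (hg : g ∈ F) (hf : (fun _ => false) ∈ F) (w d : ℕ) :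
    HasBits F w fun x => if g x then d else 0 := by
  intro i _
  cases h : d.testBit i
  · convert hf using 2 with x
    cases hx : g x <;> simp [hx, h]
  · convert hg using 2 with x
    cases hx : g x <;> simp [hx, h]

theorem HasBits.two_pow_mul_add {a w : ℕ} {A r : X → ℕ} (hA : HasBits F w A) (hr : HasBits F a r)
    (hra : ∀ x, r x < 2 ^ a) : HasBits F (w + a) fun x => 2 ^ a * A x + r x := by
  intro i hi
  by_cases h : i < a
  · convert hr i h using 2 with x
    rw [Nat.testBit_two_pow_mul_add _ (hra x), if_pos h]
  · convert hA (i - a) (by omega) using 2 with x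
    rw [Nat.testBit_two_pow_mul_add _ (hra x), if_neg h]

theorem HasBits.le {w w' : ℕ} {A : X → ℕ} (hA : HasBits F w A) (h : w' ≤ w) : HasBits F w' A :=
  fun i hi => hA i (by omega)

theorem HasBits.congr {w : ℕ} {A B : X → ℕ} (hA : HasBits F w A) (h : ∀ x, A x = B x) :
    HasBits F w B := by
  rwa [show B = A from funext fun x => (h x).symm]

/-- One step of the digit-by-digit extraction of a square root. -/
theorem Program.exists_sqrt_step {b : ℕ} {y R r : X → ℕ} (ht : (fun _ => true) ∈ F)
    (hf : (fun _ => false) ∈ F) (hy : HasBits F (b + 4) y) (hR : HasBits F (b + 4) R)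
    (hr : HasBits F 2 r) (hyb : ∀ x, y x < 2 ^ b) (hRy : ∀ x, R x ≤ 2 * y x) (hr4 : ∀ x, r x < 4) :
    ∃ F', Program F F' (13 * (b + 4)) ∧
      HasBits F' (b + 4) (fun x => 2 * y x + (decide (4 * y x + 1 ≤ 4 * R x + r x)).toNat) ∧
      HasBits F' (b + 4) (fun x => 4 * R x + r x -
        if decide (4 * y x + 1 ≤ 4 * R x + r x) then 4 * y x + 1 else 0) := by
  have hp : 2 ^ (b + 4) = 16 * 2 ^ b := by ring
  have hU : HasBits F (b + 4) fun x => 4 * R x + r x :=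
    (hR.two_pow_mul_add hr hr4).le (by omega)
  have hV : HasBits F (b + 4) fun x => 4 * y x + 1 :=
    (hy.two_pow_mul_add (hasBits_const ht hf 2 1) (by simp)).le (by omega)
  have hUw : ∀ x, 4 * R x + r x < 2 ^ (b + 4) := fun x => by
    have := hyb x; have := hRy x; have := hr4 x; omega
  have hVw : ∀ x, 4 * y x + 1 < 2 ^ (b + 4) := fun x => by
    have := hyb x; omega
  obtain ⟨F₁, h₁, m₁, -⟩ := Program.exists_sub ht hU hV hUw hVw
  set g : X → Bool := fun x => decide (4 * y x + 1 ≤ 4 * R x + r x) with hg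
  obtain ⟨F₂, h₂, m₂⟩ := Program.exists_map (F := F₁) (fun a b => a && b)
    (fun i x => (4 * y x + 1).testBit i) (fun _ => g) (b + 4) (hV.mono h₁.subset) fun _ _ => m₁
  have hV' : HasBits F₂ (b + 4) fun x => if g x then 4 * y x + 1 else 0 := by
    intro i hi
    convert m₂ i hi using 2 with x
    cases hx : g x <;> simp [hx]
  have h₁₂ := h₁.trans h₂
  have hle : ∀ x, (if g x then 4 * y x + 1 else 0) ≤ 4 * R x + r x := by
    intro x
    split_ifs with h
    · simpa [hg] using h
    · omega
  obtain ⟨F₃, h₃, -, m₃⟩ := Program.exists_sub (h₁₂.subset ht) (hU.mono h₁₂.subset) hV' hUw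
    fun x => (hle x).trans_lt (hUw x)
  refine ⟨F₃, ?_, ?_, ?_⟩
  · have := h₁₂.trans h₃
    rwa [show 6 * (b + 4) + (b + 4) + 6 * (b + 4) = 13 * (b + 4) by ring] at this
  · refine HasBits.le (w := b + 4 + 1) ?_ (by omega)
    refine HasBits.two_pow_mul_add (a := 1) (hy.mono (h₁₂.trans h₃).subset) ?_ ?_
    · intro i hi
      obtain rfl : i = 0 := by omega
      convert h₃.subset (h₂.subset m₁) using 2 with x
      change (g x).toNat.testBit 0 = g x
      cases g x <;> rfl
    · intro x
      exact Bool.toNat_lt _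
  · intro i hi
    convert m₃ i hi using 2 with x
    beta_reduce
    have : 4 * R x + r x + 2 ^ (b + 4) - (if g x then 4 * y x + 1 else 0) =
        2 ^ (b + 4) + (4 * R x + r x - if g x then 4 * y x + 1 else 0) := by
      have := hle x; omega
    rw [this, Nat.testBit_two_pow_add_gt hi]

/-- Digit-by-digit extraction of a square root. -/
theorem Program.exists_sqrt {b : ℕ} {z : X → ℕ} (ht : (fun _ => true) ∈ F)
    (hf : (fun _ => false) ∈ F) (hz : HasBits F (2 * b) z) (hzb : ∀ x, z x < 4 ^ b) :
    ∃ F', Program F F' (13 * (b + 4) * b) ∧ HasBits F' b fun x => Nat.sqrt (z x) := by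
  have key : ∀ m k, m + k = b → ∃ F', Program F F' (13 * (b + 4) * m) ∧
      HasBits F' (b + 4) (fun x => Nat.sqrt (z x / 4 ^ k)) ∧
      HasBits F' (b + 4) (fun x => z x / 4 ^ k - Nat.sqrt (z x / 4 ^ k) *
        Nat.sqrt (z x / 4 ^ k)) := by
    intro m
    induction m with
    | zero =>
      intro k hk
      obtain rfl : k = b := by omega
      have h0 : ∀ x, z x / 4 ^ k = 0 := fun x => Nat.div_eq_of_lt (hzb x)
      simp only [h0, Nat.sqrt_zero, Nat.mul_zero, Nat.sub_zero]
      exact ⟨F, .refl, hasBits_const ht hf _ 0, hasBits_const ht hf _ 0⟩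
    | succ m ih =>
      intro k hk
      obtain ⟨F₁, h₁, hy, hR⟩ := ih (k + 1) (by omega)
      have hdiv : ∀ x, z x / 4 ^ k = 4 * (z x / 4 ^ (k + 1)) + z x / 4 ^ k % 4 := fun x => by
        rw [pow_succ, ← Nat.div_div_eq_div_mul]; omega
      have hr4 : ∀ x, z x / 4 ^ k % 4 < 4 := fun x => Nat.mod_lt _ (by norm_num)
      have hr : HasBits F₁ 2 fun x => z x / 4 ^ k % 4 := by
        intro i hi
        convert h₁.subset (hz (2 * k + i) (by omega)) using 2 with x
        rw [show (4 : ℕ) = 2 ^ 2 by norm_num, Nat.testBit_mod_two_pow, ← pow_mul,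
          Nat.testBit_div_two_pow]
        simp [hi, add_comm]
      have hyb : ∀ x, Nat.sqrt (z x / 4 ^ (k + 1)) < 2 ^ b := fun x => by
        rw [Nat.sqrt_lt']
        refine (Nat.div_le_self _ _).trans_lt ((hzb x).trans_eq ?_)
        rw [← pow_mul, mul_comm, pow_mul]
        norm_num
      have hRy : ∀ x, z x / 4 ^ (k + 1) - Nat.sqrt (z x / 4 ^ (k + 1)) *
          Nat.sqrt (z x / 4 ^ (k + 1)) ≤ 2 * Nat.sqrt (z x / 4 ^ (k + 1)) := fun x => by
        have h2 := Nat.lt_succ_sqrt (z x / 4 ^ (k + 1))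
        rw [Nat.succ_eq_add_one,
          show ∀ s, (s + 1) * (s + 1) = s * s + 2 * s + 1 by intro; ring] at h2
        omega
      obtain ⟨F₂, h₂, hy', hR'⟩ := Program.exists_sqrt_step (h₁.subset ht) (h₁.subset hf) hy hR hr
        hyb hRy hr4
      · refine ⟨F₂, ?_, ?_, ?_⟩
        · have := h₁.trans h₂
          rwa [show 13 * (b + 4) * m + 13 * (b + 4) = 13 * (b + 4) * (m + 1) by ring] at this
        · refine hy'.congr fun x => ?_
          conv_rhs => rw [hdiv x]
          rw [sqrt_four_mul_add (hr4 x)]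
        · refine hR'.congr fun x => ?_
          conv_rhs => rw [hdiv x]
          rw [sqrt_four_mul_add (hr4 x)]
          have h1 := Nat.sqrt_le (z x / 4 ^ (k + 1))
          generalize z x / 4 ^ (k + 1) = Q at *
          generalize z x / 4 ^ k % 4 = r at *
          generalize Nat.sqrt Q = s at *
          obtain ⟨R, rfl⟩ := Nat.exists_eq_add_of_le h1
          rw [Nat.add_sub_cancel_left]
          by_cases h : 4 * s + 1 ≤ 4 * R + r
          · simp only [h, decide_true, Bool.toNat_true, if_true]
            have : (2 * s + 1) * (2 * s + 1) = 4 * (s * s) + 4 * s + 1 := by ring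
            rw [this]; omega
          · simp only [h, decide_false, Bool.toNat_false]
            have : (2 * s + 0) * (2 * s + 0) = 4 * (s * s) := by ring
            rw [this]; simp
            omega
  obtain ⟨F', h, hy, -⟩ := key b 0 (by omega)
  refine ⟨F', h, (hy.le (by omega)).congr fun x => ?_⟩
  rw [pow_zero, Nat.div_one]

/-- Scaling by a power of two only relabels the digits, so that it needs no gates. -/
theorem HasBits.mul_four_pow_div {n b : ℕ} {J : X → ℕ} (hJ : HasBits F n J)
    (hf : (fun _ => false) ∈ F) : HasBits F (2 * b) fun x => J x * 4 ^ b / 2 ^ n := by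
  have h : ∀ x i, (J x * 4 ^ b / 2 ^ n).testBit i =
      (decide (2 * b ≤ i + n) && (J x).testBit (i + n - 2 * b)) := by
    intro x i
    rw [Nat.testBit_div_two_pow, show (4 : ℕ) = 2 ^ 2 by norm_num, ← pow_mul,
      Nat.testBit_mul_two_pow]
  intro i hi
  simp only [h]
  by_cases hle : 2 * b ≤ i + n
  · simpa [hle] using hJ (i + n - 2 * b) (by omega)
  · simpa [hle] using hf

/-- A number is the sum of its binary digits with weights. -/
theorem Program.exists_weights {w : ℕ} {A : X → ℕ} {g : X → Bool} (hA : HasBits F w A)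
    (hg : g ∈ F) (c : ℝ) :
    ∃ F' ps, Program F F' w ∧ (∀ p ∈ ps, p.1 ∈ F') ∧ ps.length = w ∧
      ∀ x, weightedSum ps x = if g x then c * ((A x % 2 ^ w : ℕ) : ℝ) else 0 := by
  induction w with
  | zero => exact ⟨F, [], .refl, by simp, rfl, fun x => by simp [weightedSum, Nat.mod_one]⟩
  | succ w ih =>
    obtain ⟨F₁, ps, h₁, hps, hl, hs⟩ := ih fun i hi => hA i (by omega)
    obtain ⟨F₂, h₂, s₂, m₂⟩ := h₁.exists_gate (fun a b => a && b) (h₁.subset (hA w (by omega)))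
      (h₁.subset hg)
    refine ⟨F₂, (fun x => (A x).testBit w && g x, c * 2 ^ w) :: ps, h₂, ?_, by simp [hl],
      fun x => ?_⟩
    · intro p hp
      rcases List.mem_cons.1 hp with rfl | hp
      · exact m₂
      · exact s₂ (hps p hp)
    · rw [weightedSum_cons, hs, mod_two_pow_succ_eq]
      cases hx : g x <;> cases h : (A x).testBit w <;> simp [hx, h]
      ring

theorem weightedSum_append {ps qs : List ((X → Bool) × ℝ)} (x : X) :
    weightedSum (ps ++ qs) x = weightedSum ps x + weightedSum qs x := by
  simp [weightedSum]

/-- A product is the sum of the products of its binary digits with weights, so that the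
multiplication itself need not be carried out. -/
theorem Program.exists_weights_mul {w v : ℕ} {A B : X → ℕ} {g : X → Bool} (hA : HasBits F w A)
    (hB : HasBits F v B) (hg : g ∈ F) (c : ℝ) :
    ∃ F' ps, Program F F' (w * (v + 1)) ∧ (∀ p ∈ ps, p.1 ∈ F') ∧ ps.length = w * v ∧
      ∀ x, weightedSum ps x =
        if g x then c * ((A x % 2 ^ w : ℕ) : ℝ) * ((B x % 2 ^ v : ℕ) : ℝ) else 0 := by
  induction w with
  | zero => exact ⟨F, [], by simpa using .refl, by simp, by simp,
      fun x => by simp [weightedSum, Nat.mod_one]⟩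
  | succ w ih =>
    obtain ⟨F₁, ps, h₁, hps, hl, hs⟩ := ih fun i hi => hA i (by omega)
    obtain ⟨F₂, h₂, s₂, m₂⟩ := h₁.exists_gate (fun a b => a && b) (h₁.subset (hA w (by omega)))
      (h₁.subset hg)
    obtain ⟨F₃, qs, h₃, hqs, hlq, hsq⟩ := Program.exists_weights (hB.mono h₂.subset) m₂ (c * 2 ^ w)
    refine ⟨F₃, qs ++ ps, ?_, ?_, by simp [hl, hlq]; ring, fun x => ?_⟩
    · have := h₂.trans h₃
      rwa [show w * (v + 1) + 1 + v = (w + 1) * (v + 1) by ring] at this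
    · intro p hp
      rcases List.mem_append.1 hp with hp | hp
      · exact hqs p hp
      · exact h₃.subset (s₂ (hps p hp))
    · rw [weightedSum_append, hs, hsq, mod_two_pow_succ_eq]
      cases g x <;> cases (A x).testBit w <;> simp
      ring

end Arithmetic
end

noncomputable section

open Matrix

/-! ### Arithmetic on a quantum register -/

section Register

variable {W : Type} [Fintype W] [DecidableEq W] {n : ℕ}

/-- The `n` lowest binary digits of `m`. -/
def bits (n m : ℕ) : Fin n → Bool := fun i => m.testBit i

theorem ofBits_bits (n m : ℕ) : Nat.ofBits (bits n m) = m % 2 ^ n := Nat.ofBits_testBit m n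

theorem bits_ofBits (f : Fin n → Bool) : bits n (Nat.ofBits f) = f := by
  ext i
  exact Nat.testBit_ofBits_lt f i i.2

theorem bits_congr {m m' : ℕ} (h : m % 2 ^ n = m' % 2 ^ n) : bits n m = bits n m' := by
  rw [← bits_ofBits (bits n m), ← bits_ofBits (bits n m'), ofBits_bits, ofBits_bits, h]

theorem hasBits_ofBits {X : Type*} {F : Set (X → Bool)} {u : X → Fin n → Bool}
    (h : ∀ i, (fun x => u x i) ∈ F) : HasBits F n fun x => Nat.ofBits (u x) := by
  intro i hi
  convert h ⟨i, hi⟩ using 2 with x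
  exact Nat.testBit_ofBits_lt _ i hi

/-- `cleanCost_xor` for a register of `n` qubits. -/
theorem cleanCost_xor_register {S : Set W} {F : Set ((W → Bool) → Bool)} {k : ℕ}
    (h : Program (inputs S) F k) (s : Fin n ↪ W) (hs : ∀ i, s i ∉ S)
    {H : Fin n → (W → Bool) → Bool} (hH : ∀ i, H i ∈ F) {π : (W → Bool) → W → Bool}
    (hπ : ∀ x i, π x (s i) = (x (s i) ^^ H i x)) (hπ' : ∀ x w, (∀ i, s i ≠ w) → π x w = x w) :
    CleanCost (mapMatrix π) (10 * k + n) := by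
  have hT : ∀ w, w ∈ (List.finRange n).map s ↔ ∃ i, s i = w := by simp
  have key := cleanCost_xor h ((List.finRange n).map s)
    ((List.nodup_finRange n).map s.injective)
    (fun t ht => by obtain ⟨i, rfl⟩ := (hT t).1 ht; exact hs i)
    (Function.extend s H fun _ _ => false)
    (fun t ht => by
      obtain ⟨i, rfl⟩ := (hT t).1 ht
      rw [s.injective.extend_apply]; exact hH i)
  rw [List.length_map, List.length_finRange] at key
  convert key using 2
  ext x w
  simp only [hT]
  split_ifs with hw
  · obtain ⟨i, rfl⟩ := hw
    rw [hπ, s.injective.extend_apply]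
  · exact hπ' x w fun i hi => hw ⟨i, hi⟩

/-- The map that adds `D` to the number in the register if the flag `b` is set. -/
def shiftMap (b : Bool) (D : ℕ) (x : Fin n ⊕ Bool → Bool) : Fin n ⊕ Bool → Bool :=
  Sum.elim (bits n (Nat.ofBits (fun i => x (.inl i)) + if x (.inr b) then D else 0))
    fun c => x (.inr c)

/-- Addition of the constant `D`, modulo `2 ^ n`, under the control of `f`. -/
theorem Program.exists_shift {X : Type*} {F : Set (X → Bool)} {u : X → Fin n → Bool}
    {f : X → Bool} (hu : ∀ i, (fun x => u x i) ∈ F) (hf : f ∈ F) (D : ℕ) :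
    ∃ F', Program F F' (2 + 5 * n) ∧ ∀ i, (fun x => bits n (Nat.ofBits (u x) +
      if f x then D else 0) i) ∈ F' := by
  obtain ⟨F₁, h₁, -, m₁⟩ := Program.exists_const ⟨f, hf⟩
  obtain ⟨F₂, h₂, m₂, -⟩ := Program.exists_add ((hasBits_ofBits hu).mono h₁.subset)
    (hasBits_ite_const (h₁.subset hf) m₁ n D) m₁
  refine ⟨F₂, h₁.trans h₂, fun i => ?_⟩
  exact m₂ i i.2

/-- In-place addition: the sum is computed in a second register, from which the first one is
erased by a subtraction, and the registers are exchanged. -/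
theorem cleanCost_shift (b : Bool) (D : ℕ) (hD : D < 2 ^ n) :
    CleanCost (mapMatrix (shiftMap (n := n) b D)) (104 * n + 40) := by
  let π₁ : ((Fin n ⊕ Bool) ⊕ Fin n → Bool) → (Fin n ⊕ Bool) ⊕ Fin n → Bool := fun x =>
    Sum.elim (fun w => x (.inl w)) fun i => (x (.inr i) ^^ bits n (Nat.ofBits
      (fun i => x (.inl (.inl i))) + if x (.inl (.inr b)) then D else 0) i)
  let π₂ : ((Fin n ⊕ Bool) ⊕ Fin n → Bool) → (Fin n ⊕ Bool) ⊕ Fin n → Bool := fun x =>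
    Sum.elim (Sum.elim (fun i => (x (.inl (.inl i)) ^^ bits n (Nat.ofBits (fun i => x (.inr i)) +
      if x (.inl (.inr b)) then 2 ^ n - D else 0) i)) fun c => x (.inl (.inr c)))
      fun i => x (.inr i)
  let π₃ : ((Fin n ⊕ Bool) ⊕ Fin n → Bool) → (Fin n ⊕ Bool) ⊕ Fin n → Bool := fun x =>
    Sum.elim (Sum.elim (fun i => (x (.inl (.inl i)) ^^ x (.inr i))) fun c => x (.inl (.inr c)))
      fun i => x (.inr i)
  let π₄ : ((Fin n ⊕ Bool) ⊕ Fin n → Bool) → (Fin n ⊕ Bool) ⊕ Fin n → Bool := fun x =>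
    Sum.elim (fun w => x (.inl w)) fun i => (x (.inr i) ^^ x (.inl (.inl i)))
  let sX : Fin n ↪ (Fin n ⊕ Bool) ⊕ Fin n := Function.Embedding.inl.trans Function.Embedding.inl
  let sY : Fin n ↪ (Fin n ⊕ Bool) ⊕ Fin n := Function.Embedding.inr
  have c₁ : CleanCost (mapMatrix π₁) (10 * (2 + 5 * n) + n) := by
    obtain ⟨F, h, hF⟩ := Program.exists_shift (F := inputs (Set.range sY)ᶜ)
      (u := fun x i => x (.inl (.inl i))) (f := fun x => x (.inl (.inr b)))
      (fun i => ⟨_, by simp [sY], rfl⟩) ⟨_, by simp [sY], rfl⟩ D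
    refine cleanCost_xor_register h sY (by simp) hF (fun x i => rfl) fun x w hw => ?_
    rcases w with w | w
    · rfl
    · exact absurd rfl (hw w)
  have hX : ∀ (x : (Fin n ⊕ Bool) ⊕ Fin n → Bool) (H : Fin n → Bool)
      (w : (Fin n ⊕ Bool) ⊕ Fin n), (∀ i, sX i ≠ w) →
      Sum.elim (Sum.elim H fun c => x (.inl (.inr c))) (fun i => x (.inr i)) w = x w := by
    rintro x H ((w | w) | w) hw
    · exact absurd rfl (hw w)
    · rfl
    · rfl
  have c₂ : CleanCost (mapMatrix π₂) (10 * (2 + 5 * n) + n) := by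
    obtain ⟨F, h, hF⟩ := Program.exists_shift (F := inputs (Set.range sX)ᶜ)
      (u := fun x i => x (.inr i)) (f := fun x => x (.inl (.inr b)))
      (fun i => ⟨_, by simp [sX], rfl⟩) ⟨_, by simp [sX], rfl⟩ (2 ^ n - D)
    exact cleanCost_xor_register h sX (by simp) hF (fun x i => rfl) fun x => hX x _
  have c₃ : CleanCost (mapMatrix π₃) (10 * 0 + n) :=
    cleanCost_xor_register (S := (Set.range sX)ᶜ) .refl sX (by simp)
      (H := fun i x => x (.inr i)) (fun i => ⟨_, by simp [sX], rfl⟩) (fun x i => rfl)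
      fun x => hX x _
  have c₄ : CleanCost (mapMatrix π₄) (10 * 0 + n) := by
    refine cleanCost_xor_register (S := (Set.range sY)ᶜ) .refl sY (by simp)
      (H := fun i x => x (.inl (.inl i))) (fun i => ⟨_, by simp [sY], rfl⟩) (fun x i => rfl)
      fun x w hw => ?_
    rcases w with w | w
    · rfl
    · exact absurd rfl (hw w)
  refine CleanCost.of_sum ((c₄.mul (c₃.mul (c₂.mul c₁))).mono (by omega)) fun x => ?_
  rw [← Matrix.mulVec_mulVec, ← Matrix.mulVec_mulVec, ← Matrix.mulVec_mulVec,
    mapMatrix_mulVec_ket, mapMatrix_mulVec_ket, mapMatrix_mulVec_ket, mapMatrix_mulVec_ket,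
    mapMatrix_mulVec_ket, liftState_ket, extend_inl]
  congr 1
  have hback : bits n (Nat.ofBits (bits n (Nat.ofBits (fun i => x (.inl i)) +
      if x (.inr b) then D else 0)) + if x (.inr b) then 2 ^ n - D else 0) =
      fun i => x (.inl i) := by
    refine Eq.trans ?_ (bits_ofBits _)
    apply bits_congr
    rw [ofBits_bits]
    cases x (.inr b)
    · simp
    · simp only [if_true, Nat.mod_add_mod, add_assoc]
      rw [Nat.add_sub_cancel' hD.le, Nat.add_mod_right]
  have e₁ : π₁ (Sum.elim x zeros) = Sum.elim x (bits n (Nat.ofBits (fun i => x (.inl i)) +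
      if x (.inr b) then D else 0)) := by
    ext w
    rcases w with w | w
    · rfl
    · exact Bool.false_xor _
  have e₂ : π₂ (π₁ (Sum.elim x zeros)) = Sum.elim (Sum.elim zeros fun c => x (.inr c))
      (bits n (Nat.ofBits (fun i => x (.inl i)) + if x (.inr b) then D else 0)) := by
    rw [e₁]
    ext w
    rcases w with (w | w) | w
    · change (x (.inl w) ^^ bits n (Nat.ofBits (bits n (Nat.ofBits (fun i => x (.inl i)) +
        if x (.inr b) then D else 0)) + if x (.inr b) then 2 ^ n - D else 0) w) = false
      rw [hback, Bool.xor_self]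
    · rfl
    · rfl
  rw [e₂]
  ext w
  rcases w with (w | w) | w
  · exact Bool.false_xor _
  · rfl
  · change (_ ^^ (false ^^ _)) = false
    rw [Bool.false_xor]
    exact Bool.xor_self _

/-- The integer part of `v * 4 ^ b / 2 ^ n`, where `v` is reduced modulo `2 ^ n`. -/
def scaled (n b v : ℕ) : ℕ := v % 2 ^ n * 4 ^ b / 2 ^ n

theorem scaled_lt (n b v : ℕ) : scaled n b v < 4 ^ b := by
  rw [scaled, Nat.div_lt_iff_lt_mul (by positivity), mul_comm]
  exact Nat.mul_lt_mul_of_pos_left (Nat.mod_lt _ (by positivity)) (by positivity)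

/-- The angle that the circuit computes for a register with the content `v`: a combination of
`√z` and `√z * z`, where `z` is the scaled value of `v + d`, and zero if `v` exceeds `T`. -/
def circuitAngle (n b d T : ℕ) (l₁ l₂ : ℝ) (v : ℕ) : ℝ :=
  if v ≤ T then l₁ * (Nat.sqrt (scaled n b (v + d)) : ℕ) +
    l₂ * (Nat.sqrt (scaled n b (v + d)) : ℕ) * (scaled n b (v + d) : ℕ) else 0

/-- Rotation of the qubit `t` by the computed angle, if the condition `g` holds: always, or if the
qubit `w` is set. -/
theorem cleanCost_circuitAngle {t : W} {u : Fin n → W} (hu : ∀ i, u i ≠ t) {g : (W → Bool) → Bool}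
    {w : W} (hw : w ≠ t) (hg : g = (fun _ => true) ∨ g = fun x => x w) (b d T : ℕ)
    (hT : T < 2 ^ n) (l₁ l₂ : ℝ) :
    CleanCost (ctl t fun x => (qubitRotation (if g x then
      circuitAngle n b d T l₁ l₂ (Nat.ofBits fun i => x (u i)) else 0) : Matrix Bool Bool ℂ))
      (700 * (n + b ^ 2) + 30) := by
  set v : (W → Bool) → ℕ := fun x => Nat.ofBits fun i => x (u i) with hv
  have hwS : (fun x : W → Bool => x w) ∈ inputs {t}ᶜ := ⟨w, by simpa using hw, rfl⟩
  have hvn : ∀ x, v x < 2 ^ n := fun x => Nat.ofBits_lt_two_pow _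
  obtain ⟨F₁, h₁, tr, fa⟩ := Program.exists_const ⟨_, hwS⟩
  have hvb : HasBits F₁ n v := hasBits_ofBits fun i =>
    h₁.subset ⟨u i, by simpa using hu i, rfl⟩
  have hg₁ : g ∈ F₁ := by
    rcases hg with rfl | rfl
    · exact tr
    · exact h₁.subset hwS
  obtain ⟨F₂, h₂, hJ, -⟩ := Program.exists_add hvb (hasBits_const tr fa n d) fa
  have hJ' : HasBits F₂ n fun x => (v x + d) % 2 ^ n := by
    intro i hi
    convert hJ i hi using 2 with x
    simp [Nat.testBit_mod_two_pow, hi]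
  obtain ⟨F₃, h₃, hc, -⟩ := Program.exists_sub (h₂.subset tr)
    (hasBits_const (h₂.subset tr) (h₂.subset fa) n T) (hvb.mono h₂.subset) (fun _ => hT) hvn
  obtain ⟨F₄, h₄, s₄, hgc⟩ := h₃.exists_gate (fun a b => a && b) (h₃.subset (h₂.subset hg₁)) hc
  have hz : HasBits F₄ (2 * b) fun x => scaled n b (v x + d) :=
    (hJ'.mono h₄.subset).mul_four_pow_div (h₄.subset (h₂.subset fa))
  obtain ⟨F₅, h₅, hy⟩ := Program.exists_sqrt (h₄.subset (h₂.subset tr)) (h₄.subset (h₂.subset fa))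
    hz fun x => scaled_lt n b _
  obtain ⟨F₆, ps, h₆, hps, hpl, hpw⟩ := Program.exists_weights hy (h₅.subset hgc) l₁
  obtain ⟨F₇, qs, h₇, hqs, hql, hqw⟩ := Program.exists_weights_mul (hy.mono h₆.subset)
    (hz.mono (h₅.trans h₆).subset) (h₆.subset (h₅.subset hgc)) l₂
  have key := cleanCost_rotation
    (((((h₁.trans h₂).trans h₄).trans h₅).trans h₆).trans h₇) (t := t) (by simp) (ps ++ qs)
    (fun p hp => by
      rcases List.mem_append.1 hp with hp | hp
      · exact h₇.subset (hps p hp)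
      · exact hqs p hp)
  have hmod : ∀ x, Nat.sqrt (scaled n b (v x + d)) % 2 ^ b = Nat.sqrt (scaled n b (v x + d)) := by
    intro x
    refine Nat.mod_eq_of_lt ?_
    rw [Nat.sqrt_lt', ← pow_mul, mul_comm, pow_mul]
    exact scaled_lt n b _
  have hmod' : ∀ x, scaled n b (v x + d) % 2 ^ (2 * b) = scaled n b (v x + d) := by
    intro x
    refine Nat.mod_eq_of_lt ?_
    rw [pow_mul]
    exact scaled_lt n b _
  have hw : ∀ x, weightedSum (ps ++ qs) x =
      if g x then circuitAngle n b d T l₁ l₂ (v x) else 0 := by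
    intro x
    rw [weightedSum_append, hpw, hqw, hmod, hmod', circuitAngle]
    by_cases h : g x = true
    · by_cases h' : v x ≤ T <;> simp [h, h']
    · simp [h]
  simp only [hw] at key
  refine key.mono ?_
  rw [List.length_append, hpl, hql]
  have : b ≤ b * b := Nat.le_mul_self b
  ring_nf
  ring_nf at this
  omega

end Register
end

noncomputable section

open Matrix

/-! ### Implementation of quantum operations -/

section Implement

variable {N : ℕ}

/-- The operation `Ψ` on an `N`-level system is implemented by a circuit with at most `k` gates:
on the levels, encoded in binary, and ancilla qubits in the state `0`, the circuit applies Kraus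
operators `A z` of `Ψ`, together with which the ancilla qubits are left in different basis states
`y z`. -/
def Implementable (N : ℕ) (Ψ : Module.End ℂ (Matrix (Fin N) (Fin N) ℂ)) (k : ℕ) : Prop :=
  ∃ (K : Type) (_ : Fintype K) (_ : DecidableEq K) (c : QCircuit (Fin (Nat.clog 2 N) ⊕ K))
    (I : Type) (_ : Fintype I) (_ : DecidableEq I) (y : I → K → Bool)
    (A : I → Matrix (Fin N) (Fin N) ℂ), c.length ≤ k ∧ Function.Injective y ∧
      (∀ j, QCircuit.toMatrix c *ᵥ ket (Sum.elim (levelBits N j) zeros) =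
        ∑ z, ∑ i, A z i j • ket (Sum.elim (levelBits N i) (y z))) ∧ krausMap A = Ψ

theorem implementable_one : Implementable N 1 0 := by
  refine ⟨Empty, inferInstance, inferInstance, [], Unit, inferInstance, inferInstance,
    fun _ => zeros, fun _ => 1, le_rfl, fun _ _ _ => rfl, fun j => ?_, ?_⟩
  · simp [QCircuit.toMatrix_nil, Matrix.one_apply]
  · refine LinearMap.ext fun X => ?_
    rw [krausMap_apply]
    simp

/-- The second circuit is given fresh ancilla qubits, so that the pairs of Kraus operators leave
different basis states. -/
theorem Implementable.mul {Ψ Φ : Module.End ℂ (Matrix (Fin N) (Fin N) ℂ)} {k l : ℕ}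
    (hΦ : Implementable N Φ l) (hΨ : Implementable N Ψ k) : Implementable N (Φ * Ψ) (k + l) := by
  obtain ⟨K, _, _, c, I, _, _, y, A, hc, hy, h, hA⟩ := hΨ
  obtain ⟨K', _, _, c', I', _, _, y', A', hc', hy', h', hA'⟩ := hΦ
  let e : Fin (Nat.clog 2 N) ⊕ K ↪ Fin (Nat.clog 2 N) ⊕ (K ⊕ K') :=
    (Function.Embedding.refl _).sumMap Function.Embedding.inl
  let e' : Fin (Nat.clog 2 N) ⊕ K' ↪ Fin (Nat.clog 2 N) ⊕ (K ⊕ K') :=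
    (Function.Embedding.refl _).sumMap Function.Embedding.inr
  have he : ∀ (u w : Fin (Nat.clog 2 N) → Bool) (a b : K → Bool) (a' : K' → Bool),
      Function.extend e (Sum.elim u a) (Sum.elim w (Sum.elim b a')) =
        Sum.elim u (Sum.elim a a') := by
    intro u w a b a'
    ext i
    rcases i with i | i | i
    · exact e.injective.extend_apply (Sum.elim u a) _ (.inl i)
    · exact e.injective.extend_apply (Sum.elim u a) _ (.inr i)
    · exact Function.extend_apply' _ _ _ (by rintro ⟨_ | _, h⟩ <;> cases h)
  have he' : ∀ (u w : Fin (Nat.clog 2 N) → Bool) (a : K → Bool) (a' b' : K' → Bool),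
      Function.extend e' (Sum.elim u a') (Sum.elim w (Sum.elim a b')) =
        Sum.elim u (Sum.elim a a') := by
    intro u w a a' b'
    ext i
    rcases i with i | i | i
    · exact e'.injective.extend_apply (Sum.elim u a') _ (.inl i)
    · exact Function.extend_apply' _ _ _ (by rintro ⟨_ | _, h⟩ <;> cases h)
    · exact e'.injective.extend_apply (Sum.elim u a') _ (.inr i)
  have hz : (zeros : K ⊕ K' → Bool) = Sum.elim zeros zeros := by
    ext i; cases i <;> rfl
  refine ⟨K ⊕ K', inferInstance, inferInstance, QCircuit.relabel e c ++ QCircuit.relabel e' c',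
    I × I', inferInstance, inferInstance, fun p => Sum.elim (y p.1) (y' p.2),
    fun p => A' p.2 * A p.1, ?_, ?_, fun j => ?_, ?_⟩
  · rw [List.length_append, QCircuit.length_relabel, QCircuit.length_relabel]
    omega
  · rintro ⟨z, z'⟩ ⟨w, w'⟩ hzw
    have h1 : y z = y w := funext fun i => congrFun hzw (.inl i)
    have h2 : y' z' = y' w' := funext fun i => congrFun hzw (.inr i)
    rw [hy h1, hy' h2]
  · have h1 : QCircuit.toMatrix (QCircuit.relabel e c) *ᵥ
        ket (Sum.elim (levelBits N j) (Sum.elim zeros zeros)) =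
        ∑ z, ∑ i, A z i j • ket (Sum.elim (levelBits N i) (Sum.elim (y z) zeros)) := by
      have := QCircuit.relabel_mulVec_liftState e (Sum.elim zeros (Sum.elim zeros zeros)) c
        (ket (Sum.elim (levelBits N j) zeros))
      rw [h, liftState_ket, he] at this
      rw [this, ← Fintype.sum_prod_type', ← Fintype.sum_prod_type', liftState_sum_smul]
      simp only [liftState_ket, he]
    have h2 : ∀ z i, QCircuit.toMatrix (QCircuit.relabel e' c') *ᵥ
        ket (Sum.elim (levelBits N i) (Sum.elim (y z) zeros)) =
        ∑ z', ∑ l, A' z' l i • ket (Sum.elim (levelBits N l) (Sum.elim (y z) (y' z'))) := by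
      intro z i
      have := QCircuit.relabel_mulVec_liftState e' (Sum.elim zeros (Sum.elim (y z) zeros)) c'
        (ket (Sum.elim (levelBits N i) zeros))
      rw [h', liftState_ket, he'] at this
      rw [this, ← Fintype.sum_prod_type', ← Fintype.sum_prod_type', liftState_sum_smul]
      simp only [liftState_ket, he']
    rw [QCircuit.toMatrix_append_mulVec, hz, h1, Matrix.mulVec_sum,
      Fintype.sum_prod_type]
    refine Finset.sum_congr rfl fun z _ => ?_
    simp only [Matrix.mulVec_sum, Matrix.mulVec_smul, h2, Finset.smul_sum, smul_smul,
      Matrix.mul_apply, Finset.sum_smul]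
    rw [Finset.sum_comm]
    refine Finset.sum_congr rfl fun z' _ => ?_
    rw [Finset.sum_comm]
    simp only [mul_comm]
  · refine LinearMap.ext fun X => ?_
    rw [Module.End.mul_apply, ← hA, ← hA', krausMap_apply, krausMap_apply, krausMap_apply,
      Fintype.sum_prod_type, Finset.sum_comm]
    refine Finset.sum_congr rfl fun z' _ => ?_
    rw [Matrix.mul_sum, Matrix.sum_mul]
    refine Finset.sum_congr rfl fun z _ => ?_
    simp only [conjTranspose_mul, Matrix.mul_assoc]

theorem Implementable.pow {Ψ : Module.End ℂ (Matrix (Fin N) (Fin N) ℂ)} {k : ℕ}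
    (hΨ : Implementable N Ψ k) (M : ℕ) : Implementable N (Ψ ^ M) (M * k) := by
  induction M with
  | zero => simpa using implementable_one
  | succ M ih =>
    rw [pow_succ, Nat.succ_mul, add_comm]
    exact ih.mul hΨ

theorem encodeIsometry_conjTranspose_mul (N : ℕ) : (encodeIsometry N)ᴴ * encodeIsometry N = 1 := by
  ext i j
  rw [Matrix.mul_apply]
  simp only [conjTranspose_apply, encodeIsometry, Matrix.one_apply]
  rw [Finset.sum_eq_single (levelBits N i)]
  · simp [(levelBits_injective N).eq_iff]
  · intro s _ hs
    simp [hs]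
  · simp

/-- Tracing out the ancilla qubits leaves the operation with the Kraus operators that the circuit
applies. -/
theorem Implementable.exists_channel {Ψ : Module.End ℂ (Matrix (Fin N) (Fin N) ℂ)} {k : ℕ}
    (hΨ : Implementable N Ψ k) :
    ∃ (q : ℕ) (c : QCircuit (Fin (Nat.clog 2 N) ⊕ Fin q)), c.length ≤ k ∧
      QCircuit.channel N q c = conjBy (encodeIsometry N) ∘ₗ Ψ := by
  obtain ⟨K, _, _, c, I, _, _, y, A, hc, hy, h, hA⟩ := hΨ
  let f : K ≃ Fin (Fintype.card K) := Fintype.equivFin K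
  let e : Fin (Nat.clog 2 N) ⊕ K ↪ Fin (Nat.clog 2 N) ⊕ Fin (Fintype.card K) :=
    ((Equiv.refl _).sumCongr f).toEmbedding
  have he : ∀ (u : Fin (Nat.clog 2 N) → Bool) (a : K → Bool)
      (x : Fin (Nat.clog 2 N) ⊕ Fin (Fintype.card K) → Bool),
      Function.extend e (Sum.elim u a) x = Sum.elim u fun i => a (f.symm i) := by
    intro u a x
    ext i
    obtain ⟨i, rfl⟩ : ∃ j, e j = i := ⟨_, ((Equiv.refl _).sumCongr f).apply_symm_apply i⟩
    rw [e.injective.extend_apply]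
    rcases i with i | i
    · rfl
    · exact congrArg a (f.symm_apply_apply i).symm
  let y' : I → Fin (Fintype.card K) → Bool := fun z i => y z (f.symm i)
  have hy' : Function.Injective y' := by
    intro z w hzw
    apply hy
    ext i
    simpa [y'] using congrFun hzw (f i)
  refine ⟨Fintype.card K, QCircuit.relabel e c, (QCircuit.length_relabel e c).trans_le hc, ?_⟩
  have hcol : ∀ s w j, (QCircuit.toMatrix (QCircuit.relabel e c) *
      encodeWithAncilla N (Fintype.card K)) (Sum.elim s w) j =
      (∑ z, if w = y' z then encodeIsometry N * A z else 0) s j := by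
    intro s w j
    have h1 : (QCircuit.toMatrix (QCircuit.relabel e c) *
      encodeWithAncilla N (Fintype.card K)) (Sum.elim s w) j =
      (QCircuit.toMatrix (QCircuit.relabel e c) *ᵥ ket (Sum.elim (levelBits N j) zeros))
        (Sum.elim s w) := by
      rw [mulVec_ket, Matrix.mul_apply, Finset.sum_eq_single (Sum.elim (levelBits N j) zeros)]
      · rw [encodeWithAncilla, if_pos (by rfl), mul_one]
      · intro x _ hx
        change x ≠ Sum.elim (levelBits N j) fun _ => false at hx
        rw [encodeWithAncilla, if_neg hx, mul_zero]
      · simp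
    have h2 := QCircuit.relabel_mulVec_liftState e zeros c (ket (Sum.elim (levelBits N j) zeros))
    rw [liftState_ket, he, h, ← Fintype.sum_prod_type', liftState_sum_smul] at h2
    simp only [liftState_ket, he] at h2
    rw [h1]
    refine (congrFun h2 _).trans ?_
    rw [Finset.sum_apply, Fintype.sum_prod_type, Matrix.sum_apply]
    refine Finset.sum_congr rfl fun z _ => ?_
    have hiff : ∀ i, Sum.elim s w = Sum.elim (levelBits N i) (fun l => y z (f.symm l)) ↔
        s = levelBits N i ∧ w = y' z := by
      intro i
      constructor
      · intro h
        exact ⟨funext fun l => congrFun h (.inl l), funext fun l => congrFun h (.inr l)⟩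
      · rintro ⟨rfl, rfl⟩
        rfl
    simp only [Pi.smul_apply, ket, Pi.single_apply, hiff, smul_eq_mul]
    split_ifs with hw
    · simp only [hw, and_true, Matrix.mul_apply, encodeIsometry]
      exact Finset.sum_congr rfl fun i _ => by rw [mul_comm]
    · simp [hw]
  refine LinearMap.ext fun X => ?_
  ext s s'
  have h3 : QCircuit.channel N (Fintype.card K) (QCircuit.relabel e c) X s s' = ∑ w,
      ((∑ z, if w = y' z then encodeIsometry N * A z else 0) * X *
        (∑ z, if w = y' z then encodeIsometry N * A z else 0)ᴴ) s s' := by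
    change ∑ w, (QCircuit.toMatrix (QCircuit.relabel e c) *
      encodeWithAncilla N (Fintype.card K) * X * (QCircuit.toMatrix (QCircuit.relabel e c) *
      encodeWithAncilla N (Fintype.card K))ᴴ) (Sum.elim s w) (Sum.elim s' w) = _
    refine Finset.sum_congr rfl fun w _ => ?_
    rw [Matrix.mul_apply, Matrix.mul_apply]
    refine Finset.sum_congr rfl fun j _ => ?_
    rw [Matrix.mul_apply, Matrix.mul_apply, conjTranspose_apply, conjTranspose_apply, hcol]
    congr 1
    exact Finset.sum_congr rfl fun i _ => by rw [hcol]
  rw [h3, ← Fintype.sum_of_injective y' hy' (fun z => (encodeIsometry N * A z * X *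
    (encodeIsometry N * A z)ᴴ) s s')]
  · rw [LinearMap.comp_apply, ← hA, krausMap_apply, map_sum, Matrix.sum_apply]
    refine Finset.sum_congr rfl fun z _ => ?_
    simp only [conjBy, LinearMap.coe_mk, AddHom.coe_mk, conjTranspose_mul, Matrix.mul_assoc]
  · intro w hw
    have : ∀ z, w ≠ y' z := fun z h => hw ⟨z, h.symm⟩
    simp [this]
  · intro z
    simp [hy'.eq_iff]

/-- The diamond norm estimate is reduced to an operator norm on the trace class. -/
theorem Implementable.simulableWithin {Ψ T : Module.End ℂ (Matrix (Fin N) (Fin N) ℂ)} {k : ℕ}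
    (hΨ : Implementable N Ψ k) {t ε G : ℝ} (hε : 0 < ε) (hk : (k : ℝ) ≤ G)
    (h : ‖superCLM (ampliationHom (Fin N) (Ψ - superExp ((t : ℂ) • T)))‖ < ε) :
    SimulableWithin N T t ε G := by
  obtain ⟨q, c, hc, hch⟩ := hΨ.exists_channel
  refine ⟨q, c, le_trans (by exact_mod_cast hc) hk, ?_⟩
  rw [hch, ← LinearMap.comp_sub]
  refine (diamondNorm_conjBy_comp_le (encodeIsometry_conjTranspose_mul N) _).trans_lt ?_
  exact (ENNReal.ofReal_lt_ofReal_iff hε).2 h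

end Implement
end

noncomputable section

open Matrix

/-! ### The circuit of one step -/

section Step

variable {n : ℕ}

/-- The content of the two flag qubits for each Kraus operator of a step: the first flag records
that a jump took place, the second one that a second jump followed. -/
def flags : Option Bool → Bool → Bool
  | none, _ => false
  | some b, i => if i then b else true

theorem flags_injective : Function.Injective flags := by
  intro z w h
  have h0 := congrFun h false
  have h1 := congrFun h true
  rcases z with _ | z <;> rcases w with _ | w <;> simp_all [flags]

theorem shiftMap_elim (b : Bool) (D : ℕ) (u : Fin n → Bool) (f : Bool → Bool) :
    shiftMap b D (Sum.elim u f) = Sum.elim (if f b then bits n (Nat.ofBits u + D) else u) f := by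
  rw [shiftMap]
  simp only [Sum.elim_inl, Sum.elim_inr]
  by_cases h : f b = true <;> simp only [h, if_true, if_false, add_zero, Bool.false_eq_true]
  congr 1
  exact bits_ofBits u

/-- One step of the simulation: a rotation of the first flag, a shift of the register controlled
by it, and the same for the second flag, controlled by the first one. -/
def stepUnitary (n D : ℕ) (α β : ℕ → ℝ) : Matrix (Fin n ⊕ Bool → Bool) (Fin n ⊕ Bool → Bool) ℂ :=
  mapMatrix (shiftMap true D) *
    (ctl (.inr true) (fun x => (qubitRotation (if x (.inr false) then
      β (Nat.ofBits fun i => x (.inl i)) else 0) : Matrix Bool Bool ℂ)) *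
    (mapMatrix (shiftMap false D) *
      ctl (.inr false) fun x => (qubitRotation (α (Nat.ofBits fun i => x (.inl i))) :
        Matrix Bool Bool ℂ)))

theorem stepUnitary_mulVec_ket (D : ℕ) (α β : ℕ → ℝ) (u : Fin n → Bool) :
    stepUnitary n D α β *ᵥ ket (Sum.elim u zeros) =
      (Real.cos (α (Nat.ofBits u)) : ℂ) • ket (Sum.elim u (flags none)) +
      ((Real.cos (β (Nat.ofBits (bits n (Nat.ofBits u + D)))) : ℂ) *
        (Real.sin (α (Nat.ofBits u)) : ℂ)) •
          ket (Sum.elim (bits n (Nat.ofBits u + D)) (flags (some false))) +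
      ((Real.sin (β (Nat.ofBits (bits n (Nat.ofBits u + D)))) : ℂ) *
        (Real.sin (α (Nat.ofBits u)) : ℂ)) •
          ket (Sum.elim (bits n (Nat.ofBits (bits n (Nat.ofBits u + D)) + D))
            (flags (some true))) := by
  have f0 : Function.update (zeros : Bool → Bool) false false = flags none := by
    ext i; cases i <;> rfl
  have f1 : Function.update (zeros : Bool → Bool) false true = flags (some false) := by
    ext i; cases i <;> rfl
  have f2 : ∀ b b', Function.update (flags (some b)) true b' = flags (some b') := by
    intro b b'; ext i; cases i <;> simp [flags]
  have f3 : Function.update (flags none) true false = flags none := by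
    ext i; cases i <;> rfl
  rw [stepUnitary, ← Matrix.mulVec_mulVec, ← Matrix.mulVec_mulVec, ← Matrix.mulVec_mulVec,
    ctl_mulVec_ket]
  simp only [Fintype.sum_bool, Matrix.mulVec_add, Matrix.mulVec_smul, mapMatrix_mulVec_ket,
    Sum.update_elim_inr, f0, f1, shiftMap_elim, ctl_mulVec_ket, f2, f3, Sum.elim_inl,
    Sum.elim_inr, qubitRotation_apply]
  have g1 : ∀ b, flags (some b) true = b := fun _ => rfl
  have g2 : ∀ b, flags (some b) false = true := fun _ => rfl
  have g3 : ∀ i, flags none i = false := fun _ => rfl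
  have g4 : (zeros : Bool → Bool) false = false := rfl
  simp only [g1, g2, g3, g4, if_true, Bool.false_eq_true, if_false, Bool.true_eq_false,
    Real.cos_zero, Real.sin_zero, Complex.ofReal_zero, Complex.ofReal_one, zero_smul, one_smul,
    zero_add]
  module

/-- The column of a step at a level, in terms of the Kraus operators. -/
theorem stepUnitary_mulVec_level {N D : ℕ} {α β : ℕ → ℝ} {S : Matrix (Fin N) (Fin N) ℂ}
    (hS : ∀ j : Fin N, (α j = 0 ∧ β j = 0) ∨ ∃ i, levelBits N i = bits (Nat.clog 2 N) (j + D) ∧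
      ∀ i', S i' j = if i' = i then 1 else 0) (j : Fin N) :
    stepUnitary (Nat.clog 2 N) D α β *ᵥ ket (Sum.elim (levelBits N j) zeros) =
      ∑ z, ∑ i, stepKraus S (fun j => α j) (fun j => β j) z i j •
        ket (Sum.elim (levelBits N i) (flags z)) := by
  have hof : ∀ i : Fin N, Nat.ofBits (levelBits N i) = i := by
    intro i
    refine (ofBits_bits (Nat.clog 2 N) i).trans (Nat.mod_eq_of_lt ?_)
    exact i.2.trans_le (Nat.le_pow_clog (by norm_num) N)
  rw [stepUnitary_mulVec_ket, hof, Fintype.sum_option, Fintype.sum_bool]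
  have h0 : ∑ i, stepKraus S (fun j => α j) (fun j => β j) none i j •
      ket (Sum.elim (levelBits N i) (flags none)) =
      (Real.cos (α j) : ℂ) • ket (Sum.elim (levelBits N j) (flags none)) := by
    rw [Finset.sum_eq_single j]
    · simp [stepKraus, realDiag]
    · intro i _ hi
      simp [stepKraus, realDiag, Matrix.diagonal_apply_ne _ hi]
    · simp
  rw [h0]
  have h1 : ∀ i, stepKraus S (fun j => α j) (fun j => β j) (some false) i j =
      Real.cos (β i) * S i j * Real.sin (α j) := by
    intro i
    simp [stepKraus, realDiag, Matrix.mul_diagonal, Matrix.diagonal_mul]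
  have h2 : ∀ i, stepKraus S (fun j => α j) (fun j => β j) (some true) i j =
      (∑ l, S i l * Real.sin (β l) * S l j) * Real.sin (α j) := by
    intro i
    simp only [stepKraus, realDiag, Matrix.mul_diagonal, Matrix.mul_apply (M := _ * diagonal _)]
  simp only [h1, h2]
  rcases hS j with ⟨hα, -⟩ | ⟨i, hi, hSi⟩
  · simp [hα]
  · have h3 : ∀ i', ∑ l : Fin N, S i' l * (Real.sin (β l) : ℂ) * S l j =
        S i' i * Real.sin (β i) := by
      intro i'
      rw [Finset.sum_eq_single i]
      · simp [hSi]
      · intro l _ hl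
        simp [hSi, hl]
      · simp
    have h4 : ∑ i' : Fin N, ((Real.cos (β i') : ℂ) * S i' j * (Real.sin (α j) : ℂ)) •
        ket (Sum.elim (levelBits N i') (flags (some false))) =
        ((Real.cos (β i) : ℂ) * (Real.sin (α j) : ℂ)) •
          ket (Sum.elim (levelBits N i) (flags (some false))) := by
      rw [Finset.sum_eq_single i]
      · simp [hSi]
      · intro l _ hl
        simp [hSi, hl]
      · simp
    have h5 : ∑ i' : Fin N, (S i' i * (Real.sin (β i) : ℂ) * (Real.sin (α j) : ℂ)) •
        ket (Sum.elim (levelBits N i') (flags (some true))) =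
        ((Real.sin (β i) : ℂ) * (Real.sin (α j) : ℂ)) •
          ket (Sum.elim (bits (Nat.clog 2 N) (i + D)) (flags (some true))) := by
      rcases hS i with ⟨-, hβ⟩ | ⟨l, hl, hSl⟩
      · simp [hβ]
      · rw [Finset.sum_eq_single l]
        · simp [hSl, hl]
        · intro l' _ hl'
          simp [hSl, hl']
        · simp
    simp only [h3, h4, h5, ← hi, hof]
    abel

/-- Two rotations by computed angles and two shifts realize the Kraus operators of a step. -/
theorem implementable_step {N : ℕ} (hN : 2 ≤ N) {D : ℕ} (hD : D < 2 ^ Nat.clog 2 N)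
    {S : Matrix (Fin N) (Fin N) ℂ} (b d T : ℕ) (hT : T < 2 ^ Nat.clog 2 N) (l₁ l₂ l₁' l₂' : ℝ)
    {α β : ℕ → ℝ} (hα : α = circuitAngle (Nat.clog 2 N) b d T l₁ l₂)
    (hβ : β = circuitAngle (Nat.clog 2 N) b d T l₁' l₂')
    (hS : ∀ j : Fin N, (α j = 0 ∧ β j = 0) ∨ ∃ i, levelBits N i = bits (Nat.clog 2 N) (j + D) ∧
      ∀ i', S i' j = if i' = i then 1 else 0) :
    Implementable N (krausMap (stepKraus S (fun j => α j) fun j => β j))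
      (2000 * (Nat.clog 2 N + b ^ 2)) := by
  have hn : 1 ≤ Nat.clog 2 N := Nat.clog_pos (by norm_num) hN
  have c₁ := cleanCost_circuitAngle (t := (.inr false : Fin (Nat.clog 2 N) ⊕ Bool)) (u := Sum.inl)
    (by simp) (w := .inr true) (by simp) (.inl rfl) b d T hT l₁ l₂
  simp only [if_true] at c₁
  have c₃ := cleanCost_circuitAngle (t := (.inr true : Fin (Nat.clog 2 N) ⊕ Bool)) (u := Sum.inl)
    (by simp) (w := .inr false) (by simp) (.inr rfl) b d T hT l₁' l₂'
  have hB : CleanCost (stepUnitary (Nat.clog 2 N) D α β) (2000 * (Nat.clog 2 N + b ^ 2)) := by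
    rw [stepUnitary, hα, hβ]
    exact ((cleanCost_shift true D hD).mul
      (c₃.mul ((cleanCost_shift false D hD).mul c₁))).mono (by omega)
  obtain ⟨K, _, _, c, hc, h⟩ := hB
  let e : (Fin (Nat.clog 2 N) ⊕ Bool) ⊕ K ↪ Fin (Nat.clog 2 N) ⊕ (Bool ⊕ K) :=
    (Equiv.sumAssoc _ _ _).toEmbedding
  have he : ∀ (u : Fin (Nat.clog 2 N) → Bool) (f : Bool → Bool) (a : K → Bool),
      Function.extend e (Sum.elim (Sum.elim u f) a) zeros = Sum.elim u (Sum.elim f a) := by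
    intro u f a
    ext i
    rcases i with i | i | i
    · exact e.injective.extend_apply (Sum.elim (Sum.elim u f) a) _ (.inl (.inl i))
    · exact e.injective.extend_apply (Sum.elim (Sum.elim u f) a) _ (.inl (.inr i))
    · exact e.injective.extend_apply (Sum.elim (Sum.elim u f) a) _ (.inr i)
  refine ⟨Bool ⊕ K, inferInstance, inferInstance, QCircuit.relabel e c, Option Bool, inferInstance,
    inferInstance, fun z => Sum.elim (flags z) zeros, _,
    (QCircuit.length_relabel e c).trans_le hc, ?_, fun j => ?_, rfl⟩
  · intro z w hzw
    exact flags_injective (funext fun i => congrFun hzw (.inl i))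
  · have h1 := QCircuit.relabel_mulVec_liftState e zeros c
      (liftState Function.Embedding.inl zeros (ket (Sum.elim (levelBits N j) zeros)))
    have hl : ∀ u f, liftState e zeros (liftState Function.Embedding.inl zeros
        (ket (Sum.elim u f : Fin (Nat.clog 2 N) ⊕ Bool → Bool))) =
        ket (Sum.elim u (Sum.elim f zeros)) := by
      intro u f
      rw [liftState_ket, liftState_ket, extend_inl, ← he]
      rfl
    have hz : (zeros : Bool ⊕ K → Bool) = Sum.elim zeros zeros := by
      ext i; cases i <;> rfl
    rw [h, hl, stepUnitary_mulVec_level hS] at h1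
    rw [hz, h1, ← Fintype.sum_prod_type', ← Fintype.sum_prod_type', liftState_sum_smul,
      liftState_sum_smul]
    simp only [hl]

end Step
end

noncomputable section

open Matrix

/-! ### Accuracy of the computed angles -/

section Angles

/-- The weight of `√z` in the computed angle. -/
def linearWeight (N n b : ℕ) (r : ℝ) : ℝ := r * √((2 : ℝ) ^ n / N) / 2 ^ b

/-- The weight of `√z * z` in the computed angle. -/
def cubicWeight (N n b : ℕ) (r : ℝ) : ℝ := -((r * √((2 : ℝ) ^ n / N)) ^ 3 / 12) / (2 ^ b * 4 ^ b)

/-- The computed angle, with `b` digits, has an error of order `r 2 ^ (-b)` from the angle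
`x - x³ / 12` with `x = r √(J / N)`. -/
theorem abs_weights_sub_le {N n b J : ℕ} (hN : 0 < N) (hn : 2 ^ n ≤ 2 * N) (hJ : J ≤ N)
    (hJn : J < 2 ^ n) {r : ℝ} (hr : 0 ≤ r) (hr1 : r ≤ 1) :
    |linearWeight N n b r * (Nat.sqrt (scaled n b J) : ℕ) + cubicWeight N n b r *
      (Nat.sqrt (scaled n b J) : ℕ) * (scaled n b J : ℕ) -
        (r * √((J : ℝ) / N) - (r * √((J : ℝ) / N)) ^ 3 / 12)| ≤ 2 * r * (1 / 2 ^ b) := by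
  have hN' : (0 : ℝ) < N := by exact_mod_cast hN
  set κ := √((2 : ℝ) ^ n / N) with hκ
  set e := √((J : ℝ) / N) with he
  set η : ℝ := 1 / 2 ^ b with hη
  have hκ2 : κ ^ 2 = 2 ^ n / N := Real.sq_sqrt (by positivity)
  have he2 : e ^ 2 = J / N := Real.sq_sqrt (by positivity)
  have hκ0 : 0 ≤ κ := Real.sqrt_nonneg _
  have he0 : 0 ≤ e := Real.sqrt_nonneg _
  have hη0 : 0 < η := by positivity
  have hη1 : η ≤ 1 := by
    rw [hη, div_le_one (by positivity)]
    exact one_le_pow₀ (by norm_num)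
  have hκ2' : κ ^ 2 ≤ 2 := by
    rw [hκ2, div_le_iff₀ hN']
    exact_mod_cast hn
  have hκ1 : κ ≤ 3 / 2 := by nlinarith
  have he1 : e ≤ 1 := by
    refine Real.sqrt_le_one.2 ?_
    rw [div_le_one hN']
    exact_mod_cast hJ
  set z := scaled n b J with hz
  set y := Nat.sqrt z with hy
  -- The scaled value `x` of `J / N` and the integers below it and below its root.
  set x : ℝ := J * 4 ^ b / 2 ^ n with hx
  have hxe : κ ^ 2 * η ^ 2 * x = e ^ 2 := by
    rw [hκ2, he2, hη, hx, one_div, inv_pow, ← pow_mul, mul_comm b 2, pow_mul]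
    norm_num
    field_simp
  have hzx : (z : ℝ) ≤ x ∧ x < z + 1 := by
    rw [hz, scaled, Nat.mod_eq_of_lt hJn]
    constructor
    · have := Nat.cast_div_le (α := ℝ) (m := J * 4 ^ b) (n := 2 ^ n)
      push_cast at this
      exact this
    · have := Nat.lt_div_mul_add (a := J * 4 ^ b) (b := 2 ^ n) (by positivity)
      rw [hx, div_lt_iff₀ (by positivity)]
      have h2 : ((J * 4 ^ b : ℕ) : ℝ) < ((J * 4 ^ b / 2 ^ n * 2 ^ n + 2 ^ n : ℕ) : ℝ) := by
        exact_mod_cast this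
      push_cast at h2 ⊢
      linarith
  have hyz : (y : ℝ) ^ 2 ≤ z := by
    have := Nat.sqrt_le' z
    exact_mod_cast this
  have hzy : (z : ℝ) + 1 ≤ (y + 1) ^ 2 := by
    have := Nat.lt_succ_sqrt' z
    exact_mod_cast this
  have hy0 : (0 : ℝ) ≤ y := Nat.cast_nonneg _
  have hz0 : (0 : ℝ) ≤ z := Nat.cast_nonneg _
  set Y := κ * η * y with hY
  set Z := κ ^ 2 * η ^ 2 * z with hZ
  have hY0 : 0 ≤ Y := by positivity
  have hκη : 0 ≤ κ ^ 2 * η ^ 2 := by positivity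
  have hZe : Z ≤ e ^ 2 := by
    rw [← hxe]
    exact mul_le_mul_of_nonneg_left hzx.1 hκη
  have hYe : Y ≤ e := by
    refine abs_le_of_sq_le_sq' ?_ he0 |>.2
    refine le_trans ?_ hZe
    rw [hY, hZ, mul_pow, mul_pow]
    exact mul_le_mul_of_nonneg_left hyz hκη
  have heY : e ≤ Y + κ * η := by
    refine abs_le_of_sq_le_sq' ?_ (by positivity) |>.2
    rw [← hxe, hY, show κ * η * y + κ * η = κ * η * (y + 1) by ring, mul_pow, mul_pow]
    exact mul_le_mul_of_nonneg_left (hzx.2.le.trans hzy) hκη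
  have heZ : e ^ 2 ≤ Z + 2 * η := by
    have : e ^ 2 ≤ Z + κ ^ 2 * η ^ 2 := by
      rw [← hxe, hZ]
      have := mul_le_mul_of_nonneg_left hzx.2.le hκη
      linarith
    have h2 : κ ^ 2 * η ^ 2 ≤ 2 * η ^ 2 := by gcongr
    nlinarith
  have hangle : linearWeight N n b r * (y : ℕ) + cubicWeight N n b r * (y : ℕ) * (z : ℕ) =
      r * Y - r ^ 3 / 12 * (Y * Z) := by
    have h4 : η ^ 2 = 1 / 4 ^ b := by
      rw [hη, one_div, inv_pow, ← pow_mul, mul_comm b 2, pow_mul]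
      norm_num
    rw [linearWeight, cubicWeight, ← hκ, hY, hZ, h4, hη]
    field_simp
    ring
  rw [hangle]
  have h1 : 0 ≤ e ^ 3 - Y * Z := by
    nlinarith [mul_nonneg hY0 (sub_nonneg.2 hZe),
      mul_nonneg (sub_nonneg.2 hYe) (sq_nonneg e)]
  have h2 : e ^ 3 - Y * Z ≤ κ * η + 2 * η := by
    have e1 : (e - Y) * e ^ 2 ≤ κ * η := by
      have : e ^ 2 ≤ 1 := by nlinarith
      have := mul_le_mul (sub_le_iff_le_add'.2 heY) this (sq_nonneg e) (by positivity)
      linarith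
    have e2 : Y * (e ^ 2 - Z) ≤ 2 * η := by
      have := mul_le_mul (hYe.trans he1) (sub_le_iff_le_add'.2 heZ) (sub_nonneg.2 hZe)
        zero_le_one
      linarith
    linarith [show e ^ 3 - Y * Z = (e - Y) * e ^ 2 + Y * (e ^ 2 - Z) by ring]
  have h3 : r ^ 3 ≤ r := pow_le_of_le_one hr hr1 (by norm_num)
  have h4 : r ^ 3 * (e ^ 3 - Y * Z) ≤ r * (κ * η + 2 * η) :=
    mul_le_mul h3 h2 h1 hr
  have h5 : 0 ≤ r ^ 3 * (e ^ 3 - Y * Z) := by positivity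
  have h6 : r * (e - Y) ≤ r * (κ * η) := by gcongr; linarith
  have h7 : 0 ≤ r * (e - Y) := mul_nonneg hr (by linarith)
  have h8 : r * (κ * η) ≤ r * (3 / 2 * η) := by gcongr
  have h9 : 0 ≤ r * η := by positivity
  have h10 : r * (κ * η + 2 * η) = r * (κ * η) + 2 * (r * η) := by ring
  have h11 : r * (3 / 2 * η) = 3 / 2 * (r * η) := by ring
  rw [show r * Y - r ^ 3 / 12 * (Y * Z) - (r * e - (r * e) ^ 3 / 12) =
    r ^ 3 * (e ^ 3 - Y * Z) / 12 - r * (e - Y) by ring, show 2 * r * η = 2 * (r * η) by ring,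
    abs_le]
  constructor <;> linarith

end Angles

/-! ### Approximation of the semigroup by a step -/

section Approx

variable {N : ℕ}

/-- The structure shared by the two Lindbladians: the Lindblad operator is `S * realDiag e`, where
`S` shifts the levels by `D` modulo the size of the register, and `e j` is the square root of
`(j + d) / N` on the levels up to `T` that are not annihilated. -/
structure IsLadder (S : Matrix (Fin N) (Fin N) ℂ) (e p : Fin N → ℝ) (D d T : ℕ) : Prop where
  shift_lt : D < 2 ^ Nat.clog 2 N
  bound_lt : T < 2 ^ Nat.clog 2 N
  isometric : Sᴴ * S = realDiag p
  level : ∀ j : Fin N, (p j = 0 ∧ e j = 0 ∧ (T < j ∨ (j : ℕ) + d = 0)) ∨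
    (p j = 1 ∧ e j = √(((j + d : ℕ) : ℝ) / N) ∧ (j : ℕ) + d < N ∧ (j : ℕ) ≤ T ∧
      ∃ i, levelBits N i = bits (Nat.clog 2 N) (j + D) ∧ ∀ i', S i' j = if i' = i then 1 else 0)

theorem two_pow_clog_le (hN : 2 ≤ N) : 2 ^ Nat.clog 2 N ≤ 2 * N := by
  have h := Nat.pow_pred_clog_lt_self (b := 2) (by norm_num) hN
  have h1 : 1 ≤ Nat.clog 2 N := Nat.clog_pos (by norm_num) hN
  obtain ⟨m, hm⟩ := Nat.exists_eq_add_of_le h1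
  rw [hm] at h ⊢
  rw [Nat.pred_eq_sub_one, Nat.add_sub_cancel_left] at h
  rw [pow_add]
  omega

/-- A circuit for one step. Both angles are computed by the same formula: the cubic term is not
needed for the second one, but is small enough to do no harm. -/
theorem IsLadder.exists_step {S : Matrix (Fin N) (Fin N) ℂ} {e p : Fin N → ℝ} {D d T : ℕ}
    (h : IsLadder S e p D d T) (hN : 2 ≤ N) {s : ℝ} (hs : 0 ≤ s) (hs1 : s ≤ 1) {b : ℕ}
    (hb : 1 / 2 ^ b ≤ s ^ 4) :
    ∃ Ψ, Implementable N Ψ (2000 * (Nat.clog 2 N + b ^ 2)) ∧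
      ‖superCLM (ampliationHom (Fin N) Ψ)‖ ≤ 1 ∧
      ‖superCLM (ampliationHom (Fin N) Ψ) -
        (1 + ((s ^ 2 : ℝ) : ℂ) • superCLM (ampliationHom (Fin N) (dissipator (S * realDiag e))) +
          (1 / 2 : ℂ) • (((s ^ 2 : ℝ) : ℂ) •
            superCLM (ampliationHom (Fin N) (dissipator (S * realDiag e)))) ^ 2)‖ ≤
        36073 * (s ^ 2) ^ 3 := by
  set n := Nat.clog 2 N
  have hNn : N ≤ 2 ^ n := Nat.le_pow_clog (by norm_num) N
  set c : ℝ := √(1 / 2) with hc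
  have hc0 : 0 ≤ c := Real.sqrt_nonneg _
  have hcc : c * c = 1 / 2 := Real.mul_self_sqrt (by norm_num)
  have hc1 : c ≤ 1 := by nlinarith
  set A : ℝ → ℕ → ℝ := fun r => circuitAngle n b d T (linearWeight N n b r) (cubicWeight N n b r)
    with hA
  have hzero : ∀ r, ∀ j : Fin N, p j = 0 → A r j = 0 := by
    intro r j hj
    rcases h.level j with ⟨-, -, hT⟩ | ⟨hp, -⟩
    · simp only [hA, circuitAngle]
      rcases hT with hT | hT
      · rw [if_neg (by omega)]
      · simp [hT, scaled]
    · rw [hj] at hp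
      norm_num at hp
  have herr : ∀ r, 0 ≤ r → r ≤ 1 → ∀ j : Fin N,
      |A r j - (r * e j - (r * e j) ^ 3 / 12)| ≤ 2 * r * s ^ 4 := by
    intro r hr hr1 j
    rcases h.level j with ⟨hp, he, -⟩ | ⟨-, he, hd, hT, -⟩
    · rw [hzero r j hp, he]
      simp
      positivity
    · simp only [hA, circuitAngle]
      rw [if_pos hT, he]
      refine (abs_weights_sub_le (by omega) (two_pow_clog_le hN) hd.le (hd.trans_le hNn) hr
        hr1).trans ?_
      gcongr
  have he : ∀ j, 0 ≤ e j ∧ e j ≤ 1 := by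
    intro j
    rcases h.level j with ⟨-, he, -⟩ | ⟨-, he, hd, -⟩
    · rw [he]; norm_num
    · rw [he]
      refine ⟨Real.sqrt_nonneg _, Real.sqrt_le_one.2 ?_⟩
      rw [div_le_one (by exact_mod_cast (by omega : 0 < N))]
      exact_mod_cast hd.le
  have hp : ∀ j, p j = 1 ∨ p j = 0 := fun j => by
    rcases h.level j with ⟨hp, -⟩ | ⟨hp, -⟩
    · exact .inr hp
    · exact .inl hp
  refine ⟨krausMap (stepKraus S (fun j => A s j) fun j => A (c * s) j),
    implementable_step hN h.shift_lt b d T h.bound_lt _ _ _ _ rfl rfl fun j => ?_,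
    norm_superCLM_ampliationHom_krausMap_le (sum_stepKraus h.isometric
      (fun j => (hp j).imp_right (hzero s j)) fun j => (hp j).imp_right (hzero (c * s) j)), ?_⟩
  · rcases h.level j with ⟨hp, -⟩ | ⟨-, -, -, -, hi⟩
    · exact .inl ⟨hzero _ _ hp, hzero _ _ hp⟩
    · exact .inr hi
  · have hα : ∀ j : Fin N, |A s j - (s * e j - (s * e j) ^ 3 / 12)| ≤ 3 * s ^ 5 := by
      intro j
      refine (herr s hs hs1 j).trans ?_
      have : 0 ≤ s ^ 5 := by positivity
      nlinarith
    have hβ : ∀ j : Fin N, |A (c * s) j - c * (s * e j)| ≤ 3 * s ^ 3 := by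
      intro j
      have hcs : c * s ≤ s := by nlinarith
      have hcs0 : 0 ≤ c * s := by positivity
      have h1 := herr (c * s) hcs0 (hcs.trans hs1) j
      have h2 : 2 * (c * s) * s ^ 4 ≤ 2 * s ^ 3 := by
        have h3 : s ^ 4 ≤ s ^ 2 := pow_le_pow_of_le_one hs hs1 (by norm_num)
        calc 2 * (c * s) * s ^ 4 ≤ 2 * s * s ^ 2 := by gcongr
          _ = 2 * s ^ 3 := by ring
      have h3 : c * s * e j ≤ s := by nlinarith [(he j).1, (he j).2]
      have h4 : 0 ≤ c * s * e j := mul_nonneg hcs0 (he j).1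
      have h5 : (c * s * e j) ^ 3 ≤ s ^ 3 := by gcongr
      have h6 : 0 ≤ (c * s * e j) ^ 3 := by positivity
      rw [← mul_assoc]
      rw [abs_le] at h1 ⊢
      constructor <;> linarith
    have hpe : ∀ j, p j = 1 ∨ e j = 0 := fun j => by
      rcases h.level j with ⟨-, he, -⟩ | ⟨hp, -⟩
      · exact .inr he
      · exact .inl hp
    obtain ⟨K', hK', hle⟩ := norm_stepKraus_sub_le (r := Fin N) h.isometric hp hpe
      (fun j => (he j).1) (fun j => (he j).2) hs hs1 (by norm_num) hcc hc0 hα hβ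
    -- For `K = 3` the constants are `K' = 108` and `10 * K' + 3 * K' ^ 2 + 1 = 36073`.
    refine hle.trans (le_of_eq ?_)
    rw [hK']
    ring

/-- The creation operator shifts by one; on the level `N - 1`, above `T = N - 2`, it vanishes. -/
theorem isLadder_up (hN : 2 ≤ N) :
    IsLadder (N := N) (of fun i j => if (i : ℕ) = j + 1 then 1 else 0)
      (fun j => if (j : ℕ) + 1 < N then √(((j + 1 : ℕ) : ℝ) / N) else 0)
      (fun j => if (j : ℕ) + 1 < N then 1 else 0) 1 1 (N - 2) where
  shift_lt := Nat.one_lt_two_pow (Nat.clog_pos (by norm_num) hN).ne'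
  bound_lt := by
    have := Nat.le_pow_clog (b := 2) (by norm_num) N
    omega
  isometric := by
    ext k j
    rw [Matrix.mul_apply]
    simp only [conjTranspose_apply, of_apply, realDiag, Matrix.diagonal_apply]
    by_cases hj : (j : ℕ) + 1 < N
    · rw [Finset.sum_eq_single ⟨j + 1, hj⟩]
      · by_cases hkj : k = j
        · subst hkj; simp [hj]
        · have : ¬ (j : ℕ) = k := fun h => hkj (Fin.ext h.symm)
          simp [hkj, this]
      · intro i _ hi
        have : ¬ (i : ℕ) = j + 1 := fun h => hi (Fin.ext h)
        simp [this]
      · simp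
    · rw [Finset.sum_eq_zero]
      · by_cases hkj : k = j
        · subst hkj; simp [hj]
        · simp [hkj]
      · intro i _
        have : ¬ (i : ℕ) = j + 1 := by omega
        simp [this]
  level j := by
    by_cases hj : (j : ℕ) + 1 < N
    · refine .inr ⟨by simp [hj], by simp [hj], hj, by omega, ⟨j + 1, hj⟩, rfl, fun i' => ?_⟩
      simp [Fin.ext_iff]
    · exact .inl ⟨by simp [hj], by simp [hj], .inl (by omega)⟩

/-- The annihilation operator shifts by `2 ^ n - 1`, that is, by `-1` modulo `2 ^ n`; on the level
`0` its amplitude vanishes. -/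
theorem isLadder_down (hN : 2 ≤ N) :
    IsLadder (N := N) (of fun i j => if (i : ℕ) + 1 = j then 1 else 0)
      (fun j => √((j : ℝ) / N)) (fun j => if (j : ℕ) = 0 then 0 else 1)
      (2 ^ Nat.clog 2 N - 1) 0 (N - 1) where
  shift_lt := Nat.sub_lt (by positivity) (by norm_num)
  bound_lt := by
    have := Nat.le_pow_clog (b := 2) (by norm_num) N
    omega
  isometric := by
    ext k j
    rw [Matrix.mul_apply]
    simp only [conjTranspose_apply, of_apply, realDiag, Matrix.diagonal_apply]
    by_cases hj : (j : ℕ) = 0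
    · rw [Finset.sum_eq_zero]
      · by_cases hkj : k = j
        · subst hkj; simp [hj]
        · simp [hkj]
      · intro i _
        have : ¬ (i : ℕ) + 1 = j := by omega
        simp [this]
    · have hj' : (j : ℕ) - 1 < N := by omega
      rw [Finset.sum_eq_single ⟨j - 1, hj'⟩]
      · have hjj : (j : ℕ) - 1 + 1 = j := by omega
        by_cases hkj : k = j
        · subst hkj; simp [hj, hjj]
        · have : ¬ (j : ℕ) = k := fun h => hkj (Fin.ext h.symm)
          simp [hkj, this, hjj]
      · intro i _ hi
        have : ¬ (i : ℕ) + 1 = j := fun h => hi (Fin.ext (by simp; omega))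
        simp [this]
      · simp
  level j := by
    by_cases hj : (j : ℕ) = 0
    · exact .inl ⟨by simp [hj], by simp [hj], .inr (by omega)⟩
    · refine .inr ⟨by simp [hj], by simp, by omega, by omega, ⟨j - 1, by omega⟩, ?_, fun i' => ?_⟩
      · change bits (Nat.clog 2 N) (j - 1) = _
        apply bits_congr
        have h1 : 1 ≤ 2 ^ Nat.clog 2 N := Nat.one_le_two_pow
        rw [show (j : ℕ) + (2 ^ Nat.clog 2 N - 1) = j - 1 + 2 ^ Nat.clog 2 N by omega,
          Nat.add_mod_right]
      · have : (i' : ℕ) + 1 = j ↔ (i' : ℕ) = j - 1 := by omega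
        simp [Fin.ext_iff, this]

theorem dissipator_smul {n : Type*} [Fintype n] (r : ℝ) (L : Matrix n n ℂ) :
    dissipator ((r : ℂ) • L) = ((r ^ 2 : ℝ) : ℂ) • dissipator L := by
  refine LinearMap.ext fun X => ?_
  simp only [dissipator, LinearMap.coe_mk, AddHom.coe_mk, LinearMap.smul_apply, conjTranspose_smul,
    Matrix.smul_mul, Matrix.mul_smul, smul_smul, Complex.star_def, Complex.conj_ofReal]
  push_cast
  module

theorem lindbladUp_eq (hN : 2 ≤ N) : lindbladUp N =
    dissipator ((of fun i j => if (i : ℕ) = j + 1 then 1 else 0 : Matrix (Fin N) (Fin N) ℂ) *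
      realDiag fun j : Fin N => if (j : ℕ) + 1 < N then √(((j + 1 : ℕ) : ℝ) / N) else 0) := by
  have hN0 : (0 : ℝ) < N := by exact_mod_cast (by omega : 0 < N)
  have : (of fun i j => if (i : ℕ) = j + 1 then 1 else 0 : Matrix (Fin N) (Fin N) ℂ) *
      (realDiag fun j : Fin N => if (j : ℕ) + 1 < N then √(((j + 1 : ℕ) : ℝ) / N) else 0) =
      ((√(1 / N) : ℝ) : ℂ) • creationOp N := by
    ext i j
    rw [realDiag, Matrix.mul_diagonal, of_apply, Matrix.smul_apply, creationOp]
    by_cases h : (i : ℕ) = j + 1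
    · have hj : (j : ℕ) + 1 < N := by omega
      rw [if_pos h, if_pos h, if_pos hj, one_mul, smul_eq_mul, ← Complex.ofReal_mul,
        ← Real.sqrt_mul (by positivity)]
      congr 2
      push_cast
      ring
    · simp [h]
  rw [this, dissipator_smul, lindbladUp, Real.sq_sqrt (by positivity)]
  push_cast
  rfl

theorem lindbladDown_eq (hN : 2 ≤ N) : lindbladDown N =
    dissipator ((of fun i j => if (i : ℕ) + 1 = j then 1 else 0 : Matrix (Fin N) (Fin N) ℂ) *
      realDiag fun j : Fin N => √((j : ℝ) / N)) := by
  have hN0 : (0 : ℝ) < N := by exact_mod_cast (by omega : 0 < N)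
  have : (of fun i j => if (i : ℕ) + 1 = j then 1 else 0 : Matrix (Fin N) (Fin N) ℂ) *
      (realDiag fun j : Fin N => √((j : ℝ) / N)) = ((√(1 / N) : ℝ) : ℂ) • annihilationOp N := by
    ext i j
    rw [realDiag, Matrix.mul_diagonal, of_apply, Matrix.smul_apply, annihilationOp]
    by_cases h : (i : ℕ) + 1 = j
    · rw [if_pos h, if_pos h, one_mul, smul_eq_mul, ← Complex.ofReal_mul,
        ← Real.sqrt_mul (by positivity)]
      congr 2
      ring
    · simp [h]
  rw [this, dissipator_smul, lindbladDown, Real.sq_sqrt (by positivity)]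
  push_cast
  rfl

end Approx
end

noncomputable section

open Matrix
open scoped Matrix.Norms.L2Operator

/-! ### The number of steps and the cost -/

section Cost

theorem log_sq_le {x : ℝ} (hx : 1 ≤ x) : Real.log x ^ 2 ≤ 4 * x := by
  have h0 : 0 ≤ Real.log x := Real.log_nonneg hx
  have h1 : Real.log x ≤ 2 * √x := by
    have h := Real.log_le_sub_one_of_pos (Real.sqrt_pos.2 (zero_lt_one.trans_le hx))
    rw [Real.log_sqrt (by linarith)] at h
    linarith
  calc Real.log x ^ 2 ≤ (2 * √x) ^ 2 := by gcongr
    _ = 4 * x := by rw [mul_pow, Real.sq_sqrt (by linarith)]; ring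

/-- The number of binary digits that makes the error of the angles negligible in a step of length
`τ`. -/
theorem exists_precision {τ : ℝ} (hτ : 0 < τ) (hτ1 : τ ≤ 1) :
    ∃ b : ℕ, 1 / 2 ^ b ≤ τ ^ 2 ∧ (b : ℝ) ^ 2 ≤ 32 * Real.log (1 / τ) ^ 2 + 2 := by
  have hl : 0 ≤ Real.log (1 / τ) := Real.log_nonneg (by rw [le_div_iff₀ hτ]; linarith)
  set l := Real.log (1 / τ) with hl'
  -- Since `4 log 2 ≥ 2`, the power `2 ^ (4 * l)` is at least `τ ^ (-2)`.
  refine ⟨⌈4 * l⌉₊, ?_, ?_⟩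
  · have h1 : 4 * l ≤ ⌈4 * l⌉₊ := Nat.le_ceil _
    have h2 : τ ^ 2 = Real.exp (-(2 * l)) := by
      rw [hl', one_div, Real.log_inv, mul_neg, neg_neg, mul_comm, Real.exp_mul,
        Real.exp_log hτ, Real.rpow_two]
    have h3 : (2 : ℝ) ^ ⌈4 * l⌉₊ = Real.exp (⌈4 * l⌉₊ * Real.log 2) := by
      rw [mul_comm (⌈4 * l⌉₊ : ℝ), Real.exp_mul, Real.exp_log (by norm_num), Real.rpow_natCast]
    rw [h2, h3, one_div, ← Real.exp_neg, Real.exp_le_exp]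
    have h4 := Real.log_two_gt_d9
    have h5 : (0 : ℝ) ≤ ⌈4 * l⌉₊ := Nat.cast_nonneg _
    nlinarith
  · have h1 : (⌈4 * l⌉₊ : ℝ) < 4 * l + 1 := Nat.ceil_lt_add_one (by linarith)
    have h2 : (0 : ℝ) ≤ ⌈4 * l⌉₊ := Nat.cast_nonneg _
    calc (⌈4 * l⌉₊ : ℝ) ^ 2 ≤ (4 * l + 1) ^ 2 := by gcongr
      _ ≤ 32 * l ^ 2 + 2 := by nlinarith [sq_nonneg (4 * l - 1)]

theorem half_le_log {N : ℕ} (hN : 2 ≤ N) : 1 / 2 ≤ Real.log N := by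
  have h : Real.log 2 ≤ Real.log N := Real.log_le_log (by norm_num) (by exact_mod_cast hN)
  have := Real.log_two_gt_d9
  linarith

theorem clog_le_log {N : ℕ} (hN : 2 ≤ N) : (Nat.clog 2 N : ℝ) ≤ 3 * Real.log N := by
  have hN0 : (0 : ℝ) < N := by exact_mod_cast (by omega : 0 < N)
  have h : Real.log 2 ≤ Real.log N := Real.log_le_log (by norm_num) (by exact_mod_cast hN)
  have h1 : Real.log ((2 : ℝ) ^ Nat.clog 2 N) ≤ Real.log (2 * N) :=
    Real.log_le_log (by positivity) (by exact_mod_cast two_pow_clog_le hN)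
  rw [Real.log_pow, Real.log_mul (by norm_num) hN0.ne'] at h1
  have h2 := Real.log_two_gt_d9
  have h3 : (0 : ℝ) ≤ Nat.clog 2 N := Nat.cast_nonneg _
  nlinarith

/-- The choice of the number `M` of steps and of the number `b` of digits. With `u = t / ε`, steps
of length of order `u ^ (-1 / 2)` give the error `ε`; the cost `M * b ^ 2` of the arithmetic is
then of order `t * √u * log² u`, which is at most of order `t * u`. -/
theorem exists_steps {N : ℕ} (hN : 2 ≤ N) {t ε : ℝ} (hε : 0 < ε) (ht : ε / 8 < t) :
    ∃ M b : ℕ, 1 ≤ M ∧ t / M ≤ 1 / 2 ∧ 1 / 2 ^ b ≤ (t / M) ^ 2 ∧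
      M * (36081 * (t / M) ^ 3) < ε ∧
      ((M * (2000 * (Nat.clog 2 N + b ^ 2)) : ℕ) : ℝ) ≤ 10 ^ 12 *
        max (t ^ 2 * Real.log N / ε) (max (Real.log N) (Real.log (1 / ε) ^ 2)) := by
  have ht0 : 0 < t := by linarith
  set G := max (t ^ 2 * Real.log N / ε) (max (Real.log N) (Real.log (1 / ε) ^ 2)) with hG
  have hG1 : t ^ 2 * Real.log N / ε ≤ G := le_max_left _ _
  have hG2 : Real.log N ≤ G := (le_max_left _ _).trans (le_max_right _ _)
  have hG3 : Real.log (1 / ε) ^ 2 ≤ G := (le_max_right _ _).trans (le_max_right _ _)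
  have hlN := half_le_log hN
  have hn := clog_le_log hN
  set u := t / ε with hu
  have hu8 : 1 / 8 < u := by rw [hu, lt_div_iff₀ hε]; linarith
  set w := √u with hw
  have hw2 : w ^ 2 = u := Real.sq_sqrt (by linarith)
  have hw3 : 1 / 3 ≤ w := Real.le_sqrt_of_sq_le (by linarith)
  have hw0 : 0 < w := by linarith
  -- The factor `200` makes `36081 * t * τ₀ ^ 2` less than `ε`, where `36081` is the constant of the
  -- step plus `8` from the remainder of the exponential.
  set τ₀ := min (1 / 2) (1 / (200 * w)) with hτ₀
  have hτ₀0 : 0 < τ₀ := lt_min (by norm_num) (by positivity)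
  have hτ₀1 : τ₀ ≤ 1 / 2 := min_le_left _ _
  have hτ₀2 : τ₀ ≤ 1 / (200 * w) := min_le_right _ _
  have hτ₀3 : 1 / τ₀ ≤ 600 * w := by
    rw [div_le_iff₀ hτ₀0]
    rcases min_choice (1 / 2) (1 / (200 * w)) with h | h
    · rw [hτ₀, h]; linarith
    · rw [hτ₀, h, mul_one_div, le_div_iff₀ (by positivity)]; linarith
  set M := ⌈t / τ₀⌉₊ with hM
  have hM1 : 1 ≤ M := Nat.one_le_iff_ne_zero.2 (Nat.ceil_pos.2 (by positivity)).ne'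
  have hM0 : (0 : ℝ) < M := by exact_mod_cast hM1
  have hMt : t / τ₀ ≤ M := Nat.le_ceil _
  set τ := t / M with hτ
  have hτ0 : 0 < τ := by positivity
  have hττ₀ : τ ≤ τ₀ := by
    rw [hτ, div_le_iff₀ hM0]
    rw [div_le_iff₀ hτ₀0] at hMt
    linarith
  obtain ⟨b, hb, hb2⟩ := exists_precision hτ0 (by linarith)
  refine ⟨M, b, hM1, hττ₀.trans hτ₀1, hb, ?_, ?_⟩
  · have h1 : M * (36081 * τ ^ 3) = 36081 * (t * τ ^ 2) := by
      rw [hτ]; field_simp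
    have h2 : τ ^ 2 ≤ 1 / (40000 * u) := by
      calc τ ^ 2 ≤ (1 / (200 * w)) ^ 2 := by gcongr; exact hττ₀.trans hτ₀2
        _ = 1 / (40000 * u) := by rw [← hw2]; ring
    have h3 : t * (1 / (40000 * u)) = ε / 40000 := by
      rw [hu]; field_simp
    have h4 : t * τ ^ 2 ≤ t * (1 / (40000 * u)) := by gcongr
    rw [h1]
    linarith
  push_cast
  have hl0 : 0 ≤ Real.log (1 / τ) := Real.log_nonneg (by rw [le_div_iff₀ hτ0]; linarith)
  rcases hM1.eq_or_lt with h1 | h1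
  -- A single step: here `τ = t` exceeds `ε / 8`.
  · rw [← h1] at hτ ⊢
    simp only [Nat.cast_one, div_one] at hτ
    have h2 : Real.log (1 / τ) ≤ 3 + Real.log (1 / ε) := by
      have h3 : Real.log (1 / τ) ≤ Real.log (8 * (1 / ε)) := by
        apply Real.log_le_log (by positivity)
        rw [hτ, mul_one_div, div_le_div_iff₀ ht0 hε]
        linarith
      rw [Real.log_mul (by norm_num) (by positivity), show (8 : ℝ) = 2 ^ 3 by norm_num,
        Real.log_pow] at h3
      have := Real.log_two_lt_d9
      push_cast at h3
      linarith
    have h3 : Real.log (1 / τ) ^ 2 ≤ 18 + 2 * Real.log (1 / ε) ^ 2 := by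
      have : Real.log (1 / τ) ^ 2 ≤ (3 + Real.log (1 / ε)) ^ 2 := by gcongr
      nlinarith [sq_nonneg (3 - Real.log (1 / ε))]
    rw [Nat.cast_one, one_mul]
    linarith
  · have h2 : 1 < t / τ₀ := by
      by_contra h
      have : M ≤ 1 := Nat.ceil_le.2 (by simpa using h)
      omega
    have h3 : (M : ℝ) < t / τ₀ + 1 := Nat.ceil_lt_add_one (by positivity)
    have h4 : (M : ℝ) ≤ 1200 * (t * w) := by
      have : t / τ₀ ≤ t * (600 * w) := by
        rw [div_eq_mul_one_div]; gcongr
      linarith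
    have h5 : 1 / τ ≤ 1200 * w := by
      have : τ₀ ≤ 2 * τ := by
        rw [hτ, mul_div_assoc', le_div_iff₀ hM0]
        have h6 : (M : ℝ) ≤ 2 * (t / τ₀) := by linarith
        calc τ₀ * M ≤ τ₀ * (2 * (t / τ₀)) := by gcongr
          _ = 2 * t := by field_simp
      have h6 : 1 / (2 * τ) ≤ 1 / τ₀ := one_div_le_one_div_of_le hτ₀0 this
      have h7 : 1 / τ = 2 * (1 / (2 * τ)) := by field_simp
      rw [h7]
      linarith
    have h6 : Real.log (1 / τ) ^ 2 ≤ 4800 * w := by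
      have h7 := log_sq_le (x := 1 / τ) (by rw [le_div_iff₀ hτ0]; linarith)
      linarith
    have h7 : (Nat.clog 2 N : ℝ) + b ^ 2 ≤ w * (307221 * Real.log N) := by
      have h8 : (Nat.clog 2 N : ℝ) + 2 ≤ 7 * Real.log N := by linarith
      have h9 : 7 * Real.log N ≤ w * (21 * Real.log N) := by nlinarith
      have h10 : w * 153600 ≤ w * (307200 * Real.log N) := by gcongr; linarith
      linarith
    have h8 : (M : ℝ) * (Nat.clog 2 N + b ^ 2) ≤
        1200 * 307221 * (t ^ 2 * Real.log N / ε) := by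
      calc (M : ℝ) * (Nat.clog 2 N + b ^ 2) ≤ 1200 * (t * w) * (w * (307221 * Real.log N)) := by
            gcongr
        _ = 1200 * 307221 * (t * w ^ 2 * Real.log N) := by ring
        _ = 1200 * 307221 * (t ^ 2 * Real.log N / ε) := by rw [hw2, hu]; ring
    have h9 : 0 ≤ t ^ 2 * Real.log N / ε := by positivity
    calc (M : ℝ) * (2000 * (Nat.clog 2 N + b ^ 2)) = 2000 * (M * (Nat.clog 2 N + b ^ 2)) := by ring
      _ ≤ 10 ^ 12 * (t ^ 2 * Real.log N / ε) := by linarith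
      _ ≤ 10 ^ 12 * G := by gcongr

variable {N : ℕ}

/-- For small times, and for large errors, no gates are needed. -/
theorem simulableWithin_of_norm_lt {L : Matrix (Fin N) (Fin N) ℂ} {t ε G : ℝ} (hε : 0 < ε)
    (hG : 0 ≤ G) (h : ‖superCLM (ampliationHom (Fin N)
      (1 - superExp ((t : ℂ) • dissipator L)))‖ < ε) :
    SimulableWithin N (dissipator L) t ε G :=
  implementable_one.simulableWithin hε (by simpa using hG) h

theorem simulableWithin_dissipator_zero {t ε G : ℝ} (ht : 0 ≤ t) (hε : 0 < ε) (hG : 0 ≤ G) :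
    SimulableWithin N (dissipator 0) t ε G := by
  refine simulableWithin_of_norm_lt hε hG ?_
  refine (norm_superCLM_one_sub_superExp_le 0 ht).trans_lt ?_
  simpa using hε

theorem IsLadder.norm_le_one {S : Matrix (Fin N) (Fin N) ℂ} {e p : Fin N → ℝ} {D d T : ℕ}
    (h : IsLadder S e p D d T) : ‖S * realDiag e‖ ≤ 1 := by
  have hS : ‖S‖ * ‖S‖ ≤ 1 := by
    rw [← l2_opNorm_conjTranspose_mul_self, h.isometric]
    refine norm_realDiag_le zero_le_one fun j => ?_
    rcases h.level j with ⟨hp, -⟩ | ⟨hp, -⟩ <;> simp [hp]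
  have he : ‖realDiag e‖ ≤ 1 := norm_realDiag_le zero_le_one fun j => by
    rcases h.level j with ⟨-, he, -⟩ | ⟨-, he, hd, -⟩
    · simp [he]
    · rw [he, abs_of_nonneg (Real.sqrt_nonneg _), Real.sqrt_le_one,
        div_le_one (by exact_mod_cast (by omega : 0 < N))]
      exact_mod_cast hd.le
  have hS1 : ‖S‖ ≤ 1 := by nlinarith [norm_nonneg S]
  exact (norm_mul_le _ _).trans (mul_le_one₀ hS1 (norm_nonneg _) he)

/-- A trivial circuit for large errors and for small times, and a power of a step otherwise. -/
theorem IsLadder.simulableWithin {S : Matrix (Fin N) (Fin N) ℂ} {e p : Fin N → ℝ} {D d T : ℕ}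
    (h : IsLadder S e p D d T) (hN : 2 ≤ N) {t ε : ℝ} (ht : 0 < t) (hε : 0 < ε) :
    SimulableWithin N (dissipator (S * realDiag e)) t ε
      (10 ^ 12 * max (t ^ 2 * Real.log N / ε) (max (Real.log N) (Real.log (1 / ε) ^ 2))) := by
  have hL := h.norm_le_one
  have hG : 0 ≤ 10 ^ 12 *
      max (t ^ 2 * Real.log N / ε) (max (Real.log N) (Real.log (1 / ε) ^ 2)) := by positivity
  rcases lt_or_ge 2 ε with hε2 | hε2
  · exact simulableWithin_of_norm_lt hε hG
      ((norm_superCLM_one_sub_superExp_le_two hL ht.le).trans_lt hε2)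
  rcases le_or_gt t (ε / 8) with htε | htε
  · refine simulableWithin_of_norm_lt hε hG ?_
    refine (norm_superCLM_one_sub_superExp_le _ ht.le).trans_lt ?_
    have h1 : t * (2 * ‖S * realDiag e‖ ^ 2) ≤ ε / 4 := by
      have : ‖S * realDiag e‖ ^ 2 ≤ 1 := pow_le_one₀ (norm_nonneg _) hL
      nlinarith
    have h2 : Real.exp (ε / 4) - 1 ≤ 2 * (ε / 4) := by
      have h3 := Real.abs_exp_sub_one_le (x := ε / 4) (by rw [abs_le]; constructor <;> linarith)
      rw [abs_of_pos (by positivity : 0 < ε / 4)] at h3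
      exact (le_abs_self _).trans h3
    have h3 := Real.exp_le_exp.2 h1
    linarith
  obtain ⟨M, b, hM, hτ, hb, herr, hcost⟩ := exists_steps hN hε htε
  have hM0 : (0 : ℝ) < M := by exact_mod_cast hM
  have hτ0 : 0 ≤ t / M := by positivity
  have hs2 : √(t / M) ^ 2 = t / M := Real.sq_sqrt hτ0
  obtain ⟨Ψ, hΨ, hΨ1, hΨ2⟩ := h.exists_step hN (Real.sqrt_nonneg (t / M))
    (Real.sqrt_le_one.2 (by linarith)) (b := b) (by
      rw [show √(t / M) ^ 4 = (√(t / M) ^ 2) ^ 2 by ring, hs2]; exact hb)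
  rw [hs2] at hΨ2
  have hpow := norm_superCLM_pow_sub_superExp_le hL hΨ1 hτ0 hτ hΨ2 M
  refine (hΨ.pow M).simulableWithin hε hcost ?_
  rw [mul_div_cancel₀ t hM0.ne'] at hpow
  refine hpow.trans_lt (lt_of_eq_of_lt ?_ herr)
  ring

end Cost
end

theorem mainTheorem12 :
    ∃ C : ℝ, 0 < C ∧ ∀ (N : ℕ) (t ε : ℝ), 1 ≤ N → 0 < t → 0 < ε →
      SimulableWithin N (lindbladUp N) t ε
        (C * max (t ^ 2 * Real.log N / ε) (max (Real.log N) (Real.log (1 / ε) ^ 2))) ∧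
      SimulableWithin N (lindbladDown N) t ε
        (C * max (t ^ 2 * Real.log N / ε) (max (Real.log N) (Real.log (1 / ε) ^ 2))) := by
  refine ⟨10 ^ 12, by norm_num, fun N t ε hN ht hε => ?_⟩
  rcases hN.eq_or_lt with rfl | hN
  · have hup : lindbladUp 1 = dissipator 0 := by
      have : creationOp 1 = 0 := by ext i j; simp [creationOp]
      rw [lindbladUp, this, Nat.cast_one, div_one, one_smul]
    have hdown : lindbladDown 1 = dissipator 0 := by
      have : annihilationOp 1 = 0 := by ext i j; simp [annihilationOp]
      rw [lindbladDown, this, Nat.cast_one, div_one, one_smul]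
    rw [hup, hdown]
    constructor <;> exact simulableWithin_dissipator_zero ht.le hε (by positivity)
  · rw [lindbladUp_eq hN, lindbladDown_eq hN]
    exact ⟨(isLadder_up hN).simulableWithin hN ht hε, (isLadder_down hN).simulableWithin hN ht hε⟩
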